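/- Let $\beta>0$ and let $\overset{\circ}{U}_\beta=(\overset{\circ}{U}_\beta(t))_{0\le t\le 1}$ be the Ornstein–Uhlenbeck process starting at zero, i.e. a (jointly measurable) zero-mean Gaussian process on $[0,1]$ with covariance function $$G(t,s)=\frac1{2\beta}\Big(e^{-\beta|t-s|}-e^{-\beta(t+s)}\Big),\qquad t,s\in[0,1].$$ Let $\overline{\overset{\circ}{U}_\beta}(t)=\overset{\circ}{U}_\beta(t)-\int_0^1\overset{\circ}{U}_\beta(s)\,ds$ be the demeaned process, let $\overline G$ be its covariance function, and let $\|\cdot\|$ be the norm of $L_2[0,1]$. Then the integral equation $\int_0^1\overline G(t,s)u(s)\,ds=\mu u(t)$, $u\in L_2[0,1]$, has infinitely many positive eigenvalues, which can be listed in non-increasing order with their multiplicities as $\mu_1\ge\mu_2\ge\dots>0$, and $$\prod_{k=1}^\infty\frac{(\pi k)^{-2}}{\mu_k}=e^{\beta}.$$ Moreover, as $\varepsilon\to0^+$, $$\mathbb P\big\{\|\overline{\overset{\circ}{U}_\beta}\|\le\varepsilon\big\}\sim e^{\beta/2}\,\mathbb P\big\{\|B\|\le\varepsilon\big\}\sim\Big(\frac{8e^\beta}{\pi}\Big)^{1/2}\exp\Big(-\frac18\,\varepsilon^{-2}\Big),$$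 where $B$ is the (jointly measurable) Brownian bridge on $[0,1]$, i.e. the zero-mean Gaussian process with covariance function $\min(t,s)-ts$. -/

import Mathlib

open MeasureTheory ProbabilityTheory Filter Topology Asymptotics

noncomputable section

/-- `X` is a zero-mean Gaussian process on `[0,1]` with covariance function `K`, jointly measurable
in time and chance (up to a null set), so that its path integrals make sense. -/
structure IsCenteredGaussianProcess {Ω : Type*} [MeasurableSpace Ω]
    (K : unitInterval → unitInterval → ℝ) (X : unitInterval → Ω → ℝ) (P : Measure Ω) : Prop where
  gaussian : IsGaussianProcess X P
  aemeasurable : AEMeasurable (fun p : unitInterval × Ω => X p.1 p.2) (volume.prod P)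
  mean_zero : ∀ t, ∫ ω, X t ω ∂P = 0
  covariance : ∀ t s, cov[X t, X s; P] = K t s

/-- Covariance function of the Ornstein–Uhlenbeck process started at zero. -/
def ouZeroKernel (β : ℝ) (t s : unitInterval) : ℝ :=
  1 / (2 * β) * (Real.exp (-β * |(t : ℝ) - s|) - Real.exp (-β * ((t : ℝ) + s)))

/-- Covariance function of the Brownian bridge. -/
def bridgeKernel (t s : unitInterval) : ℝ := min (t : ℝ) s - (t : ℝ) * s

/-- The demeaned (centered) process `X(t) - ∫₀¹ X(s) ds`. -/
def demean {Ω : Type*} (X : unitInterval → Ω → ℝ) (t : unitInterval) (ω : Ω) : ℝ :=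
  X t ω - ∫ s, X s ω

/-- The `L₂[0,1]` norm of a path. -/
def pathNorm {Ω : Type*} (X : unitInterval → Ω → ℝ) (ω : Ω) : ℝ :=
  Real.sqrt (∫ t, X t ω ^ 2)

/-- The small ball probability `P{‖X‖ ≤ ε}`. -/
def smallBall {Ω : Type*} [MeasurableSpace Ω] (X : unitInterval → Ω → ℝ) (P : Measure Ω)
    (ε : ℝ) : ℝ :=
  P.real {ω | pathNorm X ω ≤ ε}

/-- The solutions `u ∈ L₂[0,1]` of the integral equation `∫₀¹ K(t,s) u(s) ds = m u(t)`, `t ∈ [0,1]`.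
For `m ≠ 0` the equation selects one function in each class of almost everywhere equal solutions,
so this is the eigenspace of the integral operator with kernel `K` in `L₂[0,1]`. -/
def kernelEigenspace (K : unitInterval → unitInterval → ℝ) (m : ℝ) :
    Submodule ℝ (unitInterval → ℝ) where
  carrier := {u | MemLp u 2 volume ∧
    ∀ t, Integrable (fun s => K t s * u s) volume ∧ ∫ s, K t s * u s = m * u t}
  zero_mem' := by
    refine ⟨MemLp.zero, fun t => ?_⟩
    simp
  add_mem' := by
    rintro u v ⟨hu, hu'⟩ ⟨hv, hv'⟩
    refine ⟨hu.add hv, fun t => ?_⟩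
    simp only [Pi.add_apply, mul_add]
    refine ⟨(hu' t).1.add (hv' t).1, ?_⟩
    rw [integral_add (hu' t).1 (hv' t).1, (hu' t).2, (hv' t).2]
  smul_mem' := by
    rintro c u ⟨hu, hu'⟩
    refine ⟨hu.const_smul c, fun t => ?_⟩
    simp only [Pi.smul_apply, smul_eq_mul, mul_left_comm _ c]
    refine ⟨(hu' t).1.const_mul c, ?_⟩
    rw [integral_const_mul, (hu' t).2]

/-- `μ 0 ≥ μ 1 ≥ …` is the list of all positive eigenvalues of the integral operator with kernel
`K`, in non-increasing order, each repeated according to its multiplicity. -/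
structure IsEigenvalueSequence (K : unitInterval → unitInterval → ℝ) (μ : ℕ → ℝ) : Prop where
  pos : ∀ k, 0 < μ k
  antitone : Antitone μ
  multiplicity : ∀ m : ℝ, 0 < m →
    Cardinal.mk {k : ℕ // μ k = m} = Module.rank ℝ (kernelEigenspace K m)

end

/-! Write a_k = (π(k+1))², so that 1/a_k are the bridge eigenvalues, and F for `ouCharFun`. The
Ornstein–Uhlenbeck kernel is the Green function of β² - d²/dt² with v(0) = 0 and v'(1) + βv(1) = 0.
Hence each zero ω > 0 of F with sin ω ≠ 0 gives a trigonometric eigenfunction of the centered kernel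
with eigenvalue (ω² + β²)⁻¹. F alternates in sign along the multiples of π, which yields zeros ω_k
with a_k < ω_k² < a_{k+1}.

The product rests on the partial fractions F(t)/(t² sin t) = 1 - ∑ d_k/(t² - a_k) with positive
bounded d_k. A truncation of the right side is a rational function ∏ (w - r_k)/(w - a_k) whose zeros
interlace its poles. As the truncation grows, r_k tends to ω_k² while r_k - a_k stays bounded
uniformly, so dominated convergence carries the finite products to the infinite one. With Euler's
product for sinh this gives ∏ (ω_k² + y²)/a_k = `ouDet β y` for y > 0, which is e^β at y = β
(`exists_ou_frequencies`, `ouDet_self`).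

That no eigenvalue is missing is seen from the trace. Comparing derivatives in y at β in the same
product shows that ∑ (ω_k² + β²)⁻¹ is at least the trace of the operator (`ouTrace_le_tsum`). By
Bessel's inequality, applied path by path, the eigenvalues of an orthonormal system sum to at most
the trace. So a further eigenfunction is impossible (`eigenfunction_eq_zero`), and Bessel's
inequality is an equality for almost every path (`ae_hasSum_sq_pathCoord`).

The coordinates of a path along the eigenfunctions are orthogonal elements of a Gaussian space,
hence independent, and the small ball probability is a limit of probabilities of finite-dimensional
Gaussian balls. Replacing the variances μ_k by 1/a_k multiplies the density by a constant tending to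
√(∏ (1/a_k)/μ_k) = e^{β/2} and by the exponential of a quadratic form with bounded coefficients,
which is e^{O(ε²)} on the ball of radius ε (`limit_gaussianBall_mem`).

For the bridge, the distribution function of ‖B‖² has Laplace transform (2/y²)(sinh y / y)^{-1/2} at
y²/2. Expanding (1 - e^{-2y})^{-1/2} inverts it term by term, and the first term dominates as x → 0
(`isEquivalent_limit_gaussianBall_bridge`). -/

/-! ### Rational functions with interlacing zeros and poles -/

open Polynomial in
/-- A rational function `1 - ∑ dₖ / (w - aₖ)` with positive `dₖ` has exactly one zero to the right of
each of its poles, before the next one. -/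
theorem exists_interlacing_roots {a d : ℕ → ℝ} (ha : StrictMono a) (hd : ∀ k, 0 < d k) (n : ℕ) :
    ∃ r : ℕ → ℝ, (∀ k < n, a k < r k) ∧ (∀ k, k + 1 < n → r k < a (k + 1)) ∧
      ∀ w, (∀ k < n, w ≠ a k) →
        1 - ∑ k ∈ Finset.range n, d k / (w - a k) =
          ∏ k ∈ Finset.range n, (w - r k) / (w - a k) := by
  classical
  set A : ℝ[X] := ∏ k ∈ Finset.range n, (X - C (a k)) with hA
  set S : ℝ[X] := ∑ k ∈ Finset.range n, C (d k) * ∏ j ∈ (Finset.range n).erase k, (X - C (a j))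
    with hS
  -- This is the numerator of the rational function over the common denominator A. It is monic of
  -- degree n, since S has smaller degree.
  set p : ℝ[X] := A - S with hp
  have hAm : A.Monic := monic_prod_X_sub_C _ _
  have hAd : A.degree = n := by
    rw [hA, degree_prod]; simp
  have hSd : S.degree < n := by
    rw [hS]
    refine (degree_sum_le _ _).trans_lt ?_
    refine (Finset.sup_lt_iff (WithBot.bot_lt_coe n)).2 ?_
    intro k hk
    rw [degree_C_mul (hd k).ne', degree_prod]
    simp only [degree_X_sub_C, Finset.sum_const, Finset.card_erase_of_mem hk, Finset.card_range]
    have : 0 < n := by have := Finset.mem_range.1 hk; omega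
    rw [nsmul_one]
    exact WithBot.coe_lt_coe.2 (Nat.sub_lt this one_pos)
  have hpm : p.Monic := hAm.sub_of_left (by rw [hAd]; exact hSd)
  have hpd : p.degree = n := by rw [hp, degree_sub_eq_left_of_degree_lt (by rw [hAd]; exact hSd), hAd]
  have hpe : ∀ k < n, p.eval (a k) =
      -(d k * ∏ j ∈ (Finset.range n).erase k, (a k - a j)) := by
    intro k hk
    have hk' := Finset.mem_range.2 hk
    have h1 : A.eval (a k) = 0 := by
      rw [hA, eval_prod]
      exact Finset.prod_eq_zero hk' (by simp)
    have h2 : S.eval (a k) = d k * ∏ j ∈ (Finset.range n).erase k, (a k - a j) := by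
      rw [hS, eval_finsetSum, Finset.sum_eq_single_of_mem k hk']
      · simp [eval_prod]
      · intro b hb hbk
        rw [eval_mul, eval_prod, Finset.prod_eq_zero (i := k) (by simp [hk, hbk.symm]) (by simp),
          mul_zero]
    rw [hp, eval_sub, h1, h2, zero_sub]
  have hroot : ∀ k < n, ∃ r, a k < r ∧ (k + 1 < n → r < a (k + 1)) ∧ p.eval r = 0 := by
    intro k hk
    by_cases hk1 : k + 1 < n
    · have hlt : a k < a (k + 1) := ha (Nat.lt_succ_self k)
      -- At consecutive poles the two products differ in sign only through the factor a k - a (k +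
      -- 1) and its negative: any other pole lies on the same side of both.
      have hneg : p.eval (a k) * p.eval (a (k + 1)) < 0 := by
        rw [hpe k hk, hpe (k + 1) hk1,
          ← Finset.mul_prod_erase ((Finset.range n).erase k) _ (a := k + 1) (by simp [hk1]),
          ← Finset.mul_prod_erase ((Finset.range n).erase (k + 1)) _ (a := k) (by simp [hk]),
          Finset.erase_right_comm]
        set E := ((Finset.range n).erase (k + 1)).erase k
        have hpos : 0 < (∏ j ∈ E, (a k - a j)) * ∏ j ∈ E, (a (k + 1) - a j) := by
          rw [← Finset.prod_mul_distrib]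
          refine Finset.prod_pos fun j hj => ?_
          simp only [E, Finset.mem_erase, Finset.mem_range] at hj
          rcases lt_or_gt_of_ne hj.1 with h | h
          · exact mul_pos (sub_pos.2 (ha h)) (sub_pos.2 (ha (h.trans (Nat.lt_succ_self k))))
          · have h' : k + 1 < j := by omega
            exact mul_pos_of_neg_of_neg (sub_neg.2 (ha h)) (sub_neg.2 (ha h'))
        have := mul_pos (mul_pos (mul_pos (hd k) (hd (k + 1))) (pow_pos (sub_pos.2 hlt) 2)) hpos
        linarith
      have hc : ContinuousOn (fun x => p.eval x) (Set.Icc (a k) (a (k + 1))) :=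
        p.continuous.continuousOn
      rcases mul_neg_iff.1 hneg with ⟨h1, h2⟩ | ⟨h1, h2⟩
      · obtain ⟨r, hr, hr0⟩ := intermediate_value_Ioo' hlt.le hc ⟨h2, h1⟩
        exact ⟨r, hr.1, fun _ => hr.2, hr0⟩
      · obtain ⟨r, hr, hr0⟩ := intermediate_value_Ioo hlt.le hc ⟨h1, h2⟩
        exact ⟨r, hr.1, fun _ => hr.2, hr0⟩
    -- No pole follows the last one; there the zero comes from p being negative at the pole and
    -- tending to +∞.
    · have hneg : p.eval (a k) < 0 := by
        rw [hpe k hk, neg_lt_zero]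
        refine mul_pos (hd k) (Finset.prod_pos fun j hj => sub_pos.2 (ha ?_))
        simp only [Finset.mem_erase, Finset.mem_range] at hj
        omega
      have htop : Tendsto (fun x => p.eval x) atTop atTop :=
        p.tendsto_atTop_of_leadingCoeff_nonneg (by rw [hpd]; exact_mod_cast (by omega : 0 < n))
          (by rw [hpm.leadingCoeff]; exact zero_le_one)
      obtain ⟨x, hx, hxk⟩ := ((htop.eventually_gt_atTop 0).and (eventually_gt_atTop (a k))).exists
      obtain ⟨r, hr, hr0⟩ := intermediate_value_Ioo hxk.le p.continuous.continuousOn ⟨hneg, hx⟩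
      exact ⟨r, hr.1, fun h => absurd h hk1, hr0⟩
  choose! r hr1 hr2 hr3 using hroot
  have hmono : ∀ i < n, ∀ j < n, i < j → r i < r j := by
    intro i hi j hj hij
    calc r i < a (i + 1) := hr2 i hi (by omega)
      _ ≤ a j := ha.monotone (by omega)
      _ < r j := hr1 j hj
  have hinj : Set.InjOn r (Finset.range n) := by
    intro i hi j hj hij
    simp only [Finset.coe_range, Set.mem_Iio] at hi hj
    rcases lt_trichotomy i j with h | h | h
    · exact absurd hij (hmono i hi j hj h).ne
    · exact h
    · exact absurd hij (hmono j hj i hi h).ne'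
  -- The n zeros found are distinct, so they exhaust a monic polynomial of degree n.
  have hpr : p = ∏ k ∈ Finset.range n, (X - C (r k)) := by
    set q : ℝ[X] := ∏ k ∈ Finset.range n, (X - C (r k)) with hq
    have hqm : q.Monic := monic_prod_X_sub_C _ _
    have hqd : q.degree = n := by rw [hq, degree_prod]; simp
    refine eq_of_degree_sub_lt_of_eval_finset_eq ((Finset.range n).image r) ?_ ?_
    · rw [Finset.card_image_of_injOn hinj, Finset.card_range, ← hpd]
      exact degree_sub_lt_left (by rw [hpd, hqd]) hpm.ne_zero (by rw [hpm.leadingCoeff, hqm.leadingCoeff])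
    · intro x hx
      obtain ⟨k, hk, rfl⟩ := Finset.mem_image.1 hx
      rw [hr3 k (Finset.mem_range.1 hk), hq, eval_prod, Finset.prod_eq_zero hk (by simp)]
  refine ⟨r, hr1, fun k hk => hr2 k (by omega) hk, fun w hw => ?_⟩
  have hne : ∀ k ∈ Finset.range n, w - a k ≠ 0 := fun k hk => sub_ne_zero.2 (hw k (Finset.mem_range.1 hk))
  have hA0 : ∏ k ∈ Finset.range n, (w - a k) ≠ 0 := Finset.prod_ne_zero_iff.2 hne
  rw [Finset.prod_div_distrib, eq_div_iff hA0]
  have h1 : p.eval w = ∏ k ∈ Finset.range n, (w - r k) := by simp [hpr, eval_prod]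
  rw [← h1, hp, eval_sub, hA, hS, eval_finsetSum, eval_prod, sub_mul, one_mul, Finset.sum_mul]
  congr 1
  · simp
  · refine Finset.sum_congr rfl fun k hk => ?_
    rw [← Finset.mul_prod_erase _ _ hk, eval_mul, eval_prod]
    simp only [eval_C, eval_sub, eval_X]
    field_simp [hne k hk]

theorem div_sub_lt_div_sub {d a v w : ℝ} (hd : 0 < d) (hvw : v < w) (h : a < v ∨ w < a) :
    d / (w - a) < d / (v - a) := by
  rcases h with h | h
  · exact div_lt_div_of_pos_left hd (by linarith) (by linarith)
  · rw [← neg_lt_neg_iff, ← div_neg, ← div_neg]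
    exact div_lt_div_of_pos_left hd (by linarith) (by linarith)

theorem lt_or_lt_of_mem_gap {a : ℕ → ℝ} (ha : StrictMono a) {k : ℕ} {v w : ℝ}
    (hv : a k < v) (hw : w < a (k + 1)) (j : ℕ) : a j < v ∨ w < a j := by
  rcases le_or_gt j k with h | h
  · exact .inl ((ha.monotone h).trans_lt hv)
  · exact .inr (hw.trans_le (ha.monotone h))

theorem ne_of_mem_gap {a : ℕ → ℝ} (ha : StrictMono a) {k : ℕ} {w : ℝ}
    (hv : a k < w) (hw : w < a (k + 1)) (j : ℕ) : w ≠ a j := by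
  rcases lt_or_lt_of_mem_gap ha hv hw j with h | h
  · exact h.ne'
  · exact h.ne

theorem sum_div_sub_strictAnti {a d : ℕ → ℝ} (ha : StrictMono a) (hd : ∀ k, 0 < d k) {k n : ℕ}
    (hn : 0 < n) {v w : ℝ} (hv : a k < v) (hvw : v < w) (hw : w < a (k + 1)) :
    ∑ j ∈ Finset.range n, d j / (w - a j) < ∑ j ∈ Finset.range n, d j / (v - a j) :=
  Finset.sum_lt_sum_of_nonempty (by simpa using hn.ne')
    fun j _ => div_sub_lt_div_sub (hd j) hvw (lt_or_lt_of_mem_gap ha hv hw j)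

theorem tsum_div_sub_strictAnti {a d : ℕ → ℝ} (ha : StrictMono a) (hd : ∀ k, 0 < d k)
    (hs : ∀ w, (∀ k, w ≠ a k) → Summable fun k => d k / (w - a k)) {k : ℕ}
    {v w : ℝ} (hv : a k < v) (hvw : v < w) (hw : w < a (k + 1)) :
    ∑' j, d j / (w - a j) < ∑' j, d j / (v - a j) :=
  Summable.tsum_lt_tsum (i := 0)
    (fun j => (div_sub_lt_div_sub (hd j) hvw (lt_or_lt_of_mem_gap ha hv hw j)).le)
    (div_sub_lt_div_sub (hd 0) hvw (lt_or_lt_of_mem_gap ha hv hw 0))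
    (hs w (ne_of_mem_gap ha (hv.trans hvw) hw)) (hs v (ne_of_mem_gap ha hv (hvw.trans hw)))

/-- The zeros of the truncations of `1 - ∑ dₖ / (w - aₖ)` converge to the zeros of the full series. -/
theorem tendsto_truncated_root {a d : ℕ → ℝ} (ha : StrictMono a) (hd : ∀ k, 0 < d k)
    (hs : ∀ w, (∀ k, w ≠ a k) → Summable fun k => d k / (w - a k)) {r : ℕ → ℕ → ℝ}
    (hr1 : ∀ n, ∀ k < n, a k < r n k) (hr2 : ∀ n k, k + 1 < n → r n k < a (k + 1))
    (hr3 : ∀ n, ∀ k, k + 1 < n → ∑ j ∈ Finset.range n, d j / (r n k - a j) = 1)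
    {k : ℕ} {w : ℝ} (hw1 : a k < w) (hw2 : w < a (k + 1)) (hw : ∑' j, d j / (w - a j) = 1) :
    Tendsto (fun n => r n k) atTop (𝓝 w) := by
  refine tendsto_order.2 ⟨fun v hv => ?_, fun v hv => ?_⟩
  -- The full series decreases on the gap, so it exceeds 1 at a point u left of w, and so do the
  -- late truncations. These also decrease on the gap, which puts their zeros to the right of u. The
  -- upper bound is symmetric.
  · obtain ⟨u, hu1, hu2⟩ := exists_between (max_lt hv hw1)
    rw [max_lt_iff] at hu1
    have h1 := tsum_div_sub_strictAnti ha hd hs hu1.2 hu2 hw2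
    rw [hw] at h1
    have h2 := (hs u (ne_of_mem_gap ha hu1.2 (hu2.trans hw2))).hasSum.tendsto_sum_nat
    filter_upwards [h2.eventually_const_lt h1, eventually_gt_atTop (k + 1)] with n hn hkn
    refine hu1.1.trans ?_
    by_contra hcon
    push Not at hcon
    rcases hcon.lt_or_eq with hlt | heq
    · have := sum_div_sub_strictAnti ha hd (n := n) (by omega) (hr1 n k (by omega)) hlt
        (hu2.trans hw2)
      rw [hr3 n k hkn] at this
      exact lt_asymm hn this
    · rw [← heq, hr3 n k hkn] at hn
      exact lt_irrefl _ hn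
  · obtain ⟨u, hu1, hu2⟩ := exists_between (lt_min hv hw2)
    rw [lt_min_iff] at hu2
    have h1 := tsum_div_sub_strictAnti ha hd hs hw1 hu1 hu2.2
    rw [hw] at h1
    have h2 := (hs u (ne_of_mem_gap ha (hw1.trans hu1) hu2.2)).hasSum.tendsto_sum_nat
    filter_upwards [h2.eventually_lt_const h1, eventually_gt_atTop (k + 1)] with n hn hkn
    refine lt_of_le_of_lt ?_ hu2.1
    by_contra hcon
    push Not at hcon
    have := sum_div_sub_strictAnti ha hd (n := n) (by omega) (hw1.trans hu1) hcon (hr2 n k hkn)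
    rw [hr3 n k hkn] at this
    exact lt_asymm hn this

/-- Since (k+1)² - (j+1)² ≥ k(k - j), the sum is at most the Cesàro mean of 1/(i+1), with i = k - 1
- j. It bounds the influence of the poles to the left of a given one. -/
theorem tendsto_sum_inv_sq_sub_sq :
    Tendsto (fun k : ℕ => ∑ j ∈ Finset.range k, 1 / (((k : ℝ) + 1) ^ 2 - ((j : ℝ) + 1) ^ 2))
      atTop (𝓝 0) := by
  have h1 : Tendsto (fun n : ℕ => (n : ℝ)⁻¹ * ∑ i ∈ Finset.range n, 1 / ((i : ℝ) + 1)) atTop (𝓝 0) :=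
    (tendsto_one_div_add_atTop_nhds_zero_nat (𝕜 := ℝ)).cesaro
  refine squeeze_zero (fun k => Finset.sum_nonneg fun j hj => ?_) (fun k => ?_) h1
  · have : (j : ℝ) < k := by exact_mod_cast Finset.mem_range.1 hj
    have h0 : (0 : ℝ) ≤ j := j.cast_nonneg
    exact one_div_nonneg.2 (by nlinarith)
  · rw [Finset.mul_sum, ← Finset.sum_range_reflect]
    refine Finset.sum_le_sum fun j hj => ?_
    have hjk := Finset.mem_range.1 hj
    have hk : (0 : ℝ) < k := by exact_mod_cast (by omega : 0 < k)
    have hj0 : (0 : ℝ) ≤ j := j.cast_nonneg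
    have hjk' : (j : ℝ) + 1 ≤ k := by exact_mod_cast hjk
    have hc : ((k - 1 - j : ℕ) : ℝ) = k - 1 - j := by
      rw [Nat.cast_sub (by omega), Nat.cast_sub (by omega)]; simp
    rw [hc, inv_mul_eq_div, div_div]
    refine one_div_le_one_div_of_le (by positivity) ?_
    nlinarith

/-- Uniform distance of the zeros of the truncations from the poles `(π (k + 1))²`. -/
theorem exists_root_bound {d : ℕ → ℝ} {D : ℝ} (hd : ∀ k, 0 < d k) (hD : ∀ k, d k ≤ D)
    {r : ℕ → ℕ → ℝ}
    (hr : ∀ (n k : ℕ) (w : ℝ), k < n → (Real.pi * (k + 1)) ^ 2 < w → w < (Real.pi * ((k + 1 : ℕ) + 1)) ^ 2 →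
      ∑ j ∈ Finset.range n, d j / (w - (Real.pi * (j + 1)) ^ 2) < 1 → r n k ≤ w)
    (hr2 : ∀ n k : ℕ, k + 1 < n → r n k < (Real.pi * ((k + 1 : ℕ) + 1)) ^ 2) :
    ∃ M, ∀ᶠ n in atTop, ∀ k < n, r n k - (Real.pi * (k + 1)) ^ 2 ≤ M := by
  have hpi := Real.pi_gt_three
  have hD0 : 0 < D := (hd 0).trans_le (hD 0)
  have h1 := tendsto_sum_inv_sq_sub_sq.const_mul (D / Real.pi ^ 2)
  rw [mul_zero] at h1
  have h2 : Tendsto (fun k : ℕ => (k : ℝ)) atTop atTop := tendsto_natCast_atTop_atTop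
  obtain ⟨K, hK⟩ := eventually_atTop.1
    ((h1.eventually_lt_const (by norm_num : (0 : ℝ) < 1 / 2)).and (h2.eventually_gt_atTop (2 * D)))
  -- At distance 2D beyond the k-th pole its own term is at most 1/2, the poles on the left add less
  -- than 1/2 by the Cesàro estimate, and those on the right add nothing positive. The condition 2D
  -- < k keeps this point before the next pole.
  have hbig : ∀ k ≥ K, ∀ n > k, r n k - (Real.pi * (k + 1)) ^ 2 ≤ 2 * D := by
    intro k hk n hn
    obtain ⟨hK1, hK2⟩ := hK k hk
    rw [sub_le_iff_le_add']
    have hk0 : (0 : ℝ) ≤ k := k.cast_nonneg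
    have hup : (Real.pi * (k + 1)) ^ 2 + 2 * D < (Real.pi * ((k + 1 : ℕ) + 1)) ^ 2 := by
      push_cast
      have : (1 : ℝ) < Real.pi ^ 2 := by nlinarith
      rw [mul_pow, mul_pow]
      nlinarith
    refine hr n k _ hn (by linarith) hup ?_
    have hsub : Finset.range (k + 1) ⊆ Finset.range n := Finset.range_subset_range.2 hn
    have hle : ∑ j ∈ Finset.range n,
        d j / ((Real.pi * (k + 1)) ^ 2 + 2 * D - (Real.pi * (j + 1)) ^ 2) ≤
        ∑ j ∈ Finset.range (k + 1),
        d j / ((Real.pi * (k + 1)) ^ 2 + 2 * D - (Real.pi * (j + 1)) ^ 2) := by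
      rw [← Finset.sum_sdiff hsub, add_le_iff_nonpos_left]
      refine Finset.sum_nonpos fun j hj => div_nonpos_of_nonneg_of_nonpos (hd j).le ?_
      rw [sub_nonpos]
      refine hup.le.trans ?_
      simp only [Finset.mem_sdiff, Finset.mem_range, not_lt] at hj
      have : ((k + 1 : ℕ) : ℝ) ≤ j := by exact_mod_cast hj.2
      gcongr
    refine hle.trans_lt ?_
    rw [Finset.sum_range_succ]
    have h3 : d k / ((Real.pi * (k + 1)) ^ 2 + 2 * D - (Real.pi * (k + 1)) ^ 2) ≤ 1 / 2 := by
      rw [add_sub_cancel_left, div_le_div_iff₀ (by positivity) (by norm_num)]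
      linarith [hD k]
    have h4 : ∑ j ∈ Finset.range k,
        d j / ((Real.pi * (k + 1)) ^ 2 + 2 * D - (Real.pi * (j + 1)) ^ 2) ≤
        D / Real.pi ^ 2 *
          ∑ j ∈ Finset.range k, 1 / (((k : ℝ) + 1) ^ 2 - ((j : ℝ) + 1) ^ 2) := by
      rw [Finset.mul_sum]
      refine Finset.sum_le_sum fun j hj => ?_
      have hjk : (j : ℝ) < k := by exact_mod_cast Finset.mem_range.1 hj
      have hj0 : (0 : ℝ) ≤ j := j.cast_nonneg
      have hpos : 0 < ((k : ℝ) + 1) ^ 2 - ((j : ℝ) + 1) ^ 2 := by nlinarith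
      rw [div_mul_div_comm, mul_one]
      refine div_le_div₀ hD0.le (hD j) (by positivity) ?_
      rw [mul_pow, mul_pow]
      nlinarith
    linarith
  -- For the finitely many k < K the next pole is a sufficient bound; their sum dominates each of
  -- them.
  refine ⟨max (2 * D) (∑ k ∈ Finset.range K, (Real.pi * ((k + 1 : ℕ) + 1)) ^ 2), ?_⟩
  filter_upwards [eventually_gt_atTop K] with n hn k hk
  rcases le_or_gt K k with h | h
  · exact (hbig k h n hk).trans (le_max_left _ _)
  · refine le_trans ?_ (le_max_right _ _)
    refine le_trans ?_ (Finset.single_le_sum (f := fun k : ℕ => (Real.pi * ((k + 1 : ℕ) + 1)) ^ 2)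
      (fun i _ => sq_nonneg _) (Finset.mem_range.2 h))
    have := hr2 n k (by omega)
    have h0 : 0 ≤ (Real.pi * (k + 1)) ^ 2 := sq_nonneg _
    linarith

/-! ### Dirichlet eigenvalues and the infinite product over the zeros -/

/-- The eigenvalues `(π (k + 1))²` of the Dirichlet problem for `-u''` on `[0,1]`. -/
noncomputable def dirichletEigenvalue (k : ℕ) : ℝ := (Real.pi * (k + 1)) ^ 2

theorem dirichletEigenvalue_pos (k : ℕ) : 0 < dirichletEigenvalue k := by
  unfold dirichletEigenvalue; positivity

theorem dirichletEigenvalue_strictMono : StrictMono dirichletEigenvalue := by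
  intro i j hij
  unfold dirichletEigenvalue
  have : (i : ℝ) < j := by exact_mod_cast hij
  gcongr

theorem summable_inv_dirichletEigenvalue : Summable fun k => (dirichletEigenvalue k)⁻¹ := by
  have h := (summable_nat_add_iff 1).2 (Real.summable_one_div_nat_pow.2 one_lt_two)
  refine (h.mul_left (Real.pi ^ 2)⁻¹).congr fun k => ?_
  simp only [dirichletEigenvalue, mul_pow, mul_inv, one_div]
  push_cast
  rfl

theorem tendsto_dirichletEigenvalue : Tendsto dirichletEigenvalue atTop atTop := by
  have h := summable_inv_dirichletEigenvalue.tendsto_atTop_zero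
  have h2 : Tendsto (fun k => (dirichletEigenvalue k)⁻¹) atTop (𝓝[>] 0) :=
    tendsto_nhdsWithin_iff.2 ⟨h, .of_forall fun k => inv_pos.2 (dirichletEigenvalue_pos k)⟩
  exact h2.inv_tendsto_nhdsGT_zero.congr fun k => inv_inv _

theorem summable_div_sub_dirichletEigenvalue {d : ℕ → ℝ} {D : ℝ} (hd : ∀ k, 0 < d k)
    (hD : ∀ k, d k ≤ D) (w : ℝ) : Summable fun k => d k / (w - dirichletEigenvalue k) := by
  refine Summable.of_norm_bounded_eventually_nat
    (summable_inv_dirichletEigenvalue.mul_left (2 * D)) ?_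
  filter_upwards [tendsto_dirichletEigenvalue.eventually_gt_atTop (2 * |w|)] with k hk
  have hp := dirichletEigenvalue_pos k
  have h1 : dirichletEigenvalue k / 2 ≤ |w - dirichletEigenvalue k| := by
    rw [abs_sub_comm]
    refine le_trans ?_ (le_abs_self _)
    have := le_abs_self w
    linarith
  have hD0 : 0 ≤ D := (hd 0).le.trans (hD 0)
  rw [norm_div, Real.norm_eq_abs, Real.norm_eq_abs, abs_of_pos (hd k), ← div_eq_mul_inv]
  calc d k / |w - dirichletEigenvalue k| ≤ D / (dirichletEigenvalue k / 2) :=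
        div_le_div₀ hD0 (hD k) (by positivity) h1
    _ = 2 * D / dirichletEigenvalue k := by field_simp

/-- Product formula for `1 - ∑ dₖ / (w - aₖ)`, where `aₖ` are the Dirichlet eigenvalues and `dₖ` is
bounded, and distance of its zeros from the poles. -/
theorem tendsto_prod_of_roots {d : ℕ → ℝ} {D : ℝ} (hd : ∀ k, 0 < d k) (hD : ∀ k, d k ≤ D)
    {w : ℕ → ℝ} (hw1 : ∀ k, dirichletEigenvalue k < w k)
    (hw2 : ∀ k, w k < dirichletEigenvalue (k + 1))
    (hw : ∀ k, ∑' j, d j / (w k - dirichletEigenvalue j) = 1) :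
    (∃ M, ∀ k, w k - dirichletEigenvalue k ≤ M) ∧
    ∀ s, 0 ≤ s → Tendsto
      (fun n => ∏ k ∈ Finset.range n, (w k + s) / (dirichletEigenvalue k + s)) atTop
      (𝓝 (1 + ∑' j, d j / (s + dirichletEigenvalue j))) := by
  set a := dirichletEigenvalue with ha
  have ham := dirichletEigenvalue_strictMono
  have hap := dirichletEigenvalue_pos
  have hs := summable_div_sub_dirichletEigenvalue hd hD
  choose r hr1 hr2 hr3 using exists_interlacing_roots ham hd
  have hr4 : ∀ n, ∀ k, k + 1 < n → ∑ j ∈ Finset.range n, d j / (r n k - a j) = 1 := by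
    intro n k hk
    have h := hr3 n (r n k) fun j _ => ne_of_mem_gap ham (hr1 n k (by omega)) (hr2 n k hk) j
    rw [Finset.prod_eq_zero (i := k) (Finset.mem_range.2 (by omega)) (by simp)] at h
    linarith
  have hlim : ∀ k, Tendsto (fun n => r n k) atTop (𝓝 (w k)) := fun k =>
    tendsto_truncated_root ham hd (fun w _ => hs w) hr1 hr2 hr4 (hw1 k) (hw2 k) (hw k)
  obtain ⟨M, hM⟩ : ∃ M, ∀ᶠ n in atTop, ∀ k < n, r n k - a k ≤ M := by
    refine exists_root_bound hd hD (r := r) ?_ hr2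
    intro n k v hkn hv1 hv2 hlt
    by_contra hcon
    push Not at hcon
    have hlast : ∀ j, v < a j ∨ a j < r n j ∨ n ≤ j := fun j => by
      rcases lt_or_ge j n with h | h
      · exact .inr (.inl (hr1 n j h))
      · exact .inr (.inr h)
    have h := hr3 n v fun j _ => ne_of_mem_gap ham hv1 hv2 j
    -- Between the pole a k and the zero r n k the k-th factor is negative, and by interlacing all
    -- others are positive. So the sum at v would exceed 1.
    have hneg : ∏ j ∈ Finset.range n, (v - r n j) / (v - a j) < 0 := by
      rw [← Finset.mul_prod_erase _ _ (Finset.mem_range.2 hkn)]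
      refine mul_neg_of_neg_of_pos (div_neg_of_neg_of_pos (by linarith) (sub_pos.2 hv1))
        (Finset.prod_pos fun j hj => ?_)
      simp only [Finset.mem_erase, Finset.mem_range] at hj
      rcases lt_or_gt_of_ne hj.1 with hjk | hjk
      · have h1 : r n j < a (j + 1) := hr2 n j (by omega)
        have h2 : a (j + 1) ≤ a k := ham.monotone hjk
        have h3 : a j < a k := ham hjk
        have h4 : a k < v := hv1
        exact div_pos (by linarith) (by linarith)
      · have h1 : a j < r n j := hr1 n j hj.2
        have h2 : a (k + 1) ≤ a j := ham.monotone hjk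
        have h3 : v < a (k + 1) := hv2
        exact div_pos_of_neg_of_neg (by linarith) (by linarith)
    rw [← h] at hneg
    have hlt' : ∑ j ∈ Finset.range n, d j / (v - a j) < 1 := hlt
    linarith
  refine ⟨⟨M, fun k => ?_⟩, fun s hs0 => ?_⟩
  · refine le_of_tendsto ((hlim k).sub_const (a k)) ?_
    filter_upwards [hM, eventually_gt_atTop k] with n hn hk using hn k hk
  have hfac : ∀ k, 0 < (w k + s) / (a k + s) := fun k =>
    div_pos (by linarith [hap k, hw1 k]) (by linarith [hap k])
  have hbound : Summable fun k => M / a k := by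
    simpa only [div_eq_mul_inv] using summable_inv_dirichletEigenvalue.mul_left M
  have hM0 : 0 ≤ M := by
    obtain ⟨n, hn, hn0⟩ := (hM.and (eventually_gt_atTop 0)).exists
    have := hn 0 hn0
    have := hr1 n 0 hn0
    linarith
  have hlog : ∀ v k, a k ≤ v → v - a k ≤ M →
      ‖Real.log ((v + s) / (a k + s))‖ ≤ M / a k := by
    intro v k h1 h2
    have h0 := hap k
    have h3 : (1 : ℝ) ≤ (v + s) / (a k + s) := by
      rw [one_le_div (by positivity)]; linarith
    rw [Real.norm_of_nonneg (Real.log_nonneg h3)]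
    refine (Real.log_le_sub_one_of_pos (by linarith)).trans ?_
    rw [div_sub_one (by positivity)]
    exact div_le_div₀ hM0 (by linarith) h0 (by linarith)
  -- Logarithms turn the products into sums, extended by zero beyond n. The uniform bound on r n k -
  -- a k gives the summable majorant M / a k.
  have hdom := tendsto_tsum_of_dominated_convergence
    (f := fun n k => if k < n then Real.log ((r n k + s) / (a k + s)) else 0)
    (g := fun k => Real.log ((w k + s) / (a k + s))) hbound (𝓕 := atTop)
    (fun k => by
      refine Tendsto.congr' ?_ ((((hlim k).add_const s).div_const (a k + s)).log (hfac k).ne')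
      filter_upwards [eventually_gt_atTop k] with n hn
      rw [if_pos hn])
    (by
      filter_upwards [hM] with n hn k
      split_ifs with hkn
      · exact hlog _ k (hr1 n k hkn).le (hn k hkn)
      · rw [norm_zero]
        exact div_nonneg hM0 (hap k).le)
  have hMw : ∀ k, w k - a k ≤ M := fun k => by
    refine le_of_tendsto ((hlim k).sub_const (a k)) ?_
    filter_upwards [hM, eventually_gt_atTop k] with n hn hk using hn k hk
  have hsum : Summable fun k => Real.log ((w k + s) / (a k + s)) :=
    Summable.of_norm_bounded hbound fun k => hlog _ k (hw1 k).le (hMw k)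
  have hser : Tendsto (fun n => 1 - ∑ j ∈ Finset.range n, d j / (-s - a j)) atTop
      (𝓝 (1 + ∑' j, d j / (s + a j))) := by
    have h1 := ((hs (-s)).hasSum.tendsto_sum_nat).const_sub 1
    have h2 : ∑' j, d j / (s + a j) = -∑' j, d j / (-s - a j) := by
      rw [← tsum_neg]
      refine tsum_congr fun j => ?_
      rw [← div_neg]; congr 1; ring
    rw [h2, ← sub_eq_add_neg]
    exact h1
  have hexp := (Real.continuous_exp.tendsto _).comp hdom
  -- The truncated identity is evaluated at w = -s, which lies to the left of all poles.
  have hkey : ∀ᶠ n in atTop, (Real.exp ∘ fun n => ∑' k, if k < n then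
      Real.log ((r n k + s) / (a k + s)) else 0) n =
      1 - ∑ j ∈ Finset.range n, d j / (-s - a j) := by
    refine .of_forall fun n => ?_
    rw [hr3 n (-s) fun k _ => by linarith [hap k]]
    simp only [Function.comp]
    rw [tsum_eq_sum (s := Finset.range n) (fun k hk => if_neg (by simpa using hk)), Real.exp_sum]
    refine Finset.prod_congr rfl fun k hk => ?_
    have hk' := Finset.mem_range.1 hk
    rw [if_pos hk', Real.exp_log (div_pos (by linarith [hap k, hr1 n k hk']) (by linarith [hap k])),
      ← neg_div_neg_eq]
    congr 1 <;> ring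
  have heq := tendsto_nhds_unique (hexp.congr' hkey) hser
  rw [← heq]
  refine ((Real.continuous_exp.tendsto _).comp hsum.hasSum.tendsto_sum_nat).congr fun n => ?_
  simp only [Function.comp]
  rw [Real.exp_sum]
  exact Finset.prod_congr rfl fun k _ => Real.exp_log (hfac k)

/-! ### Partial fractions of the characteristic function -/

theorem tsum_inv_dirichletEigenvalue : ∑' k, (dirichletEigenvalue k)⁻¹ = 1 / 6 := by
  have h := (hasSum_nat_add_iff' 1).2 hasSum_zeta_two
  simp only [Finset.range_one, Finset.sum_singleton, Nat.cast_zero, ne_eq, OfNat.ofNat_ne_zero,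
    not_false_eq_true, zero_pow, div_zero, sub_zero] at h
  have h2 := h.mul_left (Real.pi ^ 2)⁻¹
  have h3 : (Real.pi ^ 2)⁻¹ * (Real.pi ^ 2 / 6) = 1 / 6 := by
    field_simp
  rw [h3] at h2
  refine Eq.trans (tsum_congr fun k => ?_) h2.tsum_eq
  simp only [dirichletEigenvalue, mul_pow, mul_inv, one_div]
  push_cast
  rfl

/-- The Mittag-Leffler expansion of π cot(πx) at x = z/π, with the poles ±(k+1) paired. A complex z
is used so that real and purely imaginary values give the cot and coth sums alike. -/
theorem cot_div_eq_tsum {z : ℂ} (hz : Complex.sin z ≠ 0) :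
    (Complex.cos z / Complex.sin z - 1 / z) / (2 * z) =
      ∑' k, 1 / (z ^ 2 - (dirichletEigenvalue k : ℂ)) := by
  have hpi : (Real.pi : ℂ) ≠ 0 := Complex.ofReal_ne_zero.2 Real.pi_ne_zero
  have hz0 : z ≠ 0 := by rintro rfl; simp at hz
  have hx : z / Real.pi ∈ Complex.integerComplement := by
    rintro ⟨n, hn⟩
    apply hz
    rw [Complex.sin_eq_zero_iff]
    exact ⟨n, by rw [hn]; field_simp⟩
  have h := cot_series_rep' hx
  rw [mul_div_cancel₀ _ hpi, Complex.cot] at h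
  rw [div_eq_iff (by simp [hz0]), ← mul_right_inj' hpi, mul_sub]
  have h1 : (Real.pi : ℂ) * (1 / z) = 1 / (z / Real.pi) := by field_simp
  rw [h1, h, ← tsum_mul_right, ← tsum_mul_left]
  refine tsum_congr fun k => ?_
  have e1 : z / Real.pi - (k + 1) ≠ 0 := by
    intro h0
    exact hx ⟨k + 1, by push_cast; linear_combination -h0⟩
  have e2 : z / Real.pi + (k + 1) ≠ 0 := by
    intro h0
    exact hx ⟨-(k + 1), by push_cast; linear_combination -h0⟩
  have e1' : z - Real.pi * (k + 1) ≠ 0 := by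
    intro h0; apply e1; field_simp; linear_combination h0
  have e2' : z + Real.pi * (k + 1) ≠ 0 := by
    intro h0; apply e2; field_simp; linear_combination h0
  have e3 : z ^ 2 - (dirichletEigenvalue k : ℂ) = (z - Real.pi * (k + 1)) * (z + Real.pi * (k + 1)) := by
    simp only [dirichletEigenvalue]; push_cast; ring
  have f1 : z / Real.pi - (k + 1) = (z - Real.pi * (k + 1)) / Real.pi := by field_simp
  have f2 : z / Real.pi + (k + 1) = (z + Real.pi * (k + 1)) / Real.pi := by field_simp
  rw [e3, f1, f2]
  field_simp
  ring

theorem tsum_inv_sq_sub_dirichletEigenvalue {t : ℝ} (ht : Real.sin t ≠ 0) :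
    ∑' k, 1 / (t ^ 2 - dirichletEigenvalue k) =
      (Real.cos t / Real.sin t - 1 / t) / (2 * t) := by
  have h := cot_div_eq_tsum (z := t) (by exact_mod_cast ht)
  exact_mod_cast h.symm

theorem tsum_inv_neg_sq_sub_dirichletEigenvalue {y : ℝ} (hy : 0 < y) :
    ∑' k, 1 / (-y ^ 2 - dirichletEigenvalue k) =
      -(Real.cosh y / Real.sinh y - 1 / y) / (2 * y) := by
  have hs : Complex.sinh y ≠ 0 := by
    rw [← Complex.ofReal_sinh]
    exact_mod_cast (Real.sinh_pos_iff.2 hy).ne'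
  have hy' : (y : ℂ) ≠ 0 := by exact_mod_cast hy.ne'
  have h := cot_div_eq_tsum (z := y * Complex.I) (by
    rw [Complex.sin_mul_I]; exact mul_ne_zero hs Complex.I_ne_zero)
  rw [Complex.sin_mul_I, Complex.cos_mul_I, mul_pow, Complex.I_sq] at h
  have h2 : (Complex.cosh y / (Complex.sinh y * Complex.I) - 1 / (y * Complex.I)) /
      (2 * (y * Complex.I)) = -(Complex.cosh y / Complex.sinh y - 1 / y) / (2 * y) := by
    field_simp
    rw [Complex.I_sq]; ring
  rw [h2, mul_neg_one] at h
  exact_mod_cast h.symm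

/-- The weights in the partial fraction expansion of the characteristic function of the demeaned
Ornstein–Uhlenbeck process. -/
noncomputable def ouWeight (β : ℝ) (k : ℕ) : ℝ :=
  2 * β ^ 2 + 4 * β * (1 + (-1) ^ k) * (1 + β ^ 2 * (dirichletEigenvalue k)⁻¹)

theorem ouWeight_pos {β : ℝ} (hβ : 0 < β) (k : ℕ) : 0 < ouWeight β k := by
  have h1 : (0 : ℝ) ≤ 1 + (-1) ^ k := by rcases neg_one_pow_eq_or ℝ k with h | h <;> simp [h]
  have h2 := inv_pos.2 (dirichletEigenvalue_pos k)
  unfold ouWeight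
  positivity

theorem ouWeight_le {β : ℝ} (hβ : 0 < β) (k : ℕ) :
    ouWeight β k ≤ 2 * β ^ 2 + 8 * β * (1 + β ^ 2) := by
  have h2 := inv_pos.2 (dirichletEigenvalue_pos k)
  have h3 : (dirichletEigenvalue k)⁻¹ ≤ 1 := by
    refine inv_le_one_of_one_le₀ ?_
    have := Real.pi_gt_three
    have hk : (0 : ℝ) ≤ k := k.cast_nonneg
    exact one_le_pow₀ (by nlinarith)
  have h4 : β ^ 2 * (dirichletEigenvalue k)⁻¹ ≤ β ^ 2 := mul_le_of_le_one_right (sq_nonneg β) h3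
  have h5 : 0 ≤ β ^ 2 * (dirichletEigenvalue k)⁻¹ := by positivity
  unfold ouWeight
  rcases neg_one_pow_eq_or ℝ k with h | h <;> rw [h] <;> nlinarith

/-- The factor is 2 at even and 0 at odd indices. For sums over the Dirichlet eigenvalues the odd
part is again a full sum, because the eigenvalue of index 2k + 1 is four times that of index k. -/
theorem hasSum_one_add_neg_one_pow_mul {f : ℕ → ℝ} (hf : Summable f) :
    HasSum (fun k => (1 + (-1) ^ k) * f k) (2 * (∑' k, f k - ∑' k, f (2 * k + 1))) := by
  have ho : Summable fun k => f (2 * k + 1) := hf.comp_injective (fun i j h => by simpa using h)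
  have h1 : HasSum (fun k => if Odd k then f k else 0) (∑' k, f (2 * k + 1)) := by
    have he : HasSum (fun k => if Odd (2 * k) then f (2 * k) else 0) 0 := by
      convert! (hasSum_zero : HasSum (fun _ : ℕ => (0 : ℝ)) 0) using 1
      funext k
      exact if_neg (Nat.not_odd_iff_even.2 (even_two_mul k))
    have ho' : HasSum (fun k => if Odd (2 * k + 1) then f (2 * k + 1) else 0)
        (∑' k, f (2 * k + 1)) := by
      convert! ho.hasSum using 1
      funext k
      exact if_pos (odd_two_mul_add_one k)
    simpa using! he.even_add_odd (f := fun k => if Odd k then f k else 0) ho'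
  convert! (hf.hasSum.sub h1).mul_left 2 using 1
  funext k
  rcases Nat.even_or_odd k with h | h
  · rw [h.neg_one_pow, if_neg (Nat.not_odd_iff_even.2 h)]; ring
  · simp [h.neg_one_pow, h]

/-- The identity 1/(a(w - a)) = (1/(w - a) + 1/a)/w removes the reciprocal eigenvalue from the
weight, and the odd terms turn into the sum at w/4. The last summand is (4β³/w) · 2(1/6 - 1/24). -/
theorem tsum_ouWeight_div {β w : ℝ} (hw : w ≠ 0) (hwk : ∀ k, w ≠ dirichletEigenvalue k) :
    ∑' k, ouWeight β k / (w - dirichletEigenvalue k) =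
      2 * β ^ 2 * ∑' k, 1 / (w - dirichletEigenvalue k) +
      (4 * β + 4 * β ^ 3 / w) * (2 * (∑' k, 1 / (w - dirichletEigenvalue k) -
        (∑' k, 1 / (w / 4 - dirichletEigenvalue k)) / 4)) + β ^ 3 / w := by
  have hS : Summable fun k => 1 / (w - dirichletEigenvalue k) :=
    summable_div_sub_dirichletEigenvalue (d := fun _ => 1) (D := 1) (fun _ => one_pos)
      (fun _ => le_rfl) w
  have hodd : ∀ k, dirichletEigenvalue (2 * k + 1) = 4 * dirichletEigenvalue k := fun k => by
    unfold dirichletEigenvalue; push_cast; ring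
  have h1 := hasSum_one_add_neg_one_pow_mul hS
  have h2 := hasSum_one_add_neg_one_pow_mul summable_inv_dirichletEigenvalue
  have e1 : ∑' k, 1 / (w - dirichletEigenvalue (2 * k + 1)) =
      (∑' k, 1 / (w / 4 - dirichletEigenvalue k)) / 4 := by
    rw [← tsum_div_const]
    refine tsum_congr fun k => ?_
    rw [hodd, div_div]; congr 1; ring
  have e2 : ∑' k, (dirichletEigenvalue (2 * k + 1))⁻¹ = 1 / 24 := by
    simp_rw [hodd, mul_inv]
    rw [tsum_mul_left, tsum_inv_dirichletEigenvalue]; norm_num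
  rw [e1] at h1
  rw [e2, tsum_inv_dirichletEigenvalue] at h2
  have h3 := ((hS.hasSum.mul_left (2 * β ^ 2)).add (h1.mul_left (4 * β + 4 * β ^ 3 / w))).add
    (h2.mul_left (4 * β ^ 3 / w))
  have h4 : 4 * β ^ 3 / w * (2 * (1 / 6 - 1 / 24)) = β ^ 3 / w := by ring
  rw [h4] at h3
  rw [← h3.tsum_eq]
  refine tsum_congr fun k => ?_
  have hk := sub_ne_zero.2 (hwk k)
  have hk0 := (dirichletEigenvalue_pos k).ne'
  unfold ouWeight
  field_simp
  ring

theorem tendsto_prod_one_add_div_dirichletEigenvalue {y : ℝ} (hy : 0 < y) :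
    Tendsto (fun n => ∏ k ∈ Finset.range n, (1 + y ^ 2 / dirichletEigenvalue k)) atTop
      (𝓝 (Real.sinh y / y)) := by
  have h := Complex.tendsto_euler_sin_prod (y * Complex.I / Real.pi)
  have hpi : (Real.pi : ℂ) ≠ 0 := Complex.ofReal_ne_zero.2 Real.pi_ne_zero
  have hy' : (y : ℂ) ≠ 0 := by exact_mod_cast hy.ne'
  rw [mul_div_cancel₀ _ hpi, Complex.sin_mul_I] at h
  have h2 := h.div_const (y * Complex.I)
  have h3 : Complex.sinh y * Complex.I / (y * Complex.I) = ((Real.sinh y / y : ℝ) : ℂ) := by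
    push_cast; field_simp
  rw [h3] at h2
  have h4 := (Complex.continuous_re.tendsto _).comp h2
  rw [Complex.ofReal_re] at h4
  refine h4.congr fun n => ?_
  simp only [Function.comp]
  rw [mul_div_cancel_left₀ _ (mul_ne_zero hy' Complex.I_ne_zero), ← Complex.ofReal_re (∏ k ∈ _, _)]
  congr 1
  push_cast
  refine Finset.prod_congr rfl fun k _ => ?_
  have hk : (k : ℂ) + 1 ≠ 0 := by exact_mod_cast k.succ_ne_zero
  rw [div_pow, mul_pow, Complex.I_sq]
  unfold dirichletEigenvalue
  push_cast
  field_simp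
  ring

/-- The characteristic function of the demeaned Ornstein–Uhlenbeck process: its zeros `ω` give the
eigenvalues `1 / (ω² + β²)` of the covariance operator. -/
noncomputable def ouCharFun (β ω : ℝ) : ℝ :=
  (ω ^ 2 + β ^ 2) * (Real.sin ω + 2 * β * (1 - Real.cos ω) / ω) -
    β ^ 2 * (ω * Real.cos ω + β * Real.sin ω)

/-- The characteristic function of the demeaned Ornstein–Uhlenbeck process on the imaginary axis. -/
noncomputable def ouDet (β y : ℝ) : ℝ :=
  ((y ^ 2 - β ^ 2) * (Real.sinh y + 2 * β * (Real.cosh y - 1) / y) +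
    β ^ 2 * (y * Real.cosh y + β * Real.sinh y)) / y ^ 3

/-- The sums at t² and t²/4 give cot t and cot(t/2), and cot(t/2) = (1 + cos t)/sin t brings both
over sin t. The weights are, up to sign, the residues of F(t)/(t² sin t) in the variable w = t². -/
theorem one_sub_tsum_ouWeight_div_mul {β t : ℝ} (ht : Real.sin t ≠ 0) :
    (1 - ∑' k, ouWeight β k / (t ^ 2 - dirichletEigenvalue k)) * (t ^ 2 * Real.sin t) =
      ouCharFun β t := by
  have ht0 : t ≠ 0 := by rintro rfl; simp at ht
  have h2 : Real.sin t = 2 * Real.sin (t / 2) * Real.cos (t / 2) := by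
    rw [← Real.sin_two_mul]; congr 1; ring
  have h3 : Real.cos t = 2 * Real.cos (t / 2) ^ 2 - 1 := by
    rw [← Real.cos_two_mul]; congr 1; ring
  have hs : Real.sin (t / 2) ≠ 0 := by rintro h; simp [h2, h] at ht
  have hc : Real.cos (t / 2) ≠ 0 := by rintro h; simp [h2, h] at ht
  have hcot : Real.cos (t / 2) / Real.sin (t / 2) = (1 + Real.cos t) / Real.sin t := by
    rw [h2, h3]; field_simp; ring
  have hw : ∀ k, t ^ 2 ≠ dirichletEigenvalue k := by
    intro k h
    apply ht
    rw [dirichletEigenvalue, sq_eq_sq_iff_eq_or_eq_neg] at h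
    have h0 : Real.sin (Real.pi * (k + 1)) = 0 := by
      rw [mul_comm]; exact_mod_cast Real.sin_nat_mul_pi (k + 1)
    rcases h with h | h <;> simp [h, h0]
  have h4 : t ^ 2 / 4 = (t / 2) ^ 2 := by ring
  rw [tsum_ouWeight_div (pow_ne_zero 2 ht0) hw, h4, tsum_inv_sq_sub_dirichletEigenvalue ht,
    tsum_inv_sq_sub_dirichletEigenvalue hs, hcot, ouCharFun]
  field_simp
  ring

theorem one_sub_tsum_ouWeight_div_neg {β y : ℝ} (hy : 0 < y) :
    (1 + ∑' k, ouWeight β k / (y ^ 2 + dirichletEigenvalue k)) * (Real.sinh y / y) =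
      ouDet β y := by
  have h2 : Real.sinh y = 2 * Real.sinh (y / 2) * Real.cosh (y / 2) := by
    rw [← Real.sinh_two_mul]; congr 1; ring
  have h3 : Real.cosh y = 2 * Real.cosh (y / 2) ^ 2 - 1 := by
    have := Real.cosh_two_mul (y / 2)
    rw [Real.sinh_sq, mul_div_cancel₀ _ two_ne_zero] at this
    rw [this]; ring
  have hs : Real.sinh (y / 2) ≠ 0 := (Real.sinh_pos_iff.2 (by positivity)).ne'
  have hs' : Real.sinh y ≠ 0 := (Real.sinh_pos_iff.2 hy).ne'
  have hc : Real.cosh (y / 2) ≠ 0 := (Real.cosh_pos _).ne'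
  have hcot : Real.cosh (y / 2) / Real.sinh (y / 2) = (1 + Real.cosh y) / Real.sinh y := by
    rw [h2, h3]; field_simp; ring
  have hw : ∀ k, -y ^ 2 ≠ dirichletEigenvalue k := by
    intro k h
    have := dirichletEigenvalue_pos k
    nlinarith
  have h4 : -y ^ 2 / 4 = -(y / 2) ^ 2 := by ring
  have h5 : ∑' k, ouWeight β k / (y ^ 2 + dirichletEigenvalue k) =
      -∑' k, ouWeight β k / (-y ^ 2 - dirichletEigenvalue k) := by
    rw [← tsum_neg]
    refine tsum_congr fun k => ?_
    rw [← div_neg]; congr 1; ring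
  rw [h5, tsum_ouWeight_div (neg_ne_zero.2 (pow_ne_zero 2 hy.ne')) hw, h4,
    tsum_inv_neg_sq_sub_dirichletEigenvalue hy,
    tsum_inv_neg_sq_sub_dirichletEigenvalue (by positivity), hcot, ouDet]
  field_simp
  ring

theorem ouCharFun_natCast_mul_pi (β : ℝ) (n : ℕ) :
    ouCharFun β (Real.pi * (n + 1)) = ((Real.pi * (n + 1)) ^ 2 + β ^ 2) *
      (2 * β * (1 + (-1) ^ n) / (Real.pi * (n + 1))) + β ^ 2 * (Real.pi * (n + 1)) * (-1) ^ n := by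
  have h0 : Real.sin (Real.pi * (n + 1)) = 0 := by
    rw [mul_comm]; exact_mod_cast Real.sin_nat_mul_pi (n + 1)
  have h1 : Real.cos (Real.pi * (n + 1)) = -(-1) ^ n := by
    rw [mul_comm, add_mul, one_mul, Real.cos_add_pi, Real.cos_nat_mul_pi]
  rw [ouCharFun, h0, h1]; ring

/-- At π(n+1) the sign of the function is (-1)^n, so the intermediate value theorem applies on each
gap. -/
theorem exists_ouCharFun_eq_zero {β : ℝ} (hβ : 0 < β) (n : ℕ) :
    ∃ t, Real.pi * (n + 1) < t ∧ t < Real.pi * (n + 2) ∧ ouCharFun β t = 0 := by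
  have hpi := Real.pi_pos
  have hlt : Real.pi * (n + 1) < Real.pi * (n + 2) := by gcongr; norm_num
  have hc : ContinuousOn (ouCharFun β) (Set.Icc (Real.pi * (n + 1)) (Real.pi * (n + 2))) := by
    unfold ouCharFun
    have hne : ∀ x ∈ Set.Icc (Real.pi * (n + 1)) (Real.pi * (n + 2)), x ≠ 0 := fun x hx =>
      (lt_of_lt_of_le (by positivity) hx.1).ne'
    fun_prop (disch := assumption)
  have h2 : Real.pi * ((n : ℝ) + 2) = Real.pi * ((n + 1 : ℕ) + 1) := by push_cast; ring
  have hp : ∀ m : ℕ, 0 < β ^ 2 * (Real.pi * ((m : ℝ) + 1)) := fun m => by positivity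
  have hq : ∀ m : ℕ, Even m → 0 < ouCharFun β (Real.pi * (m + 1)) := fun m hm => by
    rw [ouCharFun_natCast_mul_pi, hm.neg_one_pow]; positivity
  have hq' : ∀ m : ℕ, Odd m → ouCharFun β (Real.pi * (m + 1)) < 0 := fun m hm => by
    rw [ouCharFun_natCast_mul_pi, hm.neg_one_pow]
    have := hp m
    simp only [add_neg_cancel, mul_zero, zero_div, zero_add, mul_neg, mul_one]
    linarith
  rcases Nat.even_or_odd n with h | h
  · obtain ⟨t, ht, h0⟩ := intermediate_value_Ioo' hlt.le hc
      ⟨by rw [h2]; exact hq' (n + 1) h.add_one, hq n h⟩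
    exact ⟨t, ht.1, ht.2, h0⟩
  · obtain ⟨t, ht, h0⟩ := intermediate_value_Ioo hlt.le hc
      ⟨hq' n h, by rw [h2]; exact hq (n + 1) h.add_one⟩
    exact ⟨t, ht.1, ht.2, h0⟩

theorem sin_ne_zero_of_mem_Ioo {n : ℕ} {t : ℝ} (h1 : Real.pi * (n + 1) < t)
    (h2 : t < Real.pi * (n + 2)) : Real.sin t ≠ 0 := by
  intro h
  obtain ⟨m, hm⟩ := Real.sin_eq_zero_iff.1 h
  rw [← hm, mul_comm (m : ℝ)] at h1 h2
  have h3 := lt_of_mul_lt_mul_left h1 Real.pi_pos.le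
  have h4 := lt_of_mul_lt_mul_left h2 Real.pi_pos.le
  have h5 : ((n + 1 : ℤ) : ℝ) < m := by push_cast; exact h3
  have h6 : (m : ℝ) < ((n + 2 : ℤ) : ℝ) := by push_cast; exact h4
  rw [Int.cast_lt] at h5 h6
  omega

/-- The zeros of the characteristic function, and the product formula for it. -/
theorem exists_ou_frequencies {β : ℝ} (hβ : 0 < β) :
    ∃ ω : ℕ → ℝ, (∀ k, Real.pi * (k + 1) < ω k) ∧ (∀ k, ω k < Real.pi * (k + 2)) ∧
      (∀ k, ouCharFun β (ω k) = 0) ∧ (∃ M, ∀ k, ω k ^ 2 - dirichletEigenvalue k ≤ M) ∧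
      ∀ y, 0 < y → Tendsto
        (fun n => ∏ k ∈ Finset.range n, (ω k ^ 2 + y ^ 2) / dirichletEigenvalue k) atTop
        (𝓝 (ouDet β y)) := by
  choose ω h1 h2 h3 using exists_ouCharFun_eq_zero hβ
  have hω : ∀ k, 0 < ω k := fun k => lt_trans (by have := Real.pi_pos; positivity) (h1 k)
  have hpi := Real.pi_pos
  have g1 : ∀ k, dirichletEigenvalue k < ω k ^ 2 := fun k => by
    unfold dirichletEigenvalue
    exact pow_lt_pow_left₀ (h1 k) (by positivity) two_ne_zero
  have g2 : ∀ k, ω k ^ 2 < dirichletEigenvalue (k + 1) := fun k => by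
    have e : Real.pi * (((k + 1 : ℕ) : ℝ) + 1) = Real.pi * (k + 2) := by push_cast; ring
    rw [dirichletEigenvalue, e]
    exact pow_lt_pow_left₀ (h2 k) (hω k).le two_ne_zero
  have g3 : ∀ k, ∑' j, ouWeight β j / (ω k ^ 2 - dirichletEigenvalue j) = 1 := fun k => by
    have hs := sin_ne_zero_of_mem_Ioo (h1 k) (h2 k)
    have h := one_sub_tsum_ouWeight_div_mul (β := β) hs
    rw [h3 k] at h
    have h0 := (mul_eq_zero.1 h).resolve_right (mul_ne_zero (pow_ne_zero 2 (hω k).ne') hs)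
    linarith
  obtain ⟨hM, hprod⟩ := tendsto_prod_of_roots (ouWeight_pos hβ) (ouWeight_le hβ) g1 g2 g3
  refine ⟨ω, h1, h2, h3, hM, fun y hy => ?_⟩
  -- Multiplying by Euler's product for sinh y / y replaces the denominators a_k + y² by a_k.
  have h := (hprod (y ^ 2) (sq_nonneg y)).mul (tendsto_prod_one_add_div_dirichletEigenvalue hy)
  rw [one_sub_tsum_ouWeight_div_neg hy] at h
  refine h.congr fun n => ?_
  rw [← Finset.prod_mul_distrib]
  refine Finset.prod_congr rfl fun k _ => ?_
  have := dirichletEigenvalue_pos k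
  field_simp

/-! ### The trace from the derivative of the product -/

/-- The trace of the covariance operator of the demeaned Ornstein–Uhlenbeck process. -/
noncomputable def ouTrace (β : ℝ) : ℝ :=
  1 / (2 * β) * (1 - (1 - Real.exp (-(2 * β))) / (2 * β) -
    (2 / β - 2 * (1 - Real.exp (-β)) / β ^ 2 - (1 - Real.exp (-β)) ^ 2 / β ^ 2))

/-- At y = β the factor y² - β² kills the first bracket, and cosh + sinh remains. This is the
constant of the eigenvalue product. -/
theorem ouDet_self {β : ℝ} (hβ : 0 < β) : ouDet β β = Real.exp β := by
  rw [ouDet, ← Real.cosh_add_sinh]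
  field_simp
  ring

theorem hasDerivAt_ouDet {β : ℝ} (hβ : 0 < β) :
    HasDerivAt (ouDet β) (Real.exp β * (2 * β * ouTrace β)) β := by
  have hne : β ≠ 0 := hβ.ne'
  have h1 : HasDerivAt (fun y : ℝ => y ^ 2 - β ^ 2) (2 * β) β := by
    simpa using (hasDerivAt_pow 2 β).sub_const (β ^ 2)
  have h2 := (((Real.hasDerivAt_cosh β).sub_const 1).const_mul (2 * β)).div (hasDerivAt_id β) hne
  have h3 := h1.mul ((Real.hasDerivAt_sinh β).add h2)
  have h4 := (((hasDerivAt_id β).mul (Real.hasDerivAt_cosh β)).add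
    ((Real.hasDerivAt_sinh β).const_mul β)).const_mul (β ^ 2)
  have h5 := (h3.add h4).div (hasDerivAt_pow 3 β) (pow_ne_zero 3 hne)
  refine h5.congr_deriv ?_
  have e1 : Real.exp (-(2 * β)) = Real.exp (-β) ^ 2 := by
    rw [← Real.exp_nat_mul]; congr 1; push_cast; ring
  simp only [Pi.add_apply, Pi.mul_apply, Pi.div_apply, id, ouTrace, e1, Real.exp_neg, Real.cosh_eq,
    Real.sinh_eq]
  have hE := (Real.exp_pos β).ne'
  field_simp
  ring

theorem deriv_nonneg_of_nonneg_right {g : ℝ → ℝ} {x g' : ℝ} (hg : HasDerivAt g g' x)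
    (h0 : g x = 0) (h : ∀ y, x < y → 0 ≤ g y) : 0 ≤ g' := by
  have h1 := (hasDerivAt_iff_tendsto_slope.1 hg).mono_left
    (nhdsWithin_mono x (fun y (hy : y ∈ Set.Ioi x) => (ne_of_gt hy : y ≠ x)))
  refine ge_of_tendsto h1 ?_
  filter_upwards [self_mem_nhdsWithin] with y hy
  rw [slope_def_field, h0, sub_zero]
  exact div_nonneg (h y hy) (sub_pos.2 hy).le

/-- Relative to y = β, the k-th factor is 1 + (y² - β²)(ω_k² + β²)⁻¹, and 1 + x ≤ e^x bounds the
product by e^β exp((y² - β²)S) for y > β, with equality at β. Comparing right derivatives at β gives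
the claim. The opposite inequality is supplied by Bessel and needs no computation. -/
theorem ouTrace_le_tsum {β : ℝ} (hβ : 0 < β) {ω : ℕ → ℝ}
    (hprod : ∀ y, 0 < y → Tendsto
        (fun n => ∏ k ∈ Finset.range n, (ω k ^ 2 + y ^ 2) / dirichletEigenvalue k) atTop
        (𝓝 (ouDet β y)))
    (hs : Summable fun k => (ω k ^ 2 + β ^ 2)⁻¹) :
    ouTrace β ≤ ∑' k, (ω k ^ 2 + β ^ 2)⁻¹ := by
  set S := ∑' k, (ω k ^ 2 + β ^ 2)⁻¹ with hS
  have hle : ∀ y, β < y → ouDet β y ≤ Real.exp β * Real.exp ((y ^ 2 - β ^ 2) * S) := by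
    intro y hy
    have h1 := (hprod β hβ).mul_const (Real.exp ((y ^ 2 - β ^ 2) * S))
    rw [ouDet_self hβ] at h1
    refine le_of_tendsto_of_tendsto' (hprod y (hβ.trans hy)) h1 fun n => ?_
    have hyβ : 0 ≤ y ^ 2 - β ^ 2 := by nlinarith
    have e : ∀ k, (ω k ^ 2 + y ^ 2) / dirichletEigenvalue k =
        (ω k ^ 2 + β ^ 2) / dirichletEigenvalue k *
          ((y ^ 2 - β ^ 2) * (ω k ^ 2 + β ^ 2)⁻¹ + 1) := by
      intro k
      have := dirichletEigenvalue_pos k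
      have : 0 < ω k ^ 2 + β ^ 2 := by positivity
      field_simp
      ring
    simp_rw [e]
    rw [Finset.prod_mul_distrib]
    refine mul_le_mul_of_nonneg_left ?_ (Finset.prod_nonneg fun k _ =>
      div_nonneg (by positivity) (dirichletEigenvalue_pos k).le)
    calc ∏ k ∈ Finset.range n, ((y ^ 2 - β ^ 2) * (ω k ^ 2 + β ^ 2)⁻¹ + 1)
        ≤ ∏ k ∈ Finset.range n, Real.exp ((y ^ 2 - β ^ 2) * (ω k ^ 2 + β ^ 2)⁻¹) :=
          Finset.prod_le_prod (fun k _ => by positivity) fun k _ => Real.add_one_le_exp _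
      _ = Real.exp ((y ^ 2 - β ^ 2) * ∑ k ∈ Finset.range n, (ω k ^ 2 + β ^ 2)⁻¹) := by
          rw [← Real.exp_sum, Finset.mul_sum]
      _ ≤ _ := by
          gcongr
          exact hs.sum_le_tsum _ fun k _ => by positivity
  have h1 : HasDerivAt (fun y : ℝ => (y ^ 2 - β ^ 2) * S) (2 * β * S) β := by
    simpa using ((hasDerivAt_pow 2 β).sub_const (β ^ 2)).mul_const S
  have h2 := (h1.exp.const_mul (Real.exp β)).sub (hasDerivAt_ouDet hβ)
  have h3 := deriv_nonneg_of_nonneg_right h2 (by simp [ouDet_self hβ])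
    fun y hy => by simpa using hle y hy
  rw [sub_self, zero_mul, Real.exp_zero, one_mul, ← mul_sub] at h3
  have h4 := (mul_nonneg_iff_of_pos_left (Real.exp_pos β)).1 h3
  rw [← mul_sub] at h4
  have h5 := (mul_nonneg_iff_of_pos_left (by positivity : 0 < 2 * β)).1 h4
  linarith

/-! ### Green functions and explicit eigenfunctions -/

theorem integral_unitInterval (f : ℝ → ℝ) :
    ∫ t : unitInterval, f t = ∫ t in (0 : ℝ)..1, f t := by
  rw [intervalIntegral.integral_of_le zero_le_one, ← integral_Icc_eq_integral_Ioc]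
  exact integral_subtype_comap measurableSet_Icc f

/-- Lagrange's identity: k'v - kv' is an antiderivative when k'' = qk. It is used with q = β² for
the Ornstein–Uhlenbeck kernel and q = 0 for the bridge. -/
theorem integral_mul_sub_deriv_two {k k' v v' v'' : ℝ → ℝ} {q : ℝ}
    (hk : ∀ s, HasDerivAt k (k' s) s) (hk' : ∀ s, HasDerivAt k' (q * k s) s)
    (hv : ∀ s, HasDerivAt v (v' s) s) (hv' : ∀ s, HasDerivAt v' (v'' s) s)
    (hv'' : Continuous v'') (a b : ℝ) :
    ∫ s in a..b, k s * (q * v s - v'' s) =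
      (k' b * v b - k b * v' b) - (k' a * v a - k a * v' a) := by
  have hkc : Continuous k := continuous_iff_continuousAt.2 fun s => (hk s).continuousAt
  have hvc : Continuous v := continuous_iff_continuousAt.2 fun s => (hv s).continuousAt
  refine intervalIntegral.integral_eq_sub_of_hasDerivAt
    (f := fun s => k' s * v s - k s * v' s) (fun s _ => ?_)
    (Continuous.intervalIntegrable (by fun_prop) _ _)
  refine (((hk' s).mul (hv s)).sub ((hk s).mul (hv' s))).congr_deriv ?_
  ring

/-- `ouZeroKernel β` is the Green function of `β² v - v''` with the boundary conditions `v 0 = 0`,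
`v' 1 + β v 1 = 0`. -/
theorem integral_ouZeroKernel_mul {β : ℝ} (hβ : 0 < β) {v v' v'' : ℝ → ℝ}
    (hv : ∀ s, HasDerivAt v (v' s) s) (hv' : ∀ s, HasDerivAt v' (v'' s) s)
    (hv'' : Continuous v'') (h0 : v 0 = 0) (h1 : v' 1 + β * v 1 = 0) (t : unitInterval) :
    ∫ s : unitInterval, ouZeroKernel β t s * (β ^ 2 * v s - v'' s) = v t := by
  have hvc : Continuous v := continuous_iff_continuousAt.2 fun s => (hv s).continuousAt
  obtain ⟨t, ht0, ht1⟩ := t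
  simp only [ouZeroKernel]
  rw [integral_unitInterval fun s => 1 / (2 * β) * (Real.exp (-β * |t - s|) -
    Real.exp (-β * (t + s))) * (β ^ 2 * v s - v'' s)]
  rw [← intervalIntegral.integral_add_adjacent_intervals (b := t)
    (Continuous.intervalIntegrable (by fun_prop) _ _)
    (Continuous.intervalIntegrable (by fun_prop) _ _)]
  have hexp : ∀ c d s : ℝ, HasDerivAt (fun s => Real.exp (c + d * s)) (d * Real.exp (c + d * s)) s := by
    intro c d s
    have := (((hasDerivAt_id s).const_mul d).const_add c).exp
    refine this.congr_deriv ?_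
    simp; ring
  -- On either side of t the kernel solves k'' = β²k, and k is continuous at t. The boundary
  -- conditions kill the terms at 0 and 1, and the jump of k' at t leaves v t.
  have hA := integral_mul_sub_deriv_two (q := β ^ 2) (a := 0) (b := t)
    (k := fun s => 1 / (2 * β) * (Real.exp (-β * t + β * s) - Real.exp (-β * t + -β * s)))
    (k' := fun s => 1 / 2 * (Real.exp (-β * t + β * s) + Real.exp (-β * t + -β * s)))
    (fun s => (((hexp _ _ s).sub (hexp _ _ s)).const_mul _).congr_deriv (by field_simp; ring))
    (fun s => (((hexp _ _ s).add (hexp _ _ s)).const_mul _).congr_deriv (by field_simp; ring))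
    hv hv' hv''
  have hB := integral_mul_sub_deriv_two (q := β ^ 2) (a := t) (b := 1)
    (k := fun s => 1 / (2 * β) * (Real.exp (β * t + -β * s) - Real.exp (-β * t + -β * s)))
    (k' := fun s => -(1 / 2) * (Real.exp (β * t + -β * s) - Real.exp (-β * t + -β * s)))
    (fun s => (((hexp _ _ s).sub (hexp _ _ s)).const_mul _).congr_deriv (by field_simp; ring))
    (fun s => (((hexp _ _ s).sub (hexp _ _ s)).const_mul _).congr_deriv (by field_simp; ring))
    hv hv' hv''
  have eA : ∫ s in (0 : ℝ)..t, 1 / (2 * β) * (Real.exp (-β * |t - s|) -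
      Real.exp (-β * (t + s))) * (β ^ 2 * v s - v'' s) =
      ∫ s in (0 : ℝ)..t, 1 / (2 * β) * (Real.exp (-β * t + β * s) - Real.exp (-β * t + -β * s)) *
        (β ^ 2 * v s - v'' s) := by
    refine intervalIntegral.integral_congr fun s hs => ?_
    rw [Set.uIcc_of_le ht0] at hs
    rw [abs_of_nonneg (by linarith [hs.2])]
    ring_nf
  have eB : ∫ s in t..1, 1 / (2 * β) * (Real.exp (-β * |t - s|) -
      Real.exp (-β * (t + s))) * (β ^ 2 * v s - v'' s) =
      ∫ s in t..1, 1 / (2 * β) * (Real.exp (β * t + -β * s) - Real.exp (-β * t + -β * s)) *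
        (β ^ 2 * v s - v'' s) := by
    refine intervalIntegral.integral_congr fun s hs => ?_
    rw [Set.uIcc_of_le ht1] at hs
    rw [abs_of_nonpos (by linarith [hs.1])]
    ring_nf
  rw [eA, eB, hA, hB, h0]
  have e1 : -β * t + β * t = 0 := by ring
  have e2 : β * t + -β * t = 0 := by ring
  have e3 : v' 1 = -β * v 1 := by linarith
  simp only [e1, e2, e3, mul_zero, add_zero, Real.exp_zero, sub_self]
  field_simp
  ring

/-- `bridgeKernel` is the Green function of `-v''` with Dirichlet boundary conditions. -/
theorem integral_bridgeKernel_mul {v v' v'' : ℝ → ℝ}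
    (hv : ∀ s, HasDerivAt v (v' s) s) (hv' : ∀ s, HasDerivAt v' (v'' s) s)
    (hv'' : Continuous v'') (h0 : v 0 = 0) (h1 : v 1 = 0) (t : unitInterval) :
    ∫ s : unitInterval, bridgeKernel t s * -v'' s = v t := by
  obtain ⟨t, ht0, ht1⟩ := t
  simp only [bridgeKernel]
  rw [integral_unitInterval fun s => (min t s - t * s) * -v'' s]
  rw [← intervalIntegral.integral_add_adjacent_intervals (b := t)
    (Continuous.intervalIntegrable (by fun_prop) _ _)
    (Continuous.intervalIntegrable (by fun_prop) _ _)]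
  have hA := integral_mul_sub_deriv_two (q := 0) (a := 0) (b := t)
    (k := fun s => (1 - t) * s) (k' := fun _ => 1 - t)
    (fun s => ((hasDerivAt_id s).const_mul (1 - t)).congr_deriv (by simp))
    (fun s => (hasDerivAt_const _ _).congr_deriv (by simp)) hv hv' hv''
  have hB := integral_mul_sub_deriv_two (q := 0) (a := t) (b := 1)
    (k := fun s => t + -t * s) (k' := fun _ => -t)
    (fun s => (((hasDerivAt_id s).const_mul (-t)).const_add t).congr_deriv (by simp))
    (fun s => (hasDerivAt_const _ _).congr_deriv (by simp)) hv hv' hv''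
  have eA : ∫ s in (0 : ℝ)..t, (min t s - t * s) * -v'' s =
      ∫ s in (0 : ℝ)..t, (1 - t) * s * (0 * v s - v'' s) := by
    refine intervalIntegral.integral_congr fun s hs => ?_
    rw [Set.uIcc_of_le ht0] at hs
    rw [min_eq_right hs.2]
    ring
  have eB : ∫ s in t..1, (min t s - t * s) * -v'' s =
      ∫ s in t..1, (t + -t * s) * (0 * v s - v'' s) := by
    refine intervalIntegral.integral_congr fun s hs => ?_
    rw [Set.uIcc_of_le ht1] at hs
    rw [min_eq_left hs.1]
    ring
  rw [eA, eB, hA, hB, h0, h1]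
  ring

/-- Covariance function of the demeaned process in terms of that of the process. -/
noncomputable def centerKernel (K : unitInterval → unitInterval → ℝ) (t s : unitInterval) : ℝ :=
  K t s - (∫ r, K t r) - (∫ r, K s r) + ∫ r, ∫ q, K r q

theorem continuous_ouZeroKernel (β : ℝ) :
    Continuous fun p : unitInterval × unitInterval => ouZeroKernel β p.1 p.2 := by
  unfold ouZeroKernel; fun_prop

theorem continuous_bridgeKernel :
    Continuous fun p : unitInterval × unitInterval => bridgeKernel p.1 p.2 := by
  unfold bridgeKernel; fun_prop

theorem ouZeroKernel_comm (β : ℝ) (t s : unitInterval) :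
    ouZeroKernel β t s = ouZeroKernel β s t := by
  unfold ouZeroKernel; rw [abs_sub_comm, add_comm (t : ℝ)]

theorem Continuous.integral_unitInterval_right {K : unitInterval → unitInterval → ℝ}
    (hK : Continuous fun p : unitInterval × unitInterval => K p.1 p.2) :
    Continuous fun t => ∫ s, K t s := by
  have := continuous_parametric_integral_of_continuous (μ := (volume : Measure unitInterval))
    (f := K) hK (s := Set.univ) isCompact_univ
  simpa using this

theorem continuous_centerKernel {K : unitInterval → unitInterval → ℝ}
    (hK : Continuous fun p : unitInterval × unitInterval => K p.1 p.2) :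
    Continuous fun p : unitInterval × unitInterval => centerKernel K p.1 p.2 := by
  have hg := hK.integral_unitInterval_right
  exact ((hK.sub (hg.comp continuous_fst)).sub (hg.comp continuous_snd)).add continuous_const

theorem Continuous.integrable_unitInterval {f : unitInterval → ℝ} (hf : Continuous f) :
    Integrable f :=
  hf.integrable_of_hasCompactSupport (.of_compactSpace f)

theorem Continuous.integrable_unitInterval_prod {f : unitInterval × unitInterval → ℝ}
    (hf : Continuous f) : Integrable f (volume.prod volume) :=
  hf.integrable_of_hasCompactSupport (.of_compactSpace f)

/-- Suppose Ku = mu + c and ∫ u = 0. Centering subtracts from Ku only the constant ⟨K1, u⟩ = ⟨1,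
Ku⟩, which is c. -/
theorem integral_centerKernel_mul {K : unitInterval → unitInterval → ℝ}
    (hK : Continuous fun p : unitInterval × unitInterval => K p.1 p.2)
    {u v : unitInterval → ℝ} (hu : Continuous u) {m c : ℝ}
    (hv : ∀ t, ∫ s, K t s * u s = v t) (hvu : ∀ t, v t = m * u t + c)
    (hu0 : ∫ t, u t = 0) (hsymm : ∀ t s, K t s = K s t) (t : unitInterval) :
    ∫ s, centerKernel K t s * u s = m * u t := by
  have hg := hK.integral_unitInterval_right
  have hKt : Continuous fun s => K t s := hK.comp (by fun_prop : Continuous fun s => (t, s))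
  have e : ∀ s, centerKernel K t s * u s =
      K t s * u s - (∫ r, K t r) * u s - (∫ r, K s r) * u s + (∫ r, ∫ q, K r q) * u s := by
    intro s; unfold centerKernel; ring
  simp_rw [e]
  rw [integral_add, integral_sub, integral_sub, integral_const_mul, integral_const_mul, hu0, hv,
    hvu]
  · have h1 : ∫ s, (∫ r, K s r) * u s = c := by
      have h2 : ∀ s, (∫ r, K s r) * u s = ∫ r, K s r * u s := fun s => (integral_mul_const _ _).symm
      simp_rw [h2]
      rw [integral_integral_swap]
      · have h3 : ∀ r, ∫ s, K s r * u s = m * u r + c := fun r => by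
          rw [← hvu, ← hv]; simp_rw [hsymm r]
        simp_rw [h3]
        rw [integral_add (hu.integrable_unitInterval.const_mul m) (integrable_const _),
          integral_const_mul, hu0]
        simp
      · exact Continuous.integrable_unitInterval_prod (by unfold Function.uncurry; fun_prop)
    rw [h1]; ring
  all_goals exact Continuous.integrable_unitInterval (by fun_prop)

/-- Take u = β²v - v'' for a combination v of cos(ωt) - 1 and sin(ωt), so that v(0) = 0 and v - mu
is constant. The ratio of the coefficients is fixed by ∫ u = 0, and the condition at 1 then becomes
F(ω) = 0. The hypothesis sin ω ≠ 0 ensures 1 - cos ω ≠ 0, hence u(0) ≠ 0. -/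
theorem exists_ou_eigenfunction {β : ℝ} (hβ : 0 < β) {ω : ℝ} (hω : 0 < ω)
    (hF : ouCharFun β ω = 0) (hsin : Real.sin ω ≠ 0) :
    ∃ u : unitInterval → ℝ, Continuous u ∧ u ≠ 0 ∧
      ∀ t, ∫ s, centerKernel (ouZeroKernel β) t s * u s = (ω ^ 2 + β ^ 2)⁻¹ * u t := by
  set S := Real.sin ω with hS
  set C := Real.cos ω with hC
  have hSC : S ^ 2 + C ^ 2 = 1 := Real.sin_sq_add_cos_sq ω
  have hC1 : 1 - C ≠ 0 := by
    intro h
    have : C = 1 := by linarith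
    rw [this] at hSC
    exact hsin (by nlinarith)
  have hq : ω ^ 2 + β ^ 2 ≠ 0 := by positivity
  set A := 1 - C with hA
  -- With A = 1 - cos ω, this is the value of b for which u has mean zero.
  set b := β ^ 2 * ω - (ω ^ 2 + β ^ 2) * S with hb
  set m := (ω ^ 2 + β ^ 2)⁻¹ with hm
  have hmq : m * (ω ^ 2 + β ^ 2) = 1 := inv_mul_cancel₀ hq
  have hcos : ∀ s : ℝ, HasDerivAt (fun s => Real.cos (ω * s)) (-ω * Real.sin (ω * s)) s := fun s => by
    refine ((hasDerivAt_id s).const_mul ω).cos.congr_deriv ?_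
    simp; ring
  have hsn : ∀ s : ℝ, HasDerivAt (fun s => Real.sin (ω * s)) (ω * Real.cos (ω * s)) s := fun s => by
    refine ((hasDerivAt_id s).const_mul ω).sin.congr_deriv ?_
    simp; ring
  set u : ℝ → ℝ := fun t => A * (ω ^ 2 + β ^ 2) * Real.cos (ω * t) + b * Real.sin (ω * t) - β ^ 2 * A
    with hu
  have huc : Continuous u := by rw [hu]; fun_prop
  set v : ℝ → ℝ := fun t => A * (Real.cos (ω * t) - 1) + b * m * Real.sin (ω * t) with hv
  have hvu : ∀ t, v t = m * u t + -(m * (A * ω ^ 2)) := fun t => by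
    rw [hv, hu]; linear_combination (A - A * Real.cos (ω * t)) * hmq
  -- This is v'(1) + βv(1) = 0 multiplied by ω² + β²; up to sin² + cos² = 1 it is ω F(ω) = 0.
  have hF' : ω * C * b + β * S * b = (ω ^ 2 + β ^ 2) * (ω * S * A + β * A ^ 2) := by
    have h1 : (ω ^ 2 + β ^ 2) * (ω * S + 2 * β * (1 - C)) - β ^ 2 * ω * (ω * C + β * S) = 0 := by
      have h2 := hF
      rw [ouCharFun, ← hS, ← hC] at h2
      have h3 : ω * ((ω ^ 2 + β ^ 2) * (S + 2 * β * (1 - C) / ω) - β ^ 2 * (ω * C + β * S)) = 0 := by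
        rw [h2, mul_zero]
      rw [← h3]; field_simp
    rw [hA, hb]
    linear_combination (-1) * h1 - (ω ^ 2 + β ^ 2) * β * hSC
  have hG := integral_ouZeroKernel_mul hβ (v := v)
    (v' := fun t => A * (-ω * Real.sin (ω * t)) + b * m * (ω * Real.cos (ω * t)))
    (v'' := fun t => A * (-ω * (ω * Real.cos (ω * t))) + b * m * (ω * (-ω * Real.sin (ω * t))))
    (fun s => (((hcos s).sub_const 1).const_mul A).add ((hsn s).const_mul (b * m)))
    (fun s => (((hsn s).const_mul (-ω)).const_mul A).add (((hcos s).const_mul ω).const_mul (b * m)))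
    (by fun_prop) (by simp [hv]) (by
      simp only [hv, mul_one, ← hS, ← hC]
      have : A * (-ω * S) + b * m * (ω * C) + β * (A * (C - 1) + b * m * S) =
        m * (ω * C * b + β * S * b - (ω ^ 2 + β ^ 2) * (ω * S * A + β * A ^ 2)) := by
        rw [hA]; linear_combination (A * ω * S + β * A ^ 2) * hmq
      rw [this, hF', sub_self, mul_zero])
  have hG' : ∀ t : unitInterval, ∫ s : unitInterval, ouZeroKernel β t s * u s = v t := fun t => by
    rw [← hG t]
    refine integral_congr_ae (.of_forall fun s => ?_)
    simp only [hu, hv]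
    linear_combination (-ouZeroKernel β t s * b * Real.sin (ω * s)) * hmq
  have hu0 : ∫ t : unitInterval, u t = 0 := by
    rw [integral_unitInterval u, intervalIntegral.integral_eq_sub_of_hasDerivAt
      (f := fun t => A * (ω ^ 2 + β ^ 2) / ω * Real.sin (ω * t) - b / ω * Real.cos (ω * t) -
        β ^ 2 * A * t) (fun s _ => ?_) (huc.intervalIntegrable _ _)]
    · simp only [mul_one, mul_zero, Real.sin_zero, Real.cos_zero, ← hS, ← hC]
      rw [hA, hb]
      field_simp
      ring
    · refine ((((hsn s).const_mul _).sub ((hcos s).const_mul _)).sub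
        ((hasDerivAt_id s).const_mul _)).congr_deriv ?_
      simp only [hu]
      field_simp
      ring
  refine ⟨fun t => u t, huc.comp continuous_subtype_val, fun h => ?_, fun t => ?_⟩
  · have h0 := congrFun h 0
    simp only [hu, Set.Icc.coe_zero, mul_zero, Real.cos_zero, Real.sin_zero, Pi.zero_apply] at h0
    have : A * ω ^ 2 = 0 := by linear_combination h0
    exact mul_ne_zero hC1 (pow_ne_zero 2 hω.ne') this
  · exact integral_centerKernel_mul (continuous_ouZeroKernel β)
      (huc.comp continuous_subtype_val) hG' (fun t => hvu t) hu0 (ouZeroKernel_comm β) t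

theorem integral_bridgeKernel_mul_sin (k : ℕ) (t : unitInterval) :
    ∫ s : unitInterval, bridgeKernel t s * Real.sin (Real.pi * (k + 1) * s) =
      (dirichletEigenvalue k)⁻¹ * Real.sin (Real.pi * (k + 1) * t) := by
  set ω := Real.pi * (k + 1) with hω
  have hω0 : ω ≠ 0 := by have := Real.pi_pos; positivity
  have h0 : Real.sin ω = 0 := by
    rw [hω, mul_comm]; exact_mod_cast Real.sin_nat_mul_pi (k + 1)
  have hcos : ∀ s : ℝ, HasDerivAt (fun s => Real.cos (ω * s)) (-ω * Real.sin (ω * s)) s := fun s => by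
    refine ((hasDerivAt_id s).const_mul ω).cos.congr_deriv ?_
    simp; ring
  have hsn : ∀ s : ℝ, HasDerivAt (fun s => Real.sin (ω * s)) (ω * Real.cos (ω * s)) s := fun s => by
    refine ((hasDerivAt_id s).const_mul ω).sin.congr_deriv ?_
    simp; ring
  have h := integral_bridgeKernel_mul
    (fun s => (hsn s).const_mul (dirichletEigenvalue k)⁻¹)
    (fun s => ((hcos s).const_mul ω).const_mul (dirichletEigenvalue k)⁻¹)
    (by fun_prop) (by simp) (by simp [h0]) t
  rw [← h]
  refine integral_congr_ae (.of_forall fun s => ?_)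
  simp only [dirichletEigenvalue, ← hω]
  field_simp

theorem integral_bridgeKernel_diag : ∫ t : unitInterval, bridgeKernel t t = 1 / 6 := by
  simp only [bridgeKernel, min_self]
  rw [integral_unitInterval fun t => t - t * t,
    intervalIntegral.integral_eq_sub_of_hasDerivAt (f := fun t => t ^ 2 / 2 - t ^ 3 / 3)
      (fun s _ => ?_) (Continuous.intervalIntegrable (by fun_prop) _ _)]
  · norm_num
  · refine (((hasDerivAt_pow 2 s).div_const 2).sub ((hasDerivAt_pow 3 s).div_const 3)).congr_deriv ?_
    push_cast; ring

theorem integral_ouZeroKernel_center_diag {β : ℝ} (hβ : 0 < β) :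
    ∫ t, centerKernel (ouZeroKernel β) t t = ouTrace β := by
  have hexp : ∀ d s : ℝ, HasDerivAt (fun s => Real.exp (d * s)) (d * Real.exp (d * s)) s := by
    intro d s
    refine ((hasDerivAt_id s).const_mul d).exp.congr_deriv ?_
    simp; ring
  -- The function ∫ G(t,s) ds solves β²v - v'' = 1 with the boundary conditions of the Green
  -- function; p and q are its coefficients on e^{βt} and e^{-βt}.
  set p := -Real.exp (-β) / (2 * β ^ 2) with hp
  set q := -1 / β ^ 2 + Real.exp (-β) / (2 * β ^ 2) with hq
  have hg : ∀ t : unitInterval, ∫ s, ouZeroKernel β t s =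
      1 / β ^ 2 + p * Real.exp (β * t) + q * Real.exp (-β * t) := by
    intro t
    rw [← integral_ouZeroKernel_mul hβ
      (v := fun t => 1 / β ^ 2 + p * Real.exp (β * t) + q * Real.exp (-β * t))
      (v' := fun t => p * (β * Real.exp (β * t)) + q * (-β * Real.exp (-β * t)))
      (v'' := fun t => p * (β * (β * Real.exp (β * t))) + q * (-β * (-β * Real.exp (-β * t))))
      (fun s => (((hexp β s).const_mul p).const_add _).add ((hexp (-β) s).const_mul q))
      (fun s => (((hexp β s).const_mul β).const_mul p).add
        (((hexp (-β) s).const_mul (-β)).const_mul q)) (by fun_prop)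
      (by simp [hp, hq]; field_simp; ring)
      (by
        have : Real.exp β * Real.exp (-β) = 1 := by rw [← Real.exp_add]; simp
        simp only [mul_one, hp, hq]
        field_simp
        linear_combination (-2) * this)]
    refine integral_congr_ae (.of_forall fun s => ?_)
    simp only
    field_simp
    ring
  have hgc : Continuous fun t => ∫ s, ouZeroKernel β t s :=
    (continuous_ouZeroKernel β).integral_unitInterval_right
  have hdc : Continuous fun t => ouZeroKernel β t t :=
    (continuous_ouZeroKernel β).comp (by fun_prop : Continuous fun t => (t, t))
  have hgi : ∫ t, ∫ s, ouZeroKernel β t s = 1 / β ^ 2 + p * ((Real.exp β - 1) / β) +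
      q * ((1 - Real.exp (-β)) / β) := by
    simp_rw [hg]
    rw [integral_unitInterval fun t => 1 / β ^ 2 + p * Real.exp (β * t) + q * Real.exp (-β * t),
      intervalIntegral.integral_eq_sub_of_hasDerivAt
      (f := fun t => 1 / β ^ 2 * t + p / β * Real.exp (β * t) - q / β * Real.exp (-β * t))
      (fun s _ => ?_) (Continuous.intervalIntegrable (by fun_prop) _ _)]
    · simp; ring
    · refine ((((hasDerivAt_id s).const_mul _).add ((hexp β s).const_mul _)).sub
        ((hexp (-β) s).const_mul _)).congr_deriv ?_
      field_simp; ring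
  have hd : ∫ t, ouZeroKernel β t t = 1 / (2 * β) * (1 - (1 - Real.exp (-(2 * β))) / (2 * β)) := by
    simp only [ouZeroKernel, sub_self, abs_zero, mul_zero, Real.exp_zero]
    rw [integral_unitInterval fun t => 1 / (2 * β) * (1 - Real.exp (-β * (t + t))),
      intervalIntegral.integral_eq_sub_of_hasDerivAt
      (f := fun t => 1 / (2 * β) * (t + 1 / (2 * β) * Real.exp (-(2 * β) * t)))
      (fun s _ => ?_) (Continuous.intervalIntegrable (by fun_prop) _ _)]
    · simp; ring
    · refine (((hasDerivAt_id s).add ((hexp (-(2 * β)) s).const_mul _)).const_mul _).congr_deriv ?_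
      have : -β * (s + s) = -(2 * β) * s := by ring
      rw [this]; field_simp; ring
  simp only [centerKernel]
  rw [integral_add, integral_sub, integral_sub, hd, hgi, integral_const, ouTrace]
  · have e1 : Real.exp (-(2 * β)) = Real.exp (-β) ^ 2 := by
      rw [← Real.exp_nat_mul]; congr 1; push_cast; ring
    have hE := (Real.exp_pos β).ne'
    simp only [e1, hp, hq, Real.exp_neg, probReal_univ, one_smul]
    field_simp
    ring
  all_goals exact Continuous.integrable_unitInterval (by fun_prop)

/-! ### Gaussian spaces and independence -/

section GaussianSpace

variable {Ω T : Type*} [MeasurableSpace Ω] {P : Measure Ω}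

/-- The closed subspace of `L²(P)` spanned by the process `X`. -/
noncomputable def gaussianSpace (X : T → Ω → ℝ) (P : Measure Ω) : Submodule ℝ (Lp ℝ 2 P) :=
  (Submodule.span ℝ {Y : Lp ℝ 2 P | ∃ t, Y =ᵐ[P] X t}).topologicalClosure

theorem norm_exp_mul_I_sub_exp_mul_I_le (a b : ℝ) :
    ‖Complex.exp (a * Complex.I) - Complex.exp (b * Complex.I)‖ ≤ |a - b| := by
  have h : Complex.exp (a * Complex.I) - Complex.exp (b * Complex.I) =
      Complex.exp (b * Complex.I) * (Complex.exp (Complex.I * (a - b : ℝ)) - 1) := by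
    rw [mul_sub, ← Complex.exp_add, mul_one]
    congr 2
    push_cast; ring
  rw [h, norm_mul, Complex.norm_exp_ofReal_mul_I, one_mul]
  exact Real.norm_exp_I_mul_ofReal_sub_one_le

theorem integrable_exp_mul_I [IsFiniteMeasure P] {Y : Ω → ℝ} (hY : AEStronglyMeasurable Y P) :
    Integrable (fun ω => Complex.exp (Y ω * Complex.I)) P := by
  refine Integrable.of_bound (C := 1) ?_ (.of_forall fun ω => ?_)
  · have : Continuous fun x : ℝ => Complex.exp (x * Complex.I) := by fun_prop
    exact this.comp_aestronglyMeasurable hY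
  · rw [Complex.norm_exp_ofReal_mul_I]

/-- Since |e^{ia} - e^{ib}| ≤ |a - b|, the map is Lipschitz in L¹, hence in L². This lets the
Gaussian characteristic function pass to L² limits. -/
theorem continuous_integral_exp_mul_I [IsProbabilityMeasure P] :
    Continuous fun Y : Lp ℝ 2 P => ∫ ω, Complex.exp (Y ω * Complex.I) ∂P := by
  refine LipschitzWith.continuous (K := 1) (LipschitzWith.of_dist_le_mul fun Y Z => ?_)
  have hYm := Lp.memLp Y
  have hZm := Lp.memLp Z
  have hd : Integrable (fun ω => |Y ω - Z ω|) P :=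
    ((hYm.sub hZm).integrable (by norm_num)).abs
  rw [dist_eq_norm, ← integral_sub (integrable_exp_mul_I hYm.1) (integrable_exp_mul_I hZm.1),
    NNReal.coe_one, one_mul, dist_eq_norm]
  refine (norm_integral_le_integral_norm _).trans ?_
  refine (integral_mono_of_nonneg (.of_forall fun _ => norm_nonneg _) hd
    (.of_forall fun ω => norm_exp_mul_I_sub_exp_mul_I_le _ _)).trans ?_
  have h1 : ∫ ω, |Y ω - Z ω| ∂P = (eLpNorm (⇑Y - ⇑Z) 1 P).toReal := by
    rw [eLpNorm_one_eq_lintegral_enorm, integral_eq_lintegral_of_nonneg_ae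
      (.of_forall fun _ => abs_nonneg _) hd.1]
    congr 1
    refine lintegral_congr fun ω => ?_
    rw [← Real.enorm_eq_ofReal_abs]; rfl
  rw [h1, Lp.norm_def, eLpNorm_congr_ae (Lp.coeFn_sub Y Z)]
  exact ENNReal.toReal_mono (hYm.sub hZm).2.ne
    (eLpNorm_le_eLpNorm_of_exponent_le (by norm_num) (hYm.sub hZm).1)

theorem integral_mul_eq_inner {Y Z : Lp ℝ 2 P} : ∫ ω, Y ω * Z ω ∂P = inner ℝ Y Z := by
  rw [L2.inner_def]
  refine integral_congr_ae (.of_forall fun ω => ?_)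
  simp [mul_comm]

theorem integral_sq_eq_norm_sq (Y : Lp ℝ 2 P) : ∫ ω, Y ω ^ 2 ∂P = ‖Y‖ ^ 2 := by
  rw [← real_inner_self_eq_norm_sq, ← integral_mul_eq_inner]
  simp_rw [sq]

/-- Finite combinations of the process are centered Gaussian with variance ‖Y‖². Both sides are
continuous on L², so the formula extends to the closed span. -/
theorem integral_exp_of_mem_gaussianSpace [IsProbabilityMeasure P] {X : T → Ω → ℝ}
    (hX : IsGaussianProcess X P) (h0 : ∀ t, ∫ ω, X t ω ∂P = 0) {Y : Lp ℝ 2 P}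
    (hY : Y ∈ gaussianSpace X P) :
    ∫ ω, Complex.exp (Y ω * Complex.I) ∂P = Complex.exp (-((‖Y‖ ^ 2 / 2 : ℝ) : ℂ)) := by
  have hcl : IsClosed {Y : Lp ℝ 2 P | ∫ ω, Complex.exp (Y ω * Complex.I) ∂P =
      Complex.exp (-((‖Y‖ ^ 2 / 2 : ℝ) : ℂ))} :=
    isClosed_eq continuous_integral_exp_mul_I (by fun_prop)
  refine closure_minimal (fun Y hY => ?_) hcl hY
  obtain ⟨n, c, g, rfl⟩ := Submodule.mem_span_set'.1 hY
  choose t ht using fun i => (g i).2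
  set Y := ∑ i, c i • (g i : Lp ℝ 2 P) with hYdef
  have hae : (fun ω => ∑ i, c i * X (t i) ω) =ᵐ[P] Y := by
    have h1 := Lp.coeFn_finsetSum Finset.univ fun i => c i • (g i : Lp ℝ 2 P)
    have h2 : ∀ᵐ ω ∂P, ∀ i, (c i • (g i : Lp ℝ 2 P) : Lp ℝ 2 P) ω = c i * X (t i) ω := by
      rw [ae_all_iff]
      intro i
      filter_upwards [Lp.coeFn_smul (c i) (g i : Lp ℝ 2 P), ht i] with ω h3 h4
      rw [h3, Pi.smul_apply, h4, smul_eq_mul]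
    filter_upwards [h1, h2] with ω h3 h4
    rw [hYdef, h3, Finset.sum_apply]
    exact Finset.sum_congr rfl fun i _ => (h4 i).symm
  have hG : HasGaussianLaw (fun ω => ∑ i, c i * X (t i) ω) P := by
    have := ((hX.comp_right t).smul c).hasGaussianLaw_fun_sum (I := Finset.univ)
    simpa using this
  have hGY : HasGaussianLaw Y P := hG.congr hae
  have hmean : ∫ ω, Y ω ∂P = 0 := by
    rw [← integral_congr_ae hae, integral_finsetSum]
    · refine Finset.sum_eq_zero fun i _ => ?_
      rw [integral_const_mul, h0, mul_zero]
    · exact fun i _ => ((hX.hasGaussianLaw_eval (t i)).integrable).const_mul _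
  have hvar : Var[Y; P] = ‖Y‖ ^ 2 := by
    rw [variance_eq_integral hGY.aemeasurable, hmean, ← integral_sq_eq_norm_sq]
    simp
  have hlaw := hGY.map_eq_gaussianReal
  rw [hmean, hvar] at hlaw
  have hchar := charFun_gaussianReal (μ := 0) (v := (‖Y‖ ^ 2).toNNReal) 1
  rw [← hlaw, charFun_apply_real, integral_map hGY.aemeasurable (by fun_prop)] at hchar
  simp only [Complex.ofReal_one, one_mul, Complex.ofReal_zero, mul_zero, zero_mul, zero_sub,
    one_pow, mul_one, Real.coe_toNNReal _ (sq_nonneg ‖Y‖)] at hchar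
  rw [Set.mem_ofPred_eq, hchar]
  push_cast
  rfl

/-- Orthogonal elements of a Gaussian space are independent Gaussian variables. -/
theorem map_eq_pi_gaussianReal [IsProbabilityMeasure P] {X : T → Ω → ℝ}
    (hX : IsGaussianProcess X P) (h0 : ∀ t, ∫ ω, X t ω ∂P = 0) {ι : Type*} [Fintype ι]
    [DecidableEq ι] {Y : ι → Ω → ℝ} {y : ι → Lp ℝ 2 P} (hy : ∀ i, y i ∈ gaussianSpace X P)
    (hyY : ∀ i, Y i =ᵐ[P] y i) {v : ι → ℝ} (hv : ∀ i, 0 ≤ v i)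
    (hcov : ∀ i j, ∫ ω, Y i ω * Y j ω ∂P = if i = j then v i else 0) :
    P.map (fun ω i => Y i ω) = Measure.pi fun i => gaussianReal 0 (v i).toNNReal := by
  have hYm : ∀ i, AEMeasurable (Y i) P := fun i =>
    (Lp.aestronglyMeasurable (y i)).aemeasurable.congr (hyY i).symm
  have hYm' : AEMeasurable (fun ω i => Y i ω) P := aemeasurable_pi_lambda _ hYm
  have : IsProbabilityMeasure (P.map (fun ω i => Y i ω)) := Measure.isProbabilityMeasure_map hYm'
  rw [← charFun_eq_pi_iff]
  intro t
  -- The joint characteristic function at t is that of the single element z, whose squared norm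
  -- splits by orthogonality.
  set z : Lp ℝ 2 P := ∑ i, t i • y i with hz
  have hzm : z ∈ gaussianSpace X P := Submodule.sum_mem _ fun i _ => Submodule.smul_mem _ _ (hy i)
  have hae : (fun ω => ∑ i, t i * Y i ω) =ᵐ[P] z := by
    have h1 := Lp.coeFn_finsetSum Finset.univ fun i => t i • y i
    have h2 : ∀ᵐ ω ∂P, ∀ i, (t i • y i : Lp ℝ 2 P) ω = t i * Y i ω := by
      rw [ae_all_iff]
      intro i
      filter_upwards [Lp.coeFn_smul (t i) (y i), hyY i] with ω h3 h4
      rw [h3, Pi.smul_apply, h4, smul_eq_mul]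
    filter_upwards [h1, h2] with ω h3 h4
    rw [hz, h3, Finset.sum_apply]
    exact Finset.sum_congr rfl fun i _ => (h4 i).symm
  have hinner : ∀ i j, inner ℝ (y i) (y j) = if i = j then v i else 0 := fun i j => by
    rw [← hcov i j, ← integral_mul_eq_inner]
    refine integral_congr_ae ?_
    filter_upwards [hyY i, hyY j] with ω h1 h2
    rw [h1, h2]
  have hnorm : ‖z‖ ^ 2 = ∑ i, t i ^ 2 * v i := by
    rw [← real_inner_self_eq_norm_sq, hz, sum_inner]
    refine Finset.sum_congr rfl fun i _ => ?_
    rw [inner_sum, Finset.sum_eq_single i]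
    · rw [real_inner_smul_left, real_inner_smul_right, hinner, if_pos rfl]; ring
    · intro j _ hj
      rw [real_inner_smul_left, real_inner_smul_right, hinner, if_neg hj.symm]; ring
    · simp
  have hmt : Measurable (WithLp.toLp 2 : (ι → ℝ) → PiLp 2 fun _ : ι => ℝ) := by fun_prop
  rw [charFun_apply, integral_map (hmt.aemeasurable) (by fun_prop),
    integral_map hYm' (by fun_prop)]
  have h1 := integral_exp_of_mem_gaussianSpace hX h0 hzm
  rw [hnorm] at h1
  calc ∫ ω, Complex.exp (inner ℝ (WithLp.toLp 2 fun i => Y i ω) t * Complex.I) ∂P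
      = ∫ ω, Complex.exp (z ω * Complex.I) ∂P := by
        refine integral_congr_ae ?_
        filter_upwards [hae] with ω hω
        rw [← hω, PiLp.inner_apply]
        simp
    _ = _ := by
        rw [h1]
        simp_rw [charFun_gaussianReal]
        rw [← Complex.exp_sum]
        congr 1
        push_cast
        rw [Finset.sum_div, ← Finset.sum_neg_distrib]
        refine Finset.sum_congr rfl fun i _ => ?_
        rw [Real.coe_toNNReal _ (hv i)]
        ring

end GaussianSpace

/-! ### Coordinates of the paths -/

/-- A jointly measurable process on `[0,1]` with bounded second moments, in the closed subspace `W` of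
`L²(P)`. -/
structure IsProcessIn {Ω : Type*} [MeasurableSpace Ω] {P : Measure Ω} (W : Submodule ℝ (Lp ℝ 2 P))
    (Z : unitInterval → Ω → ℝ) : Prop where
  isClosed : IsClosed (W : Set (Lp ℝ 2 P))
  aemeasurable : AEMeasurable (fun p : unitInterval × Ω => Z p.1 p.2) (volume.prod P)
  mem : ∀ t, ∃ y ∈ W, Z t =ᵐ[P] y
  bounded : ∃ C, ∀ t, ∫ ω, Z t ω ^ 2 ∂P ≤ C

/-- The coordinate `∫₀¹ Z(s) f(s) ds` of a path. -/
noncomputable def pathCoord {Ω : Type*} (Z : unitInterval → Ω → ℝ) (f : unitInterval → ℝ) (ω : Ω) :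
    ℝ := ∫ s, Z s ω * f s

theorem sq_integral_le_integral_sq {α : Type*} [MeasurableSpace α] {μ : Measure α}
    [IsProbabilityMeasure μ] {g : α → ℝ} (hg : MemLp g 2 μ) :
    (∫ x, g x ∂μ) ^ 2 ≤ ∫ x, g x ^ 2 ∂μ := by
  have h := variance_nonneg g μ
  rw [variance_eq_sub hg] at h
  simpa using h

theorem Continuous.exists_abs_le {f : unitInterval → ℝ} (hf : Continuous f) :
    ∃ C, 0 ≤ C ∧ ∀ s, |f s| ≤ C := by
  obtain ⟨C, hC⟩ := isCompact_univ.exists_bound_of_continuousOn (f := f) hf.continuousOn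
  exact ⟨C, (norm_nonneg _).trans (hC 0 trivial), fun s => hC s trivial⟩

namespace IsProcessIn

variable {Ω : Type*} [MeasurableSpace Ω] {P : Measure Ω} {W : Submodule ℝ (Lp ℝ 2 P)}
  {Z : unitInterval → Ω → ℝ}

theorem memLp (hZ : IsProcessIn W Z) (t : unitInterval) : MemLp (Z t) 2 P := by
  obtain ⟨y, _, hy⟩ := hZ.mem t
  exact (Lp.memLp y).ae_eq hy.symm

variable [IsProbabilityMeasure P]

theorem integrable_sq (hZ : IsProcessIn W Z) :
    Integrable (fun p : unitInterval × Ω => Z p.1 p.2 ^ 2) (volume.prod P) := by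
  obtain ⟨C, hC⟩ := hZ.bounded
  have hm : AEStronglyMeasurable (fun p : unitInterval × Ω => Z p.1 p.2 ^ 2) (volume.prod P) :=
    (hZ.aemeasurable.pow_const 2).aestronglyMeasurable
  rw [integrable_prod_iff hm]
  refine ⟨.of_forall fun t => (hZ.memLp t).integrable_sq, ?_⟩
  refine Integrable.of_bound (C := C) hm.norm.integral_prod_right' (.of_forall fun t => ?_)
  have h0 : 0 ≤ ∫ ω, ‖Z t ω ^ 2‖ ∂P := integral_nonneg fun _ => norm_nonneg _
  rw [Real.norm_of_nonneg h0]
  simpa using hC t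

theorem integrable_mul (hZ : IsProcessIn W Z) {V : Ω → ℝ} (hV : MemLp V 2 P)
    {f : unitInterval → ℝ} (hf : Continuous f) :
    Integrable (fun p : unitInterval × Ω => V p.2 * (Z p.1 p.2 * f p.1)) (volume.prod P) := by
  obtain ⟨C, hC0, hC⟩ := hf.exists_abs_le
  have hV2 : Integrable (fun p : unitInterval × Ω => V p.2 ^ 2) (volume.prod P) :=
    hV.integrable_sq.comp_snd volume
  refine ((hV2.add hZ.integrable_sq).const_mul C).mono ?_ (.of_forall fun p => ?_)
  · exact ((hV.1.aemeasurable.comp_snd (μ := volume)).mul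
      (hZ.aemeasurable.mul (hf.measurable.comp measurable_fst).aemeasurable)).aestronglyMeasurable
  · have h1 := hC p.1
    have h2 := abs_nonneg (V p.2)
    have h3 := abs_nonneg (Z p.1 p.2)
    have h4 : |V p.2| * |Z p.1 p.2| ≤ V p.2 ^ 2 + Z p.1 p.2 ^ 2 := by
      rw [← sq_abs (V p.2), ← sq_abs (Z p.1 p.2)]
      nlinarith [sq_nonneg (|V p.2| - |Z p.1 p.2|)]
    simp only [norm_mul, Real.norm_eq_abs, Pi.add_apply]
    rw [abs_of_nonneg hC0, abs_of_nonneg (by positivity : 0 ≤ V p.2 ^ 2 + Z p.1 p.2 ^ 2), ← mul_assoc]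
    calc |V p.2| * |Z p.1 p.2| * |f p.1| ≤ (V p.2 ^ 2 + Z p.1 p.2 ^ 2) * C := by gcongr
      _ = _ := mul_comm _ _

theorem ae_memLp_path (hZ : IsProcessIn W Z) :
    ∀ᵐ ω ∂P, MemLp (fun t => Z t ω) 2 (volume : Measure unitInterval) := by
  have h1 := (hZ.integrable_mul (memLp_const (1 : ℝ)) (f := fun _ => 1) continuous_const).prod_left_ae
  filter_upwards [h1, hZ.integrable_sq.prod_left_ae] with ω h2 h3
  simp only [one_mul, mul_one] at h2
  exact (memLp_two_iff_integrable_sq h2.1).2 h3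

theorem memLp_pathCoord (hZ : IsProcessIn W Z) {f : unitInterval → ℝ} (hf : Continuous f) :
    MemLp (pathCoord Z f) 2 P := by
  obtain ⟨C, hC0, hC⟩ := hf.exists_abs_le
  have h1 : Integrable (pathCoord Z f) P := by
    have h := (hZ.integrable_mul (memLp_const (1 : ℝ)) hf).integral_prod_right
    simp only [one_mul] at h
    exact h
  rw [memLp_two_iff_integrable_sq h1.1]
  refine (hZ.integrable_sq.integral_prod_right.const_mul (C ^ 2)).mono (h1.1.pow 2) ?_
  filter_upwards [hZ.ae_memLp_path] with ω hω
  have h2 : MemLp (fun s => Z s ω * f s) 2 (volume : Measure unitInterval) := by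
    refine (hω.const_mul C).mono (hω.1.mul hf.aestronglyMeasurable) (.of_forall fun s => ?_)
    rw [norm_mul, norm_mul, mul_comm, Real.norm_of_nonneg hC0]
    exact mul_le_mul_of_nonneg_right (hC s) (norm_nonneg _)
  have h3 : 0 ≤ ∫ s, Z s ω ^ 2 := integral_nonneg fun _ => sq_nonneg _
  rw [Real.norm_of_nonneg (sq_nonneg _), Real.norm_of_nonneg (by positivity), pathCoord]
  refine (sq_integral_le_integral_sq h2).trans ?_
  rw [← integral_const_mul]
  refine integral_mono h2.integrable_sq (hω.integrable_sq.const_mul _) fun s => ?_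
  have := sq_le_sq' (neg_le_of_abs_le (hC s)) (le_of_abs_le (hC s))
  simp only [mul_pow]
  rw [mul_comm]
  exact mul_le_mul_of_nonneg_right this (sq_nonneg _)

theorem integral_mul_pathCoord (hZ : IsProcessIn W Z) {V : Ω → ℝ} (hV : MemLp V 2 P)
    {f : unitInterval → ℝ} (hf : Continuous f) :
    ∫ ω, V ω * pathCoord Z f ω ∂P = ∫ s, (∫ ω, V ω * Z s ω ∂P) * f s := by
  have h := integral_integral_swap (f := fun s ω => V ω * (Z s ω * f s)) (hZ.integrable_mul hV hf)
  calc ∫ ω, V ω * pathCoord Z f ω ∂P = ∫ ω, (∫ s, V ω * (Z s ω * f s)) ∂P := by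
        simp_rw [integral_const_mul]; rfl
    _ = ∫ s, (∫ ω, V ω * (Z s ω * f s) ∂P) := h.symm
    _ = _ := by simp_rw [← mul_assoc, integral_mul_const]

/-- As W is closed, it equals its double orthogonal complement. An element orthogonal to W is
orthogonal to every Z s, and by Fubini to the weighted integral. -/
theorem pathCoord_mem (hZ : IsProcessIn W Z) {f : unitInterval → ℝ} (hf : Continuous f) :
    ∃ y ∈ W, pathCoord Z f =ᵐ[P] y := by
  have hY := hZ.memLp_pathCoord hf
  refine ⟨hY.toLp, ?_, hY.coeFn_toLp.symm⟩
  have hW : W = Wᗮᗮ := by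
    rw [Submodule.orthogonal_orthogonal_eq_closure, hZ.isClosed.submodule_topologicalClosure_eq]
  rw [hW, Submodule.mem_orthogonal]
  intro V hV
  rw [← integral_mul_eq_inner]
  have h1 := hZ.integral_mul_pathCoord (Lp.memLp V) hf
  have h2 : ∀ s, ∫ ω, V ω * Z s ω ∂P = 0 := by
    intro s
    obtain ⟨y, hy, hys⟩ := hZ.mem s
    rw [← (Submodule.mem_orthogonal W V).1 hV y hy, ← integral_mul_eq_inner]
    refine integral_congr_ae ?_
    filter_upwards [hys] with ω hω
    rw [hω, mul_comm]
  simp only [h2, zero_mul, integral_zero] at h1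
  rw [← h1]
  refine integral_congr_ae ?_
  filter_upwards [hY.coeFn_toLp] with ω hω
  rw [hω]

/-- Fubini turns the second moment into the quadratic form of the covariance operator. For
orthonormal eigenfunctions the coordinates are thus uncorrelated, with the eigenvalues as variances.
-/
theorem integral_pathCoord_mul (hZ : IsProcessIn W Z) {e f : unitInterval → ℝ} {m : ℝ}
    (he : Continuous e) (hf : Continuous f)
    (hfm : ∀ t, ∫ s, (∫ ω, Z t ω * Z s ω ∂P) * f s = m * f t) :
    ∫ ω, pathCoord Z e ω * pathCoord Z f ω ∂P = m * ∫ t, e t * f t := by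
  simp_rw [mul_comm (pathCoord Z e _)]
  rw [hZ.integral_mul_pathCoord (hZ.memLp_pathCoord hf) he, ← integral_const_mul]
  refine integral_congr_ae (.of_forall fun t => ?_)
  have h := hZ.integral_mul_pathCoord (hZ.memLp t) hf
  rw [hfm] at h
  simp_rw [mul_comm (pathCoord Z f _)]
  simp only [h]
  ring

theorem integral_integral_sq (hZ : IsProcessIn W Z) :
    ∫ ω, (∫ t, Z t ω ^ 2) ∂P = ∫ t, (∫ ω, Z t ω * Z t ω ∂P) := by
  have h := integral_integral_swap (f := fun t ω => Z t ω ^ 2) hZ.integrable_sq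
  rw [← h]
  simp_rw [sq]

end IsProcessIn

/-- Bessel's inequality for orthonormal continuous functions on `[0,1]`. -/
theorem sum_sq_integral_mul_le {ι : Type*} [DecidableEq ι] (s : Finset ι) {e : ι → unitInterval → ℝ}
    (he : ∀ i, Continuous (e i)) (ho : ∀ i ∈ s, ∀ j ∈ s, ∫ t, e i t * e j t = if i = j then 1 else 0)
    {z : unitInterval → ℝ} (hz : MemLp z 2 volume) :
    ∑ i ∈ s, (∫ t, z t * e i t) ^ 2 ≤ ∫ t, z t ^ 2 := by
  set c := fun i => ∫ t, z t * e i t with hc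
  have he2 : ∀ i, MemLp (e i) 2 (volume : Measure unitInterval) := fun i => by
    obtain ⟨C, _, hC⟩ := (he i).exists_abs_le
    exact MemLp.of_bound (he i).aestronglyMeasurable C (.of_forall hC)
  have hze : ∀ i, Integrable (fun t => z t * e i t) volume := fun i =>
    hz.integrable_mul (he2 i)
  have hg : Continuous fun t => ∑ i ∈ s, c i * e i t := by fun_prop
  have hzg : Integrable (fun t => z t * ∑ i ∈ s, c i * e i t) volume := by
    have : (fun t => z t * ∑ i ∈ s, c i * e i t) = fun t => ∑ i ∈ s, c i * (z t * e i t) := by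
      funext t; rw [Finset.mul_sum]; exact Finset.sum_congr rfl fun i _ => by ring
    rw [this]
    exact integrable_finsetSum _ fun i _ => (hze i).const_mul _
  have h1 : ∫ t, z t * ∑ i ∈ s, c i * e i t = ∑ i ∈ s, c i ^ 2 := by
    have : (fun t => z t * ∑ i ∈ s, c i * e i t) = fun t => ∑ i ∈ s, c i * (z t * e i t) := by
      funext t; rw [Finset.mul_sum]; exact Finset.sum_congr rfl fun i _ => by ring
    rw [this, integral_finsetSum _ fun i _ => (hze i).const_mul _]
    refine Finset.sum_congr rfl fun i _ => ?_
    rw [integral_const_mul, sq]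
  have h2 : ∫ t, (∑ i ∈ s, c i * e i t) ^ 2 = ∑ i ∈ s, c i ^ 2 := by
    have : (fun t => (∑ i ∈ s, c i * e i t) ^ 2) =
        fun t => ∑ i ∈ s, ∑ j ∈ s, c i * c j * (e i t * e j t) := by
      funext t; rw [sq, Finset.sum_mul_sum]
      exact Finset.sum_congr rfl fun i _ => Finset.sum_congr rfl fun j _ => by ring
    rw [this, integral_finsetSum _ fun i _ => Continuous.integrable_unitInterval (by fun_prop)]
    refine Finset.sum_congr rfl fun i hi => ?_
    rw [integral_finsetSum _ fun j _ => Continuous.integrable_unitInterval (by fun_prop),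
      Finset.sum_eq_single_of_mem i hi]
    · rw [integral_const_mul, ho i hi i hi, if_pos rfl]; ring
    · intro j hj hji
      rw [integral_const_mul, ho i hi j hj, if_neg hji.symm, mul_zero]
  have h3 : 0 ≤ ∫ t, (z t - ∑ i ∈ s, c i * e i t) ^ 2 := integral_nonneg fun _ => sq_nonneg _
  have h4 : ∫ t, (z t - ∑ i ∈ s, c i * e i t) ^ 2 =
      ∫ t, z t ^ 2 - 2 * (z t * ∑ i ∈ s, c i * e i t) + (∑ i ∈ s, c i * e i t) ^ 2 := by
    refine integral_congr_ae (.of_forall fun t => ?_)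
    ring
  have h5 : Integrable (fun t => (∑ i ∈ s, c i * e i t) ^ 2) volume :=
    Continuous.integrable_unitInterval (by fun_prop)
  have h6 : Integrable (fun t => z t ^ 2 - 2 * (z t * ∑ i ∈ s, c i * e i t)) volume :=
    hz.integrable_sq.sub (hzg.const_mul 2)
  rw [h4, integral_add h6 h5,
    integral_sub hz.integrable_sq (hzg.const_mul 2), integral_const_mul, h1, h2] at h3
  linarith

/-! ### Karhunen–Loève expansion -/

/-- The probability that a centered Gaussian vector with independent coordinates of variances
`v 0, …, v (n - 1)` has squared norm at most `x`. -/
noncomputable def gaussianBall (v : ℕ → ℝ) (n : ℕ) (x : ℝ) : ℝ :=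
  (Measure.pi fun k : Fin n => gaussianReal 0 (v k).toNNReal).real {z | ∑ k, z k ^ 2 ≤ x}

section KarhunenLoeve

variable {Ω : Type*} [MeasurableSpace Ω] {P : Measure Ω} [IsProbabilityMeasure P]
  {Z : unitInterval → Ω → ℝ}

/-- Each eigenvalue is the second moment of a coordinate, so the bound is the expectation of
Bessel's inequality for the paths. -/
theorem sum_eigenvalues_le {W : Submodule ℝ (Lp ℝ 2 P)} (hZ : IsProcessIn W Z) {ι : Type*}
    [DecidableEq ι] (s : Finset ι) {e : ι → unitInterval → ℝ} {m : ι → ℝ}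
    (he : ∀ i, Continuous (e i)) (ho : ∀ i ∈ s, ∀ j ∈ s, ∫ t, e i t * e j t = if i = j then 1 else 0)
    (hem : ∀ i ∈ s, ∀ t, ∫ r, (∫ ω, Z t ω * Z r ω ∂P) * e i r = m i * e i t) :
    ∑ i ∈ s, m i ≤ ∫ t, (∫ ω, Z t ω * Z t ω ∂P) := by
  have h1 : ∀ i ∈ s, m i = ∫ ω, pathCoord Z (e i) ω ^ 2 ∂P := fun i hi => by
    have := hZ.integral_pathCoord_mul (he i) (he i) (hem i hi)
    rw [ho i hi i hi, if_pos rfl, mul_one] at this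
    simp_rw [sq]
    exact this.symm
  rw [Finset.sum_congr rfl h1, ← integral_finsetSum _ fun i _ =>
    (hZ.memLp_pathCoord (he i)).integrable_sq, ← hZ.integral_integral_sq]
  refine integral_mono_ae (integrable_finsetSum _ fun i _ =>
    (hZ.memLp_pathCoord (he i)).integrable_sq) hZ.integrable_sq.integral_prod_right ?_
  filter_upwards [hZ.ae_memLp_path] with ω hω
  exact sum_sq_integral_mul_le s he ho hω

/-- Karhunen–Loève expansion of the norm of the path. -/
theorem ae_hasSum_sq_pathCoord {W : Submodule ℝ (Lp ℝ 2 P)} (hZ : IsProcessIn W Z)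
    {e : ℕ → unitInterval → ℝ} {m : ℕ → ℝ}
    (he : ∀ i, Continuous (e i)) (ho : ∀ i j, ∫ t, e i t * e j t = if i = j then 1 else 0)
    (hem : ∀ i t, ∫ r, (∫ ω, Z t ω * Z r ω ∂P) * e i r = m i * e i t)
    (hs : Summable m) (htr : ∫ t, (∫ ω, Z t ω * Z t ω ∂P) ≤ ∑' i, m i) :
    ∀ᵐ ω ∂P, HasSum (fun i => pathCoord Z (e i) ω ^ 2) (∫ t, Z t ω ^ 2) := by
  have hY := fun i => hZ.memLp_pathCoord (he i)
  have h1 : ∀ i, m i = ∫ ω, pathCoord Z (e i) ω ^ 2 ∂P := fun i => by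
    have := hZ.integral_pathCoord_mul (he i) (he i) (hem i)
    rw [ho i i, if_pos rfl, mul_one] at this
    simp_rw [sq]
    exact this.symm
  have hm0 : ∀ i, 0 ≤ m i := fun i => by rw [h1]; exact integral_nonneg fun _ => sq_nonneg _
  have hle : ∀ᵐ ω ∂P, ∀ s : Finset ℕ, ∑ i ∈ s, pathCoord Z (e i) ω ^ 2 ≤ ∫ t, Z t ω ^ 2 := by
    filter_upwards [hZ.ae_memLp_path] with ω hω s
    exact sum_sq_integral_mul_le s he (fun i _ j _ => ho i j) hω
  have hNi : Integrable (fun ω => ∫ t, Z t ω ^ 2) P := hZ.integrable_sq.integral_prod_right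
  have hle' : (fun ω => ∑' i, ENNReal.ofReal (pathCoord Z (e i) ω ^ 2)) ≤ᵐ[P]
      fun ω => ENNReal.ofReal (∫ t, Z t ω ^ 2) := by
    filter_upwards [hle] with ω hω
    refine ENNReal.tsum_le_of_sum_range_le fun n => ?_
    rw [← ENNReal.ofReal_sum_of_nonneg fun _ _ => sq_nonneg _]
    exact ENNReal.ofReal_le_ofReal (hω _)
  have hmeas : ∀ i, AEMeasurable (fun ω => ENNReal.ofReal (pathCoord Z (e i) ω ^ 2)) P := fun i =>
    ((hY i).1.aemeasurable.pow_const 2).ennreal_ofReal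
  have hint : ∫⁻ ω, ∑' i, ENNReal.ofReal (pathCoord Z (e i) ω ^ 2) ∂P =
      ENNReal.ofReal (∑' i, m i) := by
    rw [lintegral_tsum hmeas, ENNReal.ofReal_tsum_of_nonneg hm0 hs]
    refine tsum_congr fun i => ?_
    rw [← ofReal_integral_eq_lintegral_ofReal (hY i).integrable_sq (.of_forall fun _ => sq_nonneg _),
      ← h1]
  -- Bessel bounds the coordinate sum by the squared norm almost surely. The trace hypothesis orders
  -- the expectations the other way, which forces equality.
  have hae := ae_eq_of_ae_le_of_lintegral_le hle' (by rw [hint]; exact ENNReal.ofReal_ne_top)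
    hNi.1.aemeasurable.ennreal_ofReal (by
      rw [hint, ← ofReal_integral_eq_lintegral_ofReal hNi
        (.of_forall fun _ => integral_nonneg fun _ => sq_nonneg _), hZ.integral_integral_sq]
      exact ENNReal.ofReal_le_ofReal htr)
  filter_upwards [hae, hle] with ω hω hω'
  have hsum : Summable fun i => pathCoord Z (e i) ω ^ 2 :=
    summable_of_sum_le (fun _ => sq_nonneg _) hω'
  have h2 := hsum.hasSum
  rw [← ENNReal.ofReal_tsum_of_nonneg (fun _ => sq_nonneg _) hsum,
    ENNReal.ofReal_eq_ofReal_iff (tsum_nonneg fun _ => sq_nonneg _)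
      (integral_nonneg fun _ => sq_nonneg _)] at hω
  rwa [hω] at h2

/-- The first n coordinates are independent Gaussians of variances m k. Up to a null set the small
ball event is the decreasing intersection of the events that the partial sums are at most ε². -/
theorem tendsto_gaussianBall_smallBall {T : Type*} {X : T → Ω → ℝ} (hX : IsGaussianProcess X P)
    (h0 : ∀ t, ∫ ω, X t ω ∂P = 0) (hZ : IsProcessIn (gaussianSpace X P) Z)
    {e : ℕ → unitInterval → ℝ} {m : ℕ → ℝ}
    (he : ∀ i, Continuous (e i)) (ho : ∀ i j, ∫ t, e i t * e j t = if i = j then 1 else 0)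
    (hem : ∀ i t, ∫ r, (∫ ω, Z t ω * Z r ω ∂P) * e i r = m i * e i t)
    (hs : Summable m) (htr : ∫ t, (∫ ω, Z t ω * Z t ω ∂P) ≤ ∑' i, m i) {ε : ℝ} (hε : 0 ≤ ε) :
    Tendsto (fun n => gaussianBall m n (ε ^ 2)) atTop (𝓝 (smallBall Z P ε)) := by
  have hY := fun i => hZ.memLp_pathCoord (he i)
  have hcov : ∀ i j, ∫ ω, pathCoord Z (e i) ω * pathCoord Z (e j) ω ∂P = if i = j then m i else 0 :=
    fun i j => by
      rw [hZ.integral_pathCoord_mul (he i) (he j) (hem j), ho]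
      split_ifs with h <;> simp [h]
  have hm0 : ∀ i, 0 ≤ m i := fun i => by
    have := hcov i i
    rw [if_pos rfl] at this
    rw [← this]
    exact integral_nonneg fun _ => mul_self_nonneg _
  choose y hyW hy using fun i => hZ.pathCoord_mem (he i)
  have hball : ∀ n, gaussianBall m n (ε ^ 2) =
      P.real {ω | ∑ k ∈ Finset.range n, pathCoord Z (e k) ω ^ 2 ≤ ε ^ 2} := fun n => by
    have hmap := map_eq_pi_gaussianReal hX h0 (Y := fun k : Fin n => pathCoord Z (e k))
      (fun k => hyW k) (fun k => hy k) (v := fun k : Fin n => m k) (fun k => hm0 k)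
      (fun i j => by rw [hcov]; simp only [Fin.val_inj])
    have hms : MeasurableSet {z : Fin n → ℝ | ∑ k, z k ^ 2 ≤ ε ^ 2} :=
      measurableSet_le (by fun_prop) measurable_const
    rw [gaussianBall, ← hmap, map_measureReal_apply_of_aemeasurable
      (aemeasurable_pi_lambda (fun ω (k : Fin n) => pathCoord Z (e k) ω)
        fun k => (hY k).1.aemeasurable) hms]
    congr 1
    ext ω
    simp [Finset.sum_range]
  simp_rw [hball]
  have hset : smallBall Z P ε =
      P.real (⋂ n, {ω | ∑ k ∈ Finset.range n, pathCoord Z (e k) ω ^ 2 ≤ ε ^ 2}) := by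
    refine measureReal_congr ?_
    filter_upwards [ae_hasSum_sq_pathCoord hZ he ho hem hs htr] with ω hω
    refine propext ?_
    change pathNorm Z ω ≤ ε ↔ ω ∈ ⋂ n, _
    rw [pathNorm, Real.sqrt_le_left hε, Set.mem_iInter]
    refine ⟨fun h n => (sum_le_hasSum _ (fun _ _ => sq_nonneg _) hω).trans h, fun h => ?_⟩
    exact le_of_tendsto' hω.tendsto_sum_nat h
  rw [hset]
  refine (ENNReal.tendsto_toReal (measure_ne_top _ _)).comp
    (tendsto_measure_iInter_atTop (fun n => ?_) (fun i j hij ω hω => ?_) ⟨0, measure_ne_top _ _⟩)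
  · refine nullMeasurableSet_le ?_ aemeasurable_const
    exact Finset.aemeasurable_fun_sum _ fun k _ => (hY k).1.aemeasurable.pow_const 2
  · have h : ∑ k ∈ Finset.range j, pathCoord Z (e k) ω ^ 2 ≤ ε ^ 2 := hω
    exact (Finset.sum_le_sum_of_subset_of_nonneg (Finset.range_mono hij)
      fun _ _ _ => sq_nonneg _).trans h

end KarhunenLoeve

/-! ### Comparison of Gaussian balls with different variances -/

theorem gaussianReal_eq_withDensity_gaussianReal {a b : ℝ} (ha : 0 < a) (hb : 0 < b) :
    gaussianReal 0 a.toNNReal = (gaussianReal 0 b.toNNReal).withDensity fun z =>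
      ENNReal.ofReal (√(b / a) * Real.exp (-(1 / a - 1 / b) * z ^ 2 / 2)) := by
  have ha' : a.toNNReal ≠ 0 := by simpa using ha
  have hb' : b.toNNReal ≠ 0 := by simpa using hb
  rw [gaussianReal_of_var_ne_zero _ ha', gaussianReal_of_var_ne_zero _ hb',
    ← withDensity_mul _ (by fun_prop) (by fun_prop)]
  congr 1
  funext z
  simp only [Pi.mul_apply, gaussianPDF, gaussianPDFReal, sub_zero]
  rw [← ENNReal.ofReal_mul (by positivity), Real.coe_toNNReal _ ha.le, Real.coe_toNNReal _ hb.le]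
  congr 1
  have h1 : (√(2 * Real.pi * a))⁻¹ = (√(2 * Real.pi * b))⁻¹ * √(b / a) := by
    rw [Real.sqrt_div hb.le, Real.sqrt_mul (x := 2 * Real.pi) (by positivity) a,
      Real.sqrt_mul (x := 2 * Real.pi) (by positivity) b]
    have := Real.sqrt_pos.2 ha
    have := Real.sqrt_pos.2 hb
    have : 0 < √(2 * Real.pi) := Real.sqrt_pos.2 (by positivity)
    field_simp
  have h2 : Real.exp (-z ^ 2 / (2 * a)) =
      Real.exp (-z ^ 2 / (2 * b)) * Real.exp (-(1 / a - 1 / b) * z ^ 2 / 2) := by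
    rw [← Real.exp_add]; congr 1; field_simp; ring
  rw [h1, h2]
  ring

theorem lintegral_pi_prod {ι : Type*} [Fintype ι] {ν : ι → Measure ℝ}
    [∀ i, IsProbabilityMeasure (ν i)] {f : ι → ℝ → ENNReal} (hf : ∀ i, Measurable (f i)) :
    ∫⁻ z, ∏ i, f i (z i) ∂Measure.pi ν = ∏ i, ∫⁻ x, f i x ∂ν i := by
  have h := lintegral_prod_eq_prod_lintegral_of_indepFun (μ := Measure.pi ν) Finset.univ
    (fun i (z : ι → ℝ) => f i (z i)) (iIndepFun_pi fun i => (hf i).aemeasurable)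
    fun i => (hf i).comp (measurable_pi_apply i)
  refine h.trans ?_
  exact Finset.prod_congr rfl fun i _ => (measurePreserving_eval ν i).lintegral_comp (hf i)

theorem pi_withDensity {ι : Type*} [Fintype ι] {ν : ι → Measure ℝ}
    [∀ i, IsProbabilityMeasure (ν i)] {f : ι → ℝ → ENNReal} (hf : ∀ i, Measurable (f i))
    [∀ i, IsProbabilityMeasure ((ν i).withDensity (f i))] :
    Measure.pi (fun i => (ν i).withDensity (f i)) =
      (Measure.pi ν).withDensity fun z => ∏ i, f i (z i) := by
  refine (Measure.pi_eq fun s hs => ?_)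
  have h : (Set.univ.pi s).indicator (fun z => ∏ i, f i (z i)) =
      fun z => ∏ i, (s i).indicator (f i) (z i) := by
    funext z
    by_cases hz : z ∈ Set.univ.pi s
    · rw [Set.indicator_of_mem hz]
      exact Finset.prod_congr rfl fun i _ => (Set.indicator_of_mem (hz i trivial) _).symm
    · rw [Set.indicator_of_notMem hz]
      obtain ⟨i, hi⟩ : ∃ i, z i ∉ s i := by simpa [Set.mem_pi] using hz
      exact (Finset.prod_eq_zero (Finset.mem_univ i) (Set.indicator_of_notMem hi _)).symm
  rw [withDensity_apply _ (MeasurableSet.univ_pi hs), ← lintegral_indicator (.univ_pi hs), h,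
    lintegral_pi_prod fun i => (hf i).indicator (hs i)]
  exact Finset.prod_congr rfl fun i _ => by
    rw [withDensity_apply _ (hs i), lintegral_indicator (hs i)]

/-- Comparison of the Gaussian measures of a ball under a change of the variances. -/
theorem gaussianBall_le {a b : ℕ → ℝ} (ha : ∀ k, 0 < a k) (hb : ∀ k, 0 < b k) {M : ℝ}
    (hM : ∀ k, 1 / b k - 1 / a k ≤ M) (n : ℕ) {x : ℝ} :
    gaussianBall a n x ≤
      (∏ k ∈ Finset.range n, √(b k / a k)) * Real.exp (max M 0 * x / 2) * gaussianBall b n x := by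
  set S := {z : Fin n → ℝ | ∑ k, z k ^ 2 ≤ x} with hS
  have hSm : MeasurableSet S := measurableSet_le (by fun_prop) measurable_const
  set D := fun k : Fin n => fun z : ℝ =>
    ENNReal.ofReal (√(b k / a k) * Real.exp (-(1 / a k - 1 / b k) * z ^ 2 / 2)) with hD
  have hDm : ∀ k, Measurable (D k) := fun k => by rw [hD]; fun_prop
  have hab : ∀ k : Fin n, gaussianReal 0 (a k).toNNReal =
      (gaussianReal 0 (b k).toNNReal).withDensity (D k) := fun k =>
    gaussianReal_eq_withDensity_gaussianReal (ha k) (hb k)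
  have : ∀ k : Fin n, IsProbabilityMeasure ((gaussianReal 0 (b k).toNNReal).withDensity (D k)) :=
    fun k => by rw [← hab]; infer_instance
  set Q := (∏ k ∈ Finset.range n, √(b k / a k)) * Real.exp (max M 0 * x / 2) with hQ
  have hQ0 : 0 ≤ Q := by positivity
  have hmeas : (Measure.pi fun k : Fin n => gaussianReal 0 (a k).toNNReal) S ≤
      ENNReal.ofReal Q * (Measure.pi fun k : Fin n => gaussianReal 0 (b k).toNNReal) S := by
    simp_rw [hab]
    rw [pi_withDensity hDm, withDensity_apply _ hSm, ← setLIntegral_const]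
    refine setLIntegral_mono measurable_const fun z hz => ?_
    rw [hD, ← ENNReal.ofReal_prod_of_nonneg fun k _ => by positivity]
    refine ENNReal.ofReal_le_ofReal ?_
    rw [Finset.prod_mul_distrib, ← Real.exp_sum, hQ,
      Finset.prod_range fun k => √(b k / a k)]
    have hz' : ∑ k, z k ^ 2 ≤ x := hz
    gcongr
    -- On the ball the quadratic form is bounded through ∑ z k ^ 2 ≤ x; this needs a nonnegative
    -- coefficient, hence max M 0.
    calc ∑ k : Fin n, -(1 / a k - 1 / b k) * z k ^ 2 / 2
        ≤ ∑ k : Fin n, max M 0 * z k ^ 2 / 2 := by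
          refine Finset.sum_le_sum fun k _ => ?_
          have := (hM k).trans (le_max_left M 0)
          gcongr
          linarith
      _ = max M 0 * (∑ k, z k ^ 2) / 2 := by rw [Finset.mul_sum, Finset.sum_div]
      _ ≤ _ := by gcongr
  have h := ENNReal.toReal_mono (ENNReal.mul_ne_top ENNReal.ofReal_ne_top (measure_ne_top _ _)) hmeas
  rw [ENNReal.toReal_mul, ENNReal.toReal_ofReal hQ0] at h
  exact h

/-- Comparison of the limits of Gaussian measures of balls. -/
theorem limit_gaussianBall_mem {a b : ℕ → ℝ} (ha : ∀ k, 0 < a k) (hb : ∀ k, 0 < b k) {M : ℝ}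
    (hM : ∀ k, |1 / b k - 1 / a k| ≤ M) {C : ℝ}
    (hprod : Tendsto (fun n => ∏ k ∈ Finset.range n, b k / a k) atTop (𝓝 C)) {x p q : ℝ}
    (hp : Tendsto (fun n => gaussianBall a n x) atTop (𝓝 p))
    (hq : Tendsto (fun n => gaussianBall b n x) atTop (𝓝 q)) :
    p ≤ √C * Real.exp (M * x / 2) * q ∧ √C * q ≤ Real.exp (M * x / 2) * p := by
  have hM0 : max M 0 = M := max_eq_left ((abs_nonneg _).trans (hM 0))
  have h1 : ∀ (a b : ℕ → ℝ), (∀ k, 0 < a k) → (∀ k, 0 < b k) → ∀ n,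
      ∏ k ∈ Finset.range n, √(b k / a k) = √(∏ k ∈ Finset.range n, b k / a k) := by
    intro a b ha hb n
    induction n with
    | zero => simp
    | succ n ih =>
      rw [Finset.prod_range_succ, Finset.prod_range_succ, ih, Real.sqrt_mul]
      exact Finset.prod_nonneg fun k _ => (div_pos (hb k) (ha k)).le
  have hs := hprod.sqrt
  constructor
  · refine le_of_tendsto_of_tendsto' hp ((hs.mul_const _).mul hq) fun n => ?_
    have := gaussianBall_le ha hb (M := M) (fun k => (le_abs_self _).trans (hM k)) n (x := x)
    rwa [h1 a b ha hb, hM0] at this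
  · have hle : ∀ n, √(∏ k ∈ Finset.range n, b k / a k) * gaussianBall b n x ≤
        Real.exp (M * x / 2) * gaussianBall a n x := by
      intro n
      -- The lower bound is the same comparison with the variances exchanged, whose constant is the
      -- reciprocal product.
      have h2 := gaussianBall_le hb ha (M := M)
        (fun k => (le_abs_self _).trans (by rw [abs_sub_comm]; exact hM k)) n (x := x)
      rw [hM0] at h2
      rw [← h1 a b ha hb]
      refine (mul_le_mul_of_nonneg_left h2 (by positivity)).trans (le_of_eq ?_)
      have h3 : (∏ k ∈ Finset.range n, √(b k / a k)) * ∏ k ∈ Finset.range n, √(a k / b k) = 1 := by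
        rw [← Finset.prod_mul_distrib]
        refine Finset.prod_eq_one fun k _ => ?_
        have := ha k
        have := hb k
        rw [← Real.sqrt_mul (by positivity)]
        rw [show b k / a k * (a k / b k) = 1 by field_simp, Real.sqrt_one]
      linear_combination (Real.exp (M * x / 2) * gaussianBall a n x) * h3
    exact le_of_tendsto_of_tendsto' (hs.mul hq) (hp.const_mul _) hle

/-! ### Laplace transforms of the ball probabilities -/

/-- The law N(0, b/(1 + 2lb)) has density √(1 + 2lb) e^{-lz²} with respect to N(0, b), and its total
mass is 1. -/
theorem lintegral_exp_neg_mul_sq_gaussianReal {b l : ℝ} (hb : 0 < b) (hl : 0 < l) :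
    ∫⁻ z, ENNReal.ofReal (Real.exp (-l * z ^ 2)) ∂gaussianReal 0 b.toNNReal =
      ENNReal.ofReal (√(1 + 2 * l * b))⁻¹ := by
  have ha : 0 < b / (1 + 2 * l * b) := by positivity
  have h := gaussianReal_eq_withDensity_gaussianReal ha hb
  have h1 : gaussianReal 0 (b / (1 + 2 * l * b)).toNNReal Set.univ = 1 := measure_univ
  have e1 : b / (b / (1 + 2 * l * b)) = 1 + 2 * l * b := by field_simp
  have e2 : ∀ z : ℝ, -(1 / (b / (1 + 2 * l * b)) - 1 / b) * z ^ 2 / 2 = -l * z ^ 2 := fun z => by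
    field_simp; ring
  rw [h, withDensity_apply _ MeasurableSet.univ, Measure.restrict_univ, e1] at h1
  simp_rw [e2, ENNReal.ofReal_mul (Real.sqrt_nonneg _)] at h1
  rw [lintegral_const_mul _ (by fun_prop)] at h1
  have hs : 0 < √(1 + 2 * l * b) := Real.sqrt_pos.2 (by positivity)
  rw [ENNReal.ofReal_inv_of_pos hs]
  exact ENNReal.eq_inv_of_mul_eq_one_left (by rw [mul_comm]; exact h1)

theorem lintegral_Ioi_exp_neg_mul {l c : ℝ} (hl : 0 < l) :
    ∫⁻ x in Set.Ioi c, ENNReal.ofReal (Real.exp (-l * x)) = ENNReal.ofReal (Real.exp (-l * c) / l) := by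
  have hl' : -l < 0 := by linarith
  rw [← ofReal_integral_eq_lintegral_ofReal (integrableOn_exp_mul_Ioi hl' c)
    (.of_forall fun _ => (Real.exp_pos _).le), integral_exp_mul_Ioi hl', neg_div_neg_eq]

theorem gaussianBall_nonneg (v : ℕ → ℝ) (n : ℕ) (x : ℝ) : 0 ≤ gaussianBall v n x := measureReal_nonneg

theorem gaussianBall_le_one (v : ℕ → ℝ) (n : ℕ) (x : ℝ) : gaussianBall v n x ≤ 1 :=
  measureReal_le_one

theorem gaussianBall_mono (v : ℕ → ℝ) (n : ℕ) : Monotone (gaussianBall v n) := fun _ _ hxy =>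
  measureReal_mono (fun _ hz => le_trans (α := ℝ) hz hxy)

/-- By Tonelli, the transform of x ↦ P{Q ≤ x} is E e^{-lQ} / l, and the expectation factors over the
coordinates. -/
theorem lintegral_exp_mul_gaussianBall {b : ℕ → ℝ} (hb : ∀ k, 0 < b k) {l : ℝ} (hl : 0 < l) (n : ℕ) :
    ∫⁻ x in Set.Ioi 0, ENNReal.ofReal (Real.exp (-l * x)) * ENNReal.ofReal (gaussianBall b n x) =
      ENNReal.ofReal (1 / l * ∏ k ∈ Finset.range n, (√(1 + 2 * l * b k))⁻¹) := by
  set π := Measure.pi fun k : Fin n => gaussianReal 0 (b k).toNNReal with hπ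
  have hmS : MeasurableSet {p : ℝ × (Fin n → ℝ) | ∑ k, p.2 k ^ 2 ≤ p.1} :=
    measurableSet_le (by fun_prop) (by fun_prop)
  have h1 : ∀ x : ℝ, ENNReal.ofReal (Real.exp (-l * x)) * ENNReal.ofReal (gaussianBall b n x) =
      ∫⁻ z, {p : ℝ × (Fin n → ℝ) | ∑ k, p.2 k ^ 2 ≤ p.1}.indicator
        (fun p => ENNReal.ofReal (Real.exp (-l * p.1))) (x, z) ∂π := by
    intro x
    have : (fun z => {p : ℝ × (Fin n → ℝ) | ∑ k, p.2 k ^ 2 ≤ p.1}.indicator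
        (fun p => ENNReal.ofReal (Real.exp (-l * p.1))) (x, z)) =
        {z : Fin n → ℝ | ∑ k, z k ^ 2 ≤ x}.indicator
          fun _ => ENNReal.ofReal (Real.exp (-l * x)) := by
      funext z; rfl
    rw [this, lintegral_indicator_const (measurableSet_le (by fun_prop) measurable_const),
      gaussianBall, ofReal_measureReal]
  simp_rw [h1]
  rw [lintegral_lintegral_swap]
  swap
  · exact (Measurable.indicator (by fun_prop) hmS).aemeasurable
  have h2 : ∀ z : Fin n → ℝ, ∫⁻ x in Set.Ioi 0,
      {p : ℝ × (Fin n → ℝ) | ∑ k, p.2 k ^ 2 ≤ p.1}.indicator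
        (fun p => ENNReal.ofReal (Real.exp (-l * p.1))) (x, z) =
      ENNReal.ofReal (1 / l) * ∏ k, ENNReal.ofReal (Real.exp (-l * z k ^ 2)) := by
    intro z
    set q := ∑ k, z k ^ 2 with hq
    have hq0 : 0 ≤ q := Finset.sum_nonneg fun _ _ => sq_nonneg _
    have : (fun x => {p : ℝ × (Fin n → ℝ) | ∑ k, p.2 k ^ 2 ≤ p.1}.indicator
        (fun p => ENNReal.ofReal (Real.exp (-l * p.1))) (x, z)) =
        (Set.Ici q).indicator fun x => ENNReal.ofReal (Real.exp (-l * x)) := by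
      funext x; rfl
    rw [this, lintegral_indicator measurableSet_Ici, Measure.restrict_restrict measurableSet_Ici]
    have hset : (Set.Ici q ∩ Set.Ioi 0 : Set ℝ) =ᵐ[volume] Set.Ioi q := by
      refine EventuallyLE.antisymm ?_ ?_
      · exact (LE.le.eventuallyLE Set.inter_subset_left).trans Ioi_ae_eq_Ici.symm.le
      · exact LE.le.eventuallyLE fun x hx =>
          ⟨Set.Ioi_subset_Ici_self hx, hq0.trans_lt hx⟩
    rw [Measure.restrict_congr_set hset, lintegral_Ioi_exp_neg_mul hl,
      ← ENNReal.ofReal_prod_of_nonneg fun _ _ => (Real.exp_pos _).le, ← Real.exp_sum,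
      ← ENNReal.ofReal_mul (by positivity), hq, Finset.mul_sum]
    congr 1; ring
  simp_rw [h2]
  rw [lintegral_const_mul _ (by fun_prop),
    lintegral_pi_prod (f := fun _ x => ENNReal.ofReal (Real.exp (-l * x ^ 2))) (fun _ => by fun_prop),
    ENNReal.ofReal_mul (by positivity), ENNReal.ofReal_prod_of_nonneg fun _ _ => by positivity,
    Finset.prod_range]
  simp_rw [lintegral_exp_neg_mul_sq_gaussianReal (hb _) hl]

theorem lintegral_exp_mul_limit_gaussianBall {b : ℕ → ℝ} (hb : ∀ k, 0 < b k) {l c : ℝ} (hl : 0 < l)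
    {p : ℝ → ℝ} (hp : ∀ x, 0 < x → Tendsto (fun n => gaussianBall b n x) atTop (𝓝 (p x)))
    (hc : Tendsto (fun n => ∏ k ∈ Finset.range n, (1 + 2 * l * b k)) atTop (𝓝 c)) (hc0 : 0 < c) :
    ∫⁻ x in Set.Ioi 0, ENNReal.ofReal (Real.exp (-l * x)) * ENNReal.ofReal (p x) =
      ENNReal.ofReal (1 / l * (√c)⁻¹) := by
  have h1 : Tendsto (fun n => ∫⁻ x in Set.Ioi 0,
      ENNReal.ofReal (Real.exp (-l * x)) * ENNReal.ofReal (gaussianBall b n x)) atTop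
      (𝓝 (∫⁻ x in Set.Ioi 0, ENNReal.ofReal (Real.exp (-l * x)) * ENNReal.ofReal (p x))) := by
    refine tendsto_lintegral_of_dominated_convergence'
      (fun x => ENNReal.ofReal (Real.exp (-l * x))) (fun n => ?_) (fun n => ?_) ?_ ?_
    · exact (Measurable.mul (by fun_prop) (gaussianBall_mono b n).measurable.ennreal_ofReal).aemeasurable
    · refine .of_forall fun x => mul_le_of_le_one_right' ?_
      rw [← ENNReal.ofReal_one]
      exact ENNReal.ofReal_le_ofReal (gaussianBall_le_one b n x)
    · rw [lintegral_Ioi_exp_neg_mul hl]; exact ENNReal.ofReal_ne_top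
    · filter_upwards [ae_restrict_mem measurableSet_Ioi] with x hx
      exact ENNReal.Tendsto.const_mul ((ENNReal.continuous_ofReal.tendsto _).comp (hp x hx))
        (.inr ENNReal.ofReal_ne_top)
  simp_rw [lintegral_exp_mul_gaussianBall hb hl] at h1
  refine tendsto_nhds_unique h1 ((ENNReal.continuous_ofReal.tendsto _).comp (Tendsto.const_mul _ ?_))
  have h2 := hc.sqrt.inv₀ (Real.sqrt_pos.2 hc0).ne'
  refine h2.congr fun n => ?_
  induction n with
  | zero => simp
  | succ n ih =>
    rw [Finset.prod_range_succ, Finset.prod_range_succ, Real.sqrt_mul, mul_inv, ih]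
    exact Finset.prod_nonneg fun k _ => by have := hb k; positivity

/-- A measurable function on `(0, ∞)` is determined by its Laplace transform. -/
theorem ae_eq_of_laplace_eq {f g : ℝ → ENNReal} (hf : AEMeasurable f (volume.restrict (Set.Ioi 0)))
    (hg : AEMeasurable g (volume.restrict (Set.Ioi 0)))
    (hfin : ∀ l : ℝ, 0 < l → ∫⁻ x in Set.Ioi 0, ENNReal.ofReal (Real.exp (-l * x)) * f x ≠ ⊤)
    (h : ∀ l : ℝ, 0 < l → ∫⁻ x in Set.Ioi 0, ENNReal.ofReal (Real.exp (-l * x)) * f x =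
      ∫⁻ x in Set.Ioi 0, ENNReal.ofReal (Real.exp (-l * x)) * g x) :
    f =ᵐ[volume.restrict (Set.Ioi 0)] g := by
  set ρ := (volume : Measure ℝ).restrict (Set.Ioi 0) with hρ
  -- The weight e^{-x} makes the measure finite and its moment generating function finite for t < 1.
  -- The imaginary axis is then interior to the half-plane of analyticity, and equality of
  -- transforms on the real axis reaches the characteristic functions by the identity theorem.
  set ν : (ℝ → ENNReal) → Measure ℝ := fun f =>
    ρ.withDensity fun x => ENNReal.ofReal (Real.exp (-1 * x)) * f x with hν
  have hEm : ∀ l : ℝ, Measurable fun x : ℝ => ENNReal.ofReal (Real.exp (-l * x)) := fun l => by fun_prop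
  have key : ∀ f : ℝ → ENNReal, AEMeasurable f ρ → ∀ t : ℝ,
      ∫⁻ x, ENNReal.ofReal (Real.exp (t * x)) ∂ν f =
        ∫⁻ x, ENNReal.ofReal (Real.exp (-(1 - t) * x)) * f x ∂ρ := by
    intro f hf t
    refine (lintegral_withDensity_eq_lintegral_mul₀ ((hEm 1).aemeasurable.mul hf)
      (by fun_prop)).trans ?_
    refine lintegral_congr fun x => ?_
    simp only [Pi.mul_apply]
    rw [mul_right_comm, ← ENNReal.ofReal_mul (Real.exp_pos _).le, ← Real.exp_add]
    congr 3; ring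
  have hint : ∀ f : ℝ → ENNReal, AEMeasurable f ρ →
      (∀ l : ℝ, 0 < l → ∫⁻ x, ENNReal.ofReal (Real.exp (-l * x)) * f x ∂ρ ≠ ⊤) →
      ∀ t < 1, Integrable (fun x => Real.exp (t * id x)) (ν f) := by
    intro f hf hfin t ht
    refine ⟨by fun_prop, ?_⟩
    rw [hasFiniteIntegral_iff_ofReal (.of_forall fun _ => (Real.exp_pos _).le)]
    simp only [id]
    rw [key f hf]
    exact (hfin _ (by linarith)).lt_top
  have hfing : ∀ l : ℝ, 0 < l → ∫⁻ x, ENNReal.ofReal (Real.exp (-l * x)) * g x ∂ρ ≠ ⊤ :=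
    fun l hl => by rw [← h l hl]; exact hfin l hl
  have hif := hint f hf hfin
  have hig := hint g hg hfing
  have hsub : ∀ f : ℝ → ENNReal, (∀ t < 1, Integrable (fun x => Real.exp (t * id x)) (ν f)) →
      {z : ℂ | z.re < 1} ⊆ {z | z.re ∈ interior (integrableExpSet id (ν f))} := by
    intro f hf z hz
    exact interior_maximal (fun t ht => hf t ht) isOpen_Iio hz
  have hmgf : ∀ t < 1, mgf id (ν f) t = mgf id (ν g) t := by
    intro t ht
    unfold mgf
    rw [integral_eq_lintegral_of_nonneg_ae (.of_forall fun _ => (Real.exp_pos _).le) (hif t ht).1,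
      integral_eq_lintegral_of_nonneg_ae (.of_forall fun _ => (Real.exp_pos _).le) (hig t ht).1]
    simp only [id]
    rw [key f hf, key g hg, h _ (by linarith)]
  have hfinm : ∀ f : ℝ → ENNReal, (∀ t < 1, Integrable (fun x => Real.exp (t * id x)) (ν f)) →
      IsFiniteMeasure (ν f) := by
    intro f hf
    have := hf 0 one_pos
    simp only [zero_mul, Real.exp_zero] at this
    exact (integrable_const_iff_isFiniteMeasure one_ne_zero).1 this
  have := hfinm f hif
  have := hfinm g hig
  have heq : Set.EqOn (complexMGF id (ν f)) (complexMGF id (ν g)) {z : ℂ | z.re < 1} := by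
    refine AnalyticOnNhd.eqOn_of_preconnected_of_frequently_eq
      (analyticOnNhd_complexMGF.mono (hsub f hif)) (analyticOnNhd_complexMGF.mono (hsub g hig))
      (convex_halfSpace_re_lt 1).isPreconnected (z₀ := 0) (by simp) ?_
    -- The real points -1/(n+1) accumulate at 0 inside the half-plane, and the real transforms agree
    -- there.
    have hseq : Tendsto (fun n : ℕ => ((-(1 / ((n : ℝ) + 1)) : ℝ) : ℂ)) atTop (𝓝[≠] 0) := by
      refine tendsto_nhdsWithin_iff.2 ⟨?_, .of_forall fun n => ?_⟩
      · have h0 := (tendsto_one_div_add_atTop_nhds_zero_nat (𝕜 := ℝ)).neg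
        rw [neg_zero] at h0
        exact_mod_cast (Complex.continuous_ofReal.tendsto 0).comp h0
      · have : (0 : ℝ) < 1 / ((n : ℝ) + 1) := by positivity
        simp only [Set.mem_compl_iff, Set.mem_singleton_iff, Complex.ofReal_eq_zero]
        linarith
    refine hseq.frequently (Frequently.of_forall fun n => ?_)
    have : (0 : ℝ) < 1 / ((n : ℝ) + 1) := by positivity
    rw [complexMGF_ofReal, complexMGF_ofReal, hmgf _ (by linarith)]
  have hmeas : ν f = ν g := by
    refine Measure.ext_of_charFun (funext fun t => ?_)
    rw [← complexMGF_id_mul_I, ← complexMGF_id_mul_I]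
    exact heq (by simp)
  have hd := (withDensity_eq_iff ((hEm 1).aemeasurable.mul hf) ((hEm 1).aemeasurable.mul hg)
    (hfin 1 one_pos)).1 hmeas
  filter_upwards [hd] with x hx
  exact (ENNReal.mul_right_inj (ENNReal.ofReal_pos.2 (Real.exp_pos _)).ne' ENNReal.ofReal_ne_top).1 hx

/-! ### Series for the distribution function of the squared bridge norm -/

/-- The coefficients of the binomial series of `(1 - q)^(-1/2)`. -/
noncomputable def invSqrtCoeff (n : ℕ) : ℝ := Ring.choose ((1 / 2 : ℝ) + n - 1) n

theorem factorial_mul_invSqrtCoeff (n : ℕ) :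
    (n.factorial : ℝ) * invSqrtCoeff n = ∏ j ∈ Finset.range n, ((1 / 2 : ℝ) + n - 1 - j) := by
  rw [invSqrtCoeff, ← nsmul_eq_mul, ← Ring.descPochhammer_eq_factorial_smul_choose,
    ← descPochhammer_eval_eq_prod_range, Polynomial.descPochhammer_smeval_eq_ascPochhammer,
    Polynomial.ascPochhammer_smeval_eq_eval, descPochhammer_eval_eq_ascPochhammer]

theorem invSqrtCoeff_zero : invSqrtCoeff 0 = 1 := by
  have := factorial_mul_invSqrtCoeff 0
  simpa using this

theorem invSqrtCoeff_nonneg (n : ℕ) : 0 ≤ invSqrtCoeff n := by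
  have h : 0 ≤ (n.factorial : ℝ) * invSqrtCoeff n := by
    rw [factorial_mul_invSqrtCoeff]
    refine Finset.prod_nonneg fun j hj => ?_
    have : (j : ℝ) + 1 ≤ n := by exact_mod_cast Finset.mem_range.1 hj
    linarith
  exact nonneg_of_mul_nonneg_right h (by positivity)

theorem invSqrtCoeff_le_one (n : ℕ) : invSqrtCoeff n ≤ 1 := by
  have h : (n.factorial : ℝ) * invSqrtCoeff n ≤ n.factorial * 1 := by
    rw [factorial_mul_invSqrtCoeff, mul_one]
    calc ∏ j ∈ Finset.range n, ((1 / 2 : ℝ) + n - 1 - j)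
        ≤ ∏ j ∈ Finset.range n, (((n - 1 - j : ℕ) + 1 : ℕ) : ℝ) := by
          refine Finset.prod_le_prod (fun j hj => ?_) fun j hj => ?_
          · have : (j : ℝ) + 1 ≤ n := by exact_mod_cast Finset.mem_range.1 hj
            linarith
          · have hj := Finset.mem_range.1 hj
            have : (((n - 1 - j : ℕ) + 1 : ℕ) : ℝ) = n - j := by
              rw [show n - 1 - j + 1 = n - j by omega, Nat.cast_sub hj.le]
            rw [this]; linarith
      _ = n.factorial := by
          rw [Finset.prod_range_reflect (fun k => (((k + 1 : ℕ)) : ℝ)) n, ← Nat.cast_prod,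
            Finset.prod_range_add_one_eq_factorial]
  exact le_of_mul_le_mul_left h (by positivity)

theorem hasSum_invSqrtCoeff {q : ℝ} (h0 : 0 ≤ q) (h1 : q < 1) :
    HasSum (fun n => invSqrtCoeff n * q ^ n) (√(1 - q))⁻¹ := by
  have h := (Real.one_div_one_sub_rpow_hasFPowerSeriesOnBall_zero (1 / 2)).hasSum (y := q)
    (by simpa [abs_of_nonneg h0, enorm_eq_nnnorm, ← NNReal.coe_lt_coe] using h1)
  simp only [zero_add, FormalMultilinearSeries.ofScalars_apply_eq] at h
  rw [Real.sqrt_eq_rpow, ← one_div]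
  simpa [invSqrtCoeff] using h

theorem tendsto_intervalIntegral_gaussian_atTop :
    Tendsto (fun u : ℝ => ∫ v in (0 : ℝ)..u, Real.exp (-(1 / 2) * v ^ 2)) atTop
      (𝓝 (√(2 * Real.pi) / 2)) := by
  have h := intervalIntegral_tendsto_integral_Ioi 0
    (integrable_exp_neg_mul_sq (b := 1 / 2) (by norm_num)).integrableOn tendsto_id
  rw [integral_gaussian_Ioi] at h
  convert! h using 4
  ring

theorem tendsto_intervalIntegral_gaussian_atBot :
    Tendsto (fun u : ℝ => ∫ v in (0 : ℝ)..u, Real.exp (-(1 / 2) * v ^ 2)) atBot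
      (𝓝 (-(√(2 * Real.pi) / 2))) := by
  have h := (tendsto_intervalIntegral_gaussian_atTop.comp tendsto_neg_atBot_atTop).neg
  refine h.congr fun u => ?_
  have := intervalIntegral.integral_comp_neg (a := 0) (b := u)
    fun v : ℝ => Real.exp (-(1 / 2) * v ^ 2)
  simp only [neg_sq, neg_zero] at this
  rw [Function.comp_apply, this, intervalIntegral.integral_symm, neg_neg]

/-- The Laplace transform of the function `x ↦ (2πx)^(-1/2) exp (-a²/(2x))`. -/
theorem lintegral_exp_mul_heatKernel {a y : ℝ} (ha : 0 < a) (hy : 0 < y) :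
    ∫⁻ x in Set.Ioi 0, ENNReal.ofReal (Real.exp (-(y ^ 2 / 2) * x)) *
      ENNReal.ofReal ((√(2 * Real.pi * x))⁻¹ * Real.exp (-(a ^ 2) / (2 * x))) =
      ENNReal.ofReal (Real.exp (-(a * y)) / y) := by
  set E : ℝ → ℝ := fun u => ∫ v in (0 : ℝ)..u, Real.exp (-(1 / 2) * v ^ 2) with hE
  set s := √(2 * Real.pi) with hs
  have hs0 : 0 < s := Real.sqrt_pos.2 (by positivity)
  have hE' : ∀ u, HasDerivAt E (Real.exp (-(1 / 2) * u ^ 2)) u := fun u => by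
    have hc : Continuous fun v : ℝ => Real.exp (-(1 / 2) * v ^ 2) := by fun_prop
    exact intervalIntegral.integral_hasDerivAt_right (hc.intervalIntegrable _ _)
      hc.stronglyMeasurable.stronglyMeasurableAtFilter hc.continuousAt
  -- An explicit antiderivative. Completing the square, -(y√x ∓ a/√x)²/2 = ±ay - y²x/2 - a²/(2x), so
  -- the prefactors cancel e^{±ay}; in the sum of the two inner derivatives the terms with a cancel.
  set g : ℝ → ℝ := fun x => (s * y)⁻¹ * (Real.exp (-(a * y)) * E (y * √x - a / √x) +
    Real.exp (a * y) * E (y * √x + a / √x)) with hg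
  set g' : ℝ → ℝ := fun x => Real.exp (-(y ^ 2 / 2) * x) *
    ((√(2 * Real.pi * x))⁻¹ * Real.exp (-(a ^ 2) / (2 * x))) with hg'
  have hderiv : ∀ x ∈ Set.Ioi (0 : ℝ), HasDerivAt g (g' x) x := by
    intro x hx
    have hx : 0 < x := hx
    set r := √x with hr
    have hr0 : 0 < r := Real.sqrt_pos.2 hx
    have hrx : x = r ^ 2 := (Real.sq_sqrt hx.le).symm
    have d0 : HasDerivAt (fun x => √x) (1 / (2 * r)) x := Real.hasDerivAt_sqrt hx.ne'
    have d1 := (d0.const_mul y).sub ((hasDerivAt_const x a).div d0 hr0.ne')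
    have d2 := (d0.const_mul y).add ((hasDerivAt_const x a).div d0 hr0.ne')
    have d3 := ((((hE' _).comp x d1).const_mul (Real.exp (-(a * y)))).add
      (((hE' _).comp x d2).const_mul (Real.exp (a * y)))).const_mul (s * y)⁻¹
    refine d3.congr_deriv ?_
    have e1 : Real.exp (-(1 / 2) * (y * r - a / r) ^ 2) =
        Real.exp (a * y) * (Real.exp (-(y ^ 2 / 2) * x) * Real.exp (-(a ^ 2) / (2 * x))) := by
      rw [← Real.exp_add, ← Real.exp_add, hrx]; congr 1; field_simp; ring
    have e2 : Real.exp (-(1 / 2) * (y * r + a / r) ^ 2) =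
        Real.exp (-(a * y)) * (Real.exp (-(y ^ 2 / 2) * x) * Real.exp (-(a ^ 2) / (2 * x))) := by
      rw [← Real.exp_add, ← Real.exp_add, hrx]; congr 1; field_simp; ring
    have e3 : Real.exp (-(a * y)) * Real.exp (a * y) = 1 := by
      rw [← Real.exp_add, neg_add_cancel, Real.exp_zero]
    simp only [hg', Pi.sub_apply, Pi.add_apply, Pi.div_apply]
    rw [← hr, e1, e2, Real.sqrt_mul (by positivity), ← hs, ← hr]
    generalize Real.exp (-(y ^ 2 / 2) * x) = A
    generalize Real.exp (-(a ^ 2) / (2 * x)) = B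
    generalize Real.exp (-(a * y)) = U at e3 ⊢
    generalize Real.exp (a * y) = V at e3 ⊢
    field_simp
    linear_combination (2 * y * A * B * r ^ 2) * e3
  have hg0 : Tendsto g (𝓝[>] 0) (𝓝 ((s * y)⁻¹ * (Real.exp (-(a * y)) * -(s / 2) +
      Real.exp (a * y) * (s / 2)))) := by
    have t1 : Tendsto (fun x : ℝ => √x) (𝓝[>] 0) (𝓝[>] 0) := by
      refine tendsto_nhdsWithin_iff.2 ⟨?_, ?_⟩
      · have := (Real.continuous_sqrt.tendsto 0).mono_left (nhdsWithin_le_nhds (s := Set.Ioi 0))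
        rwa [Real.sqrt_zero] at this
      · filter_upwards [self_mem_nhdsWithin] with x hx using Real.sqrt_pos.2 hx
    have t2 : Tendsto (fun x : ℝ => a / √x) (𝓝[>] 0) atTop := by
      simp_rw [div_eq_mul_inv]
      exact (tendsto_inv_nhdsGT_zero.comp t1).const_mul_atTop ha
    have t3 : Tendsto (fun x : ℝ => y * √x) (𝓝[>] 0) (𝓝 (y * 0)) :=
      (t1.mono_right nhdsWithin_le_nhds).const_mul y
    have t4 := tendsto_intervalIntegral_gaussian_atTop.comp (t3.add_atTop t2)
    have t5 : Tendsto (fun x : ℝ => y * √x - a / √x) (𝓝[>] 0) atBot := by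
      simp_rw [sub_eq_add_neg]
      exact t3.add_atBot (tendsto_neg_atTop_atBot.comp t2)
    have t6 := tendsto_intervalIntegral_gaussian_atBot.comp t5
    exact ((t6.const_mul _).add (t4.const_mul _)).const_mul _
  have hgi : Tendsto g atTop (𝓝 ((s * y)⁻¹ * (Real.exp (-(a * y)) * (s / 2) +
      Real.exp (a * y) * (s / 2)))) := by
    have t1 : Tendsto (fun x : ℝ => a / √x) atTop (𝓝 0) :=
      Tendsto.div_atTop tendsto_const_nhds Real.tendsto_sqrt_atTop
    have t2 : Tendsto (fun x : ℝ => y * √x) atTop atTop :=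
      Real.tendsto_sqrt_atTop.const_mul_atTop hy
    have t4 := tendsto_intervalIntegral_gaussian_atTop.comp (t2.atTop_add t1)
    have t5 : Tendsto (fun x : ℝ => y * √x - a / √x) atTop atTop := by
      simp_rw [sub_eq_add_neg]
      exact t2.atTop_add t1.neg
    have t6 := tendsto_intervalIntegral_gaussian_atTop.comp t5
    exact ((t6.const_mul _).add (t4.const_mul _)).const_mul _
  have hg'0 : ∀ x, 0 ≤ g' x := fun x => by simp only [hg']; positivity
  -- The formula for g has no meaningful value at 0, where it divides by √0; it is replaced by the
  -- right limit so that the fundamental theorem applies on the half-line.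
  set G := Function.update g 0 ((s * y)⁻¹ * (Real.exp (-(a * y)) * -(s / 2) +
      Real.exp (a * y) * (s / 2))) with hG
  have hGc : ContinuousWithinAt G (Set.Ici 0) 0 := by
    rw [hG, continuousWithinAt_update_same, Set.Ici_sdiff_left]
    exact hg0
  have hGd : ∀ x ∈ Set.Ioi (0 : ℝ), HasDerivAt G (g' x) x := fun x hx => by
    refine (hderiv x hx).congr_of_eventuallyEq ?_
    filter_upwards [isOpen_ne.mem_nhds (ne_of_gt hx)] with z hz
    exact Function.update_of_ne hz _ _
  have hGi : Tendsto G atTop (𝓝 ((s * y)⁻¹ * (Real.exp (-(a * y)) * (s / 2) +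
      Real.exp (a * y) * (s / 2)))) := by
    refine hgi.congr' ?_
    filter_upwards [eventually_gt_atTop 0] with x hx
    exact (Function.update_of_ne hx.ne' _ _).symm
  have hint := integrableOn_Ioi_deriv_of_nonneg hGc hGd (fun x _ => hg'0 x) hGi
  have hval := integral_Ioi_of_hasDerivAt_of_nonneg hGc hGd (fun x _ => hg'0 x) hGi
  have : ∀ x, ENNReal.ofReal (Real.exp (-(y ^ 2 / 2) * x)) *
      ENNReal.ofReal ((√(2 * Real.pi * x))⁻¹ * Real.exp (-(a ^ 2) / (2 * x))) =
      ENNReal.ofReal (g' x) := fun x => (ENNReal.ofReal_mul (Real.exp_pos _).le).symm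
  simp_rw [this]
  rw [← ofReal_integral_eq_lintegral_ofReal hint (.of_forall hg'0), hval, hG,
    Function.update_self]
  congr 1
  field_simp
  ring

theorem lintegral_rpow_mul_exp_neg_mul_Ioi {s c : ℝ} (hs : 0 < s) (hc : 0 < c) :
    ∫⁻ r in Set.Ioi 0, ENNReal.ofReal (r ^ (s - 1) * Real.exp (-(c * r))) =
      ENNReal.ofReal ((1 / c) ^ s * Real.Gamma s) := by
  have h := Real.integral_rpow_mul_exp_neg_mul_Ioi hs hc
  have hpos : 0 < (1 / c) ^ s * Real.Gamma s := mul_pos (by positivity) (Real.Gamma_pos_of_pos hs)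
  rw [← ofReal_integral_eq_lintegral_ofReal (Integrable.of_integral_ne_zero (h ▸ hpos.ne')), h]
  filter_upwards [ae_restrict_mem measurableSet_Ioi] with r hr
  have hr : 0 < r := hr
  positivity

/-- The function with the Laplace transform `y^(-3/2) exp (-a y)`, where `y` is the square root of
twice the argument. -/
noncomputable def heatMixture (a x : ℝ) : ENNReal :=
  ENNReal.ofReal (√Real.pi)⁻¹ * ∫⁻ r in Set.Ioi 0, ENNReal.ofReal (r ^ ((1 / 2 : ℝ) - 1)) *
    ENNReal.ofReal ((√(2 * Real.pi * x))⁻¹ * Real.exp (-((a + r) ^ 2) / (2 * x)))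

theorem measurable_heatMixture_integrand (a : ℝ) : Measurable fun q : ℝ × ℝ =>
    ENNReal.ofReal (q.2 ^ ((1 / 2 : ℝ) - 1)) *
    ENNReal.ofReal ((√(2 * Real.pi * q.1))⁻¹ * Real.exp (-((a + q.2) ^ 2) / (2 * q.1))) := by
  fun_prop

theorem measurable_heatMixture (a : ℝ) : Measurable (heatMixture a) :=
  (measurable_heatMixture_integrand a).lintegral_prod_right'.const_mul _

/-- By Tonelli, the heat kernel at a + r contributes e^{-(a+r)y}/y, and the Gamma integral of
r^{-1/2} e^{-yr} supplies the missing factor y^{-1/2}. -/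
theorem lintegral_exp_mul_heatMixture {a y : ℝ} (ha : 0 < a) (hy : 0 < y) :
    ∫⁻ x in Set.Ioi 0, ENNReal.ofReal (Real.exp (-(y ^ 2 / 2) * x)) * heatMixture a x =
      ENNReal.ofReal (Real.exp (-(a * y)) / (y * √y)) := by
  have h1 : ∀ x : ℝ, ENNReal.ofReal (Real.exp (-(y ^ 2 / 2) * x)) * heatMixture a x =
      ENNReal.ofReal (√Real.pi)⁻¹ * ∫⁻ r in Set.Ioi 0, ENNReal.ofReal (Real.exp (-(y ^ 2 / 2) * x)) *
        (ENNReal.ofReal (r ^ ((1 / 2 : ℝ) - 1)) *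
        ENNReal.ofReal ((√(2 * Real.pi * x))⁻¹ * Real.exp (-((a + r) ^ 2) / (2 * x)))) := by
    intro x
    rw [heatMixture, mul_left_comm, lintegral_const_mul _ (by fun_prop)]
  simp_rw [h1]
  have hm : Measurable fun q : ℝ × ℝ => ENNReal.ofReal (Real.exp (-(y ^ 2 / 2) * q.1)) *
      (ENNReal.ofReal (q.2 ^ ((1 / 2 : ℝ) - 1)) *
      ENNReal.ofReal ((√(2 * Real.pi * q.1))⁻¹ * Real.exp (-((a + q.2) ^ 2) / (2 * q.1)))) :=
    Measurable.mul (by fun_prop) (measurable_heatMixture_integrand a)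
  rw [lintegral_const_mul _ hm.lintegral_prod_right', lintegral_lintegral_swap hm.aemeasurable]
  have h2 : ∀ r ∈ Set.Ioi (0 : ℝ), ∫⁻ x in Set.Ioi 0, ENNReal.ofReal (Real.exp (-(y ^ 2 / 2) * x)) *
      (ENNReal.ofReal (r ^ ((1 / 2 : ℝ) - 1)) *
      ENNReal.ofReal ((√(2 * Real.pi * x))⁻¹ * Real.exp (-((a + r) ^ 2) / (2 * x)))) =
      ENNReal.ofReal (Real.exp (-(a * y)) / y) *
        ENNReal.ofReal (r ^ ((1 / 2 : ℝ) - 1) * Real.exp (-(y * r))) := by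
    intro r hr
    have hr : 0 < r := hr
    simp_rw [mul_left_comm _ (ENNReal.ofReal (r ^ ((1 / 2 : ℝ) - 1)))]
    rw [lintegral_const_mul _ (by fun_prop), lintegral_exp_mul_heatKernel (by positivity) hy,
      ← ENNReal.ofReal_mul (by positivity), ← ENNReal.ofReal_mul (by positivity),
      show -((a + r) * y) = -(a * y) + -(y * r) by ring, Real.exp_add]
    congr 1; ring
  rw [setLIntegral_congr_fun measurableSet_Ioi h2, lintegral_const_mul _ (by fun_prop),
    lintegral_rpow_mul_exp_neg_mul_Ioi (by norm_num) hy, ← ENNReal.ofReal_mul (by positivity),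
    ← ENNReal.ofReal_mul (by positivity), Real.Gamma_one_half_eq, ← Real.sqrt_eq_rpow,
    Real.sqrt_div zero_le_one, Real.sqrt_one]
  have : 0 < √Real.pi := Real.sqrt_pos.2 Real.pi_pos
  have : 0 < √y := Real.sqrt_pos.2 hy
  congr 1
  field_simp

/-- Expanding (a + r)² isolates e^{-a²/(2x)} and leaves a Gamma integral at rate a/x, perturbed by
the factor e^{-r²/(2x)}, which is at most 1. -/
theorem heatMixture_eq {a x : ℝ} (hx : 0 < x) : heatMixture a x =
    ENNReal.ofReal ((√Real.pi)⁻¹ * (√(2 * Real.pi * x))⁻¹ * Real.exp (-(a ^ 2) / (2 * x))) *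
      ∫⁻ r in Set.Ioi 0, ENNReal.ofReal (r ^ ((1 / 2 : ℝ) - 1) * Real.exp (-(a / x * r))) *
        ENNReal.ofReal (Real.exp (-(r ^ 2) / (2 * x))) := by
  rw [mul_assoc, ENNReal.ofReal_mul (by positivity), mul_assoc, heatMixture,
    ← lintegral_const_mul (ENNReal.ofReal ((√(2 * Real.pi * x))⁻¹ * Real.exp (-(a ^ 2) / (2 * x))))
      (by fun_prop)]
  congr 1
  refine setLIntegral_congr_fun measurableSet_Ioi fun r hr => ?_
  have hr : 0 < r := hr
  rw [← ENNReal.ofReal_mul (by positivity), ← ENNReal.ofReal_mul (by positivity),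
    ← ENNReal.ofReal_mul (by positivity)]
  have : Real.exp (-((a + r) ^ 2) / (2 * x)) = Real.exp (-(a ^ 2) / (2 * x)) *
      (Real.exp (-(a / x * r)) * Real.exp (-(r ^ 2) / (2 * x))) := by
    rw [← Real.exp_add, ← Real.exp_add]; congr 1; field_simp; ring
  rw [this]
  congr 1; ring

theorem heatMixture_const_mul {a x : ℝ} (ha : 0 < a) (hx : 0 < x) :
    (√Real.pi)⁻¹ * (√(2 * Real.pi * x))⁻¹ * ((1 / (a / x)) ^ (1 / 2 : ℝ) * Real.Gamma (1 / 2)) =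
      (√(2 * Real.pi * a))⁻¹ := by
  have : 0 < √Real.pi := Real.sqrt_pos.2 Real.pi_pos
  have : 0 < √(2 * Real.pi) := Real.sqrt_pos.2 (by positivity)
  have : 0 < √x := Real.sqrt_pos.2 hx
  have : 0 < √a := Real.sqrt_pos.2 ha
  rw [Real.Gamma_one_half_eq, ← Real.sqrt_eq_rpow, one_div_div, Real.sqrt_div hx.le,
    Real.sqrt_mul (x := 2 * Real.pi) (by positivity) x,
    Real.sqrt_mul (x := 2 * Real.pi) (by positivity) a]
  field_simp

theorem heatMixture_le {a x : ℝ} (ha : 0 < a) (hx : 0 < x) : heatMixture a x ≤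
    ENNReal.ofReal ((√(2 * Real.pi * a))⁻¹ * Real.exp (-(a ^ 2) / (2 * x))) := by
  rw [heatMixture_eq hx]
  have h1 : ∫⁻ r in Set.Ioi 0, ENNReal.ofReal (r ^ ((1 / 2 : ℝ) - 1) * Real.exp (-(a / x * r))) *
        ENNReal.ofReal (Real.exp (-(r ^ 2) / (2 * x))) ≤
      ENNReal.ofReal ((1 / (a / x)) ^ (1 / 2 : ℝ) * Real.Gamma (1 / 2)) := by
    rw [← lintegral_rpow_mul_exp_neg_mul_Ioi (by norm_num) (div_pos ha hx)]
    refine lintegral_mono fun r => mul_le_of_le_one_right' ?_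
    rw [← ENNReal.ofReal_one]
    refine ENNReal.ofReal_le_ofReal (Real.exp_le_one_iff.2 ?_)
    rw [neg_div]
    exact neg_nonpos.2 (by positivity)
  refine (mul_le_mul_right h1 _).trans (le_of_eq ?_)
  rw [← ENNReal.ofReal_mul (by positivity), ← heatMixture_const_mul ha hx]
  congr 1; ring

/-- Here 1 - r²/(2x) ≤ e^{-r²/(2x)}, and the correction is a Gamma integral with Γ(5/2) = (3/4)
Γ(1/2). Its relative size is (1/(2x)) (x/a)² (3/4) = 3x/(8a²). -/
theorem le_heatMixture {a x : ℝ} (ha : 0 < a) (hx : 0 < x) :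
    ENNReal.ofReal ((√(2 * Real.pi * a))⁻¹ * Real.exp (-(a ^ 2) / (2 * x)) *
      (1 - 3 * x / (8 * a ^ 2))) ≤ heatMixture a x := by
  rw [heatMixture_eq hx]
  have hax := div_pos ha hx
  set I := ∫⁻ r in Set.Ioi 0, ENNReal.ofReal (r ^ ((1 / 2 : ℝ) - 1) * Real.exp (-(a / x * r))) *
        ENNReal.ofReal (Real.exp (-(r ^ 2) / (2 * x))) with hI
  have hG : Real.Gamma (5 / 2) = 3 / 4 * Real.Gamma (1 / 2) := by
    rw [show (5 / 2 : ℝ) = (1 / 2 + 1) + 1 by norm_num, Real.Gamma_add_one (by norm_num),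
      Real.Gamma_add_one (by norm_num)]
    ring
  have hR : (1 / (a / x)) ^ (5 / 2 : ℝ) = (1 / (a / x)) ^ (1 / 2 : ℝ) * (x / a) ^ 2 := by
    rw [one_div_div, show (5 / 2 : ℝ) = 1 / 2 + (2 : ℕ) by norm_num,
      Real.rpow_add_natCast (div_pos hx ha).ne']
  set A := (1 / (a / x)) ^ (1 / 2 : ℝ) * Real.Gamma (1 / 2) with hA
  have h1 : ENNReal.ofReal A ≤ I + ENNReal.ofReal (3 * x / (8 * a ^ 2) * A) := by
    have e : 3 * x / (8 * a ^ 2) * A =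
        1 / (2 * x) * ((1 / (a / x)) ^ (5 / 2 : ℝ) * Real.Gamma (5 / 2)) := by
      rw [hG, hR, hA]; field_simp; ring
    rw [e, ENNReal.ofReal_mul (p := 1 / (2 * x)) (by positivity), hA,
      ← lintegral_rpow_mul_exp_neg_mul_Ioi (by norm_num) hax,
      ← lintegral_rpow_mul_exp_neg_mul_Ioi (by norm_num) hax,
      ← lintegral_const_mul _ (by fun_prop), hI, ← lintegral_add_left (by fun_prop)]
    refine setLIntegral_mono (by fun_prop) fun r hr => ?_
    have hr : 0 < r := hr
    have e2 : r ^ ((5 / 2 : ℝ) - 1) = r ^ ((1 / 2 : ℝ) - 1) * r ^ 2 := by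
      rw [show (5 / 2 : ℝ) - 1 = 1 / 2 - 1 + (2 : ℕ) by norm_num, Real.rpow_add_natCast hr.ne']
    rw [e2, ← ENNReal.ofReal_mul (by positivity), ← ENNReal.ofReal_mul (by positivity),
      ← ENNReal.ofReal_add (by positivity) (by positivity)]
    refine ENNReal.ofReal_le_ofReal ?_
    have h3 : 1 ≤ Real.exp (-(r ^ 2) / (2 * x)) + 1 / (2 * x) * r ^ 2 := by
      have := Real.add_one_le_exp (-(r ^ 2) / (2 * x))
      have e4 : -(r ^ 2) / (2 * x) = -(1 / (2 * x) * r ^ 2) := by ring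
      rw [e4] at this ⊢
      linarith
    have h4 : 0 ≤ r ^ ((1 / 2 : ℝ) - 1) * Real.exp (-(a / x * r)) := by positivity
    calc r ^ ((1 / 2 : ℝ) - 1) * Real.exp (-(a / x * r))
        = r ^ ((1 / 2 : ℝ) - 1) * Real.exp (-(a / x * r)) * 1 := (mul_one _).symm
      _ ≤ _ := mul_le_mul_of_nonneg_left h3 h4
      _ = _ := by ring
  have hA0 : 0 ≤ A := mul_nonneg (by positivity) (Real.Gamma_pos_of_pos (by norm_num)).le
  have h2 : ENNReal.ofReal (A * (1 - 3 * x / (8 * a ^ 2))) ≤ I := by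
    rw [show A * (1 - 3 * x / (8 * a ^ 2)) = A - 3 * x / (8 * a ^ 2) * A by ring,
      ENNReal.ofReal_sub _ (by positivity)]
    exact tsub_le_iff_right.2 h1
  refine le_trans (le_of_eq ?_) (mul_le_mul_right h2 _)
  rw [← ENNReal.ofReal_mul (by positivity), ← heatMixture_const_mul ha hx]
  congr 1; ring

/-- The distribution function of the squared norm of the Brownian bridge, as a series. -/
noncomputable def bridgeSeries (x : ℝ) : ENNReal :=
  ∑' n : ℕ, ENNReal.ofReal (2 * √2 * invSqrtCoeff n) * heatMixture (2 * n + 1 / 2) x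

theorem measurable_bridgeSeries : Measurable bridgeSeries :=
  Measurable.tsum fun _ => (measurable_heatMixture _).const_mul _

/-- Since sinh y / y = e^y (1 - e^{-2y})/(2y), the right side is 2√2 y^{-3/2} e^{-y/2} (1 -
e^{-2y})^{-1/2}. The binomial series turns it into terms y^{-3/2} e^{-(2n + 1/2)y}. -/
theorem lintegral_exp_mul_bridgeSeries {y : ℝ} (hy : 0 < y) :
    ∫⁻ x in Set.Ioi 0, ENNReal.ofReal (Real.exp (-(y ^ 2 / 2) * x)) * bridgeSeries x =
      ENNReal.ofReal (1 / (y ^ 2 / 2) * (√(Real.sinh y / y))⁻¹) := by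
  have h1 : ∀ x : ℝ, ENNReal.ofReal (Real.exp (-(y ^ 2 / 2) * x)) * bridgeSeries x =
      ∑' n : ℕ, ENNReal.ofReal (2 * √2 * invSqrtCoeff n) *
        (ENNReal.ofReal (Real.exp (-(y ^ 2 / 2) * x)) * heatMixture (2 * n + 1 / 2) x) := by
    intro x
    rw [bridgeSeries, ← ENNReal.tsum_mul_left]
    exact tsum_congr fun n => mul_left_comm _ _ _
  simp_rw [h1]
  have hm : ∀ n : ℕ, Measurable fun x : ℝ =>
      ENNReal.ofReal (Real.exp (-(y ^ 2 / 2) * x)) * heatMixture (2 * n + 1 / 2) x := fun n =>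
    Measurable.mul (by fun_prop) (measurable_heatMixture _)
  rw [lintegral_tsum fun n => ((hm n).const_mul _).aemeasurable]
  have h2 : ∀ n : ℕ, ∫⁻ x in Set.Ioi 0, ENNReal.ofReal (2 * √2 * invSqrtCoeff n) *
        (ENNReal.ofReal (Real.exp (-(y ^ 2 / 2) * x)) * heatMixture (2 * n + 1 / 2) x) =
      ENNReal.ofReal (2 * √2 * Real.exp (-(y / 2)) / (y * √y) *
        (invSqrtCoeff n * Real.exp (-(2 * y)) ^ n)) := by
    intro n
    have := invSqrtCoeff_nonneg n
    rw [lintegral_const_mul _ (hm n), lintegral_exp_mul_heatMixture (by positivity) hy,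
      ← ENNReal.ofReal_mul (by positivity), ← Real.exp_nat_mul,
      show -((2 * (n : ℝ) + 1 / 2) * y) = -(y / 2) + n * -(2 * y) by ring, Real.exp_add]
    congr 1; ring
  simp_rw [h2]
  have hs := (hasSum_invSqrtCoeff (q := Real.exp (-(2 * y))) (Real.exp_pos _).le
    (Real.exp_lt_one_iff.2 (by linarith))).mul_left (2 * √2 * Real.exp (-(y / 2)) / (y * √y))
  rw [← ENNReal.ofReal_tsum_of_nonneg (fun n => mul_nonneg (by positivity)
    (mul_nonneg (invSqrtCoeff_nonneg n) (by positivity))) hs.summable, hs.tsum_eq]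
  congr 1
  have hq : 0 < 1 - Real.exp (-(2 * y)) := sub_pos.2 (Real.exp_lt_one_iff.2 (by linarith))
  have e1 : Real.sinh y / y = Real.exp (y / 2) ^ 2 * ((1 - Real.exp (-(2 * y))) / (2 * y)) := by
    rw [← Real.exp_nat_mul, Real.sinh_eq, mul_div_assoc', mul_sub, ← Real.exp_add]
    field_simp
    ring_nf
  rw [e1, Real.sqrt_mul (by positivity), Real.sqrt_sq (by positivity), Real.sqrt_div hq.le,
    Real.sqrt_mul zero_le_two, Real.exp_neg (y / 2)]
  have : 0 < √2 := by positivity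
  have : 0 < √y := Real.sqrt_pos.2 hy
  have : 0 < √(1 - Real.exp (-(2 * y))) := Real.sqrt_pos.2 hq
  have := Real.sq_sqrt hy.le
  field_simp
  linear_combination (-1 : ℝ) * this

/-- Only the term n = 0 is kept; with a = 1/2 the correction 3x/(8a²) is 3x/2. -/
theorem le_bridgeSeries {x : ℝ} (hx : 0 < x) :
    ENNReal.ofReal (√(8 / Real.pi) * Real.exp (-(1 / 8) * x⁻¹) * (1 - 3 / 2 * x)) ≤
      bridgeSeries x := by
  refine le_trans ?_ (ENNReal.le_tsum 0)
  refine le_trans (le_of_eq ?_) (mul_le_mul_right (le_heatMixture (by norm_num) hx) _)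
  rw [invSqrtCoeff_zero, ← ENNReal.ofReal_mul (by positivity)]
  have : 0 < √Real.pi := Real.sqrt_pos.2 Real.pi_pos
  have e1 : √(8 / Real.pi) = 2 * √2 * (√Real.pi)⁻¹ := by
    rw [Real.sqrt_div (by norm_num), show (8 : ℝ) = 2 ^ 2 * 2 by norm_num,
      Real.sqrt_mul (by norm_num), Real.sqrt_sq (by norm_num)]
    ring
  rw [e1]
  push_cast
  rw [show 2 * Real.pi * (2 * 0 + 1 / 2) = Real.pi by ring,
    show -((2 * 0 + 1 / 2 : ℝ) ^ 2) / (2 * x) = -(1 / 8) * x⁻¹ by field_simp; norm_num]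
  congr 1
  ring

/-- As (2n + 1/2)²/2 = 1/8 + n + 2n² and e^{-1/x} ≤ x, the terms are dominated by a geometric series
of ratio x times the leading term. -/
theorem bridgeSeries_le {x : ℝ} (hx : 0 < x) (hx1 : x < 1) :
    bridgeSeries x ≤
      ENNReal.ofReal (√(8 / Real.pi) * Real.exp (-(1 / 8) * x⁻¹) * (1 - x)⁻¹) := by
  have hsum := (hasSum_geometric_of_lt_one hx.le hx1).mul_left
    (√(8 / Real.pi) * Real.exp (-(1 / 8) * x⁻¹))
  rw [← hsum.tsum_eq, ENNReal.ofReal_tsum_of_nonneg (fun n => by positivity) hsum.summable]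
  refine ENNReal.tsum_le_tsum fun n => ?_
  refine (mul_le_mul_right (heatMixture_le (by positivity) hx) _).trans ?_
  have hc := invSqrtCoeff_nonneg n
  rw [← ENNReal.ofReal_mul (by positivity)]
  refine ENNReal.ofReal_le_ofReal ?_
  have hpi : 0 < √Real.pi := Real.sqrt_pos.2 Real.pi_pos
  have e1 : √(8 / Real.pi) = 2 * √2 * 1 * (√Real.pi)⁻¹ := by
    rw [Real.sqrt_div (by norm_num), show (8 : ℝ) = 2 ^ 2 * 2 by norm_num,
      Real.sqrt_mul (by norm_num), Real.sqrt_sq (by norm_num)]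
    ring
  have h1 : (√(2 * Real.pi * (2 * n + 1 / 2)))⁻¹ ≤ (√Real.pi)⁻¹ := by
    have : 0 ≤ Real.pi * n := by positivity
    gcongr
    linarith
  have h2 : Real.exp (-((2 * n + 1 / 2 : ℝ) ^ 2) / (2 * x)) ≤ Real.exp (-(1 / 8) * x⁻¹) * x ^ n := by
    have h3 : Real.exp (-x⁻¹) ≤ x := by
      rw [Real.exp_neg, inv_le_comm₀ (Real.exp_pos _) hx]
      linarith [Real.add_one_le_exp x⁻¹]
    calc Real.exp (-((2 * n + 1 / 2 : ℝ) ^ 2) / (2 * x))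
        ≤ Real.exp (-(1 / 8) * x⁻¹ + n * -x⁻¹) := by
          refine Real.exp_le_exp.2 ?_
          have : -((2 * n + 1 / 2 : ℝ) ^ 2) / (2 * x) =
              -(1 / 8) * x⁻¹ + n * -x⁻¹ - 2 * n ^ 2 * x⁻¹ := by field_simp; ring
          have h0 : 0 ≤ 2 * (n : ℝ) ^ 2 * x⁻¹ := by positivity
          linarith
      _ = Real.exp (-(1 / 8) * x⁻¹) * Real.exp (-x⁻¹) ^ n := by
          rw [Real.exp_add, Real.exp_nat_mul]
      _ ≤ _ := by gcongr
  calc 2 * √2 * invSqrtCoeff n * ((√(2 * Real.pi * (2 * n + 1 / 2)))⁻¹ *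
        Real.exp (-((2 * n + 1 / 2 : ℝ) ^ 2) / (2 * x)))
      ≤ 2 * √2 * 1 * ((√Real.pi)⁻¹ * (Real.exp (-(1 / 8) * x⁻¹) * x ^ n)) := by
        have := invSqrtCoeff_le_one n
        gcongr
    _ = _ := by rw [e1]; ring

/-! ### Asymptotics of the limiting ball probabilities -/

theorem gaussianBall_succ_le (v : ℕ → ℝ) (n : ℕ) (x : ℝ) :
    gaussianBall v (n + 1) x ≤ gaussianBall v n x := by
  have h := measurePreserving_piFinSuccAbove
    (fun k : Fin (n + 1) => gaussianReal 0 (v k).toNNReal) (Fin.last n)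
  have hS : MeasurableSet {z : Fin n → ℝ | ∑ k, z k ^ 2 ≤ x} :=
    measurableSet_le (by fun_prop) measurable_const
  have h2 := (measurePreserving_snd (μ := gaussianReal 0 (v (Fin.last n)).toNNReal)
    (ν := Measure.pi fun k : Fin n =>
      gaussianReal 0 (v ((Fin.last n).succAbove k)).toNNReal)).comp h
  have h3 := h2.measureReal_preimage hS.nullMeasurableSet
  have h4 : gaussianBall v n x = (Measure.pi fun k : Fin n =>
      gaussianReal 0 (v ((Fin.last n).succAbove k)).toNNReal).real
        {z : Fin n → ℝ | ∑ k, z k ^ 2 ≤ x} := by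
    simp only [gaussianBall, Fin.succAbove_last, Fin.val_castSucc]
  rw [h4, ← h3]
  refine measureReal_mono fun z hz => ?_
  have hz : ∑ k, z k ^ 2 ≤ x := hz
  rw [Fin.sum_univ_castSucc] at hz
  have h5 : ∑ k : Fin n, z k.castSucc ^ 2 ≤ x := by nlinarith [sq_nonneg (z (Fin.last n))]
  simpa [MeasurableEquiv.piFinSuccAbove, Fin.insertNthEquiv, Fin.removeNth, Fin.init] using h5

/-- This gives the limit distribution function from the variances alone, so the explicit asymptotics
can be stated without a bridge process. -/
theorem exists_tendsto_gaussianBall (v : ℕ → ℝ) (x : ℝ) :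
    ∃ p, Tendsto (fun n => gaussianBall v n x) atTop (𝓝 p) :=
  ⟨_, tendsto_atTop_ciInf (antitone_nat_of_succ_le fun n => gaussianBall_succ_le v n x)
    ⟨0, by rintro _ ⟨n, rfl⟩; exact gaussianBall_nonneg v n x⟩⟩

/-- For almost every z just right of x, p x ≤ p z ≤ U z, and U z is close to U x. Laplace inversion
determines p only almost everywhere; this recovers bounds at every point. -/
theorem Monotone.le_of_ae_le_right {p U : ℝ → ℝ} (hp : Monotone p) {x b : ℝ} (hxb : x < b)
    (hU : ContinuousAt U x) (h : ∀ᵐ z ∂volume.restrict (Set.Ioo x b), p z ≤ U z) :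
    p x ≤ U x := by
  by_contra! hlt
  obtain ⟨l, u, hx, hsub⟩ := mem_nhds_iff_exists_Ioo_subset.1 (hU.eventually_lt_const hlt)
  have hne : (ae (volume.restrict (Set.Ioo x (min u b)))).NeBot := by
    rw [ae_neBot, Ne, Measure.restrict_eq_zero, Real.volume_Ioo]
    simp [hx.2, hxb]
  have h1 := ae_restrict_of_ae_restrict_of_subset
    (Set.Ioo_subset_Ioo_right (min_le_right u b)) h
  obtain ⟨z, hz, hz'⟩ := (h1.and (ae_restrict_mem measurableSet_Ioo)).exists
  have h2 : U z < p x := hsub ⟨hx.1.trans hz'.1, hz'.2.trans_le (min_le_left _ _)⟩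
  exact absurd (hp hz'.1.le) (not_le.2 (hz.trans_lt h2))

theorem Monotone.le_of_ae_le_left {p L : ℝ → ℝ} (hp : Monotone p) {x b : ℝ} (hxb : b < x)
    (hL : ContinuousAt L x) (h : ∀ᵐ z ∂volume.restrict (Set.Ioo b x), L z ≤ p z) :
    L x ≤ p x := by
  by_contra! hlt
  obtain ⟨l, u, hx, hsub⟩ := mem_nhds_iff_exists_Ioo_subset.1 (hL.eventually_const_lt hlt)
  have hne : (ae (volume.restrict (Set.Ioo (max l b) x))).NeBot := by
    rw [ae_neBot, Ne, Measure.restrict_eq_zero, Real.volume_Ioo]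
    simp [hx.1, hxb]
  have h1 := ae_restrict_of_ae_restrict_of_subset
    (Set.Ioo_subset_Ioo_left (le_max_right l b)) h
  obtain ⟨z, hz, hz'⟩ := (h1.and (ae_restrict_mem measurableSet_Ioo)).exists
  have h2 : p x < L z := hsub ⟨(le_max_left _ _).trans_lt hz'.1, hz'.2.trans hx.2⟩
  exact absurd (hp hz'.2.le) (not_le.2 (h2.trans_le hz))

/-- The small ball asymptotics of the Brownian bridge, in terms of its eigenvalues. -/
theorem isEquivalent_limit_gaussianBall_bridge {p : ℝ → ℝ}
    (hp : ∀ x, Tendsto (fun n => gaussianBall (fun k => (dirichletEigenvalue k)⁻¹) n x) atTop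
      (𝓝 (p x))) :
    p ~[𝓝[>] 0] fun x => √(8 / Real.pi) * Real.exp (-(1 / 8) * x⁻¹) := by
  have hb : ∀ k, 0 < (dirichletEigenvalue k)⁻¹ := fun k => inv_pos.2 (dirichletEigenvalue_pos k)
  have hmono : Monotone p := fun x y hxy =>
    le_of_tendsto_of_tendsto' (hp x) (hp y) fun n => gaussianBall_mono _ n hxy
  have hp0 : ∀ x, 0 ≤ p x := fun x => ge_of_tendsto' (hp x) fun n => gaussianBall_nonneg _ _ _
  have hlap : ∀ y, 0 < y → ∫⁻ x in Set.Ioi 0,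
      ENNReal.ofReal (Real.exp (-(y ^ 2 / 2) * x)) * ENNReal.ofReal (p x) =
      ENNReal.ofReal (1 / (y ^ 2 / 2) * (√(Real.sinh y / y))⁻¹) := by
    intro y hy
    refine lintegral_exp_mul_limit_gaussianBall hb (by positivity) (fun x _ => hp x) ?_
      (div_pos (Real.sinh_pos_iff.2 hy) hy)
    refine (tendsto_prod_one_add_div_dirichletEigenvalue hy).congr fun n => ?_
    refine Finset.prod_congr rfl fun k _ => ?_
    ring
  -- Every l > 0 is y²/2 with y = √(2l), so the two transforms agree everywhere on the half-line.
  have hae : (fun x => ENNReal.ofReal (p x)) =ᵐ[volume.restrict (Set.Ioi 0)] bridgeSeries := by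
    have hl : ∀ l : ℝ, 0 < l → l = √(2 * l) ^ 2 / 2 := fun l hl => by
      rw [Real.sq_sqrt (by positivity)]; ring
    refine ae_eq_of_laplace_eq hmono.measurable.ennreal_ofReal.aemeasurable
      measurable_bridgeSeries.aemeasurable (fun l hl0 => ?_) fun l hl0 => ?_
    · rw [hl l hl0, hlap _ (by positivity)]
      exact ENNReal.ofReal_ne_top
    · rw [hl l hl0, hlap _ (by positivity), lintegral_exp_mul_bridgeSeries (by positivity)]
  set D : ℝ → ℝ := fun x => √(8 / Real.pi) * Real.exp (-(1 / 8) * x⁻¹) with hD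
  have hDpos : ∀ x, 0 < D x := fun x => by simp only [hD]; positivity
  have hDc : ∀ x, 0 < x → ContinuousAt D x := fun x hx => by
    have := hx.ne'
    simp only [hD]
    fun_prop (disch := assumption)
  have hupper : ∀ x ∈ Set.Ioo (0 : ℝ) 1, p x ≤ D x * (1 - x)⁻¹ := by
    intro x hx
    have hx1 : 1 - x ≠ 0 := (sub_pos.2 hx.2).ne'
    refine hmono.le_of_ae_le_right (U := fun x => D x * (1 - x)⁻¹) hx.2
      ((hDc x hx.1).mul (by fun_prop (disch := assumption))) ?_
    filter_upwards [ae_restrict_of_ae_restrict_of_subset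
      (Set.Ioo_subset_Ioi_self.trans (Set.Ioi_subset_Ioi hx.1.le)) hae,
      ae_restrict_mem measurableSet_Ioo] with z hz hz'
    have h1 := bridgeSeries_le (hx.1.trans hz'.1) hz'.2
    rw [← hz] at h1
    refine (ENNReal.ofReal_le_ofReal_iff ?_).1 h1
    exact mul_nonneg (hDpos z).le (inv_nonneg.2 (sub_pos.2 hz'.2).le)
  have hlower : ∀ x, 0 < x → D x * (1 - 3 / 2 * x) ≤ p x := by
    intro x hx
    refine hmono.le_of_ae_le_left (L := fun x => D x * (1 - 3 / 2 * x)) hx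
      ((hDc x hx).mul (by fun_prop)) ?_
    filter_upwards [ae_restrict_of_ae_restrict_of_subset Set.Ioo_subset_Ioi_self hae,
      ae_restrict_mem measurableSet_Ioo] with z hz hz'
    have h1 := le_bridgeSeries hz'.1
    rw [← hz] at h1
    exact (ENNReal.ofReal_le_ofReal_iff (hp0 z)).1 h1
  refine isEquivalent_of_tendsto_one ?_
  refine tendsto_of_tendsto_of_tendsto_of_le_of_le' (g := fun x : ℝ => 1 - 3 / 2 * x)
    (h := fun x : ℝ => (1 - x)⁻¹) ?_ ?_ ?_ ?_
  · have : ContinuousAt (fun x : ℝ => 1 - 3 / 2 * x) 0 := by fun_prop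
    have := this.tendsto.mono_left (nhdsWithin_le_nhds (s := Set.Ioi 0))
    simpa using this
  · have : ContinuousAt (fun x : ℝ => (1 - x)⁻¹) 0 := by
      have h1 : (1 - 0 : ℝ) ≠ 0 := by norm_num
      fun_prop (disch := assumption)
    have := this.tendsto.mono_left (nhdsWithin_le_nhds (s := Set.Ioi 0))
    simpa using this
  · filter_upwards [self_mem_nhdsWithin] with x hx
    rw [Pi.div_apply, le_div_iff₀ (hDpos x), mul_comm]
    exact hlower x hx
  · filter_upwards [Ioo_mem_nhdsGT one_pos] with x hx
    rw [Pi.div_apply, div_le_iff₀ (hDpos x), mul_comm]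
    exact hupper x hx

theorem isEquivalent_of_le_exp_mul {p q : ℝ → ℝ} {C M : ℝ} (hM : 0 ≤ M)
    (hq : ∀ x, 0 ≤ q x) (hC : 0 ≤ C)
    (h : ∀ x, 0 < x → p x ≤ C * Real.exp (M * x / 2) * q x ∧ C * q x ≤ Real.exp (M * x / 2) * p x) :
    p ~[𝓝[>] 0] fun x => C * q x := by
  refine isLittleO_iff.2 fun c hc => ?_
  have hcont : ContinuousAt (fun x : ℝ => Real.exp (M * x / 2) - 1) 0 := by fun_prop
  have hlim := hcont.tendsto.mono_left (nhdsWithin_le_nhds (s := Set.Ioi 0))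
  simp only [mul_zero, zero_div, Real.exp_zero, sub_self] at hlim
  filter_upwards [hlim.eventually_lt_const hc, self_mem_nhdsWithin] with x hx hx0
  obtain ⟨h1, h2⟩ := h x hx0
  have hx0 : 0 < x := hx0
  have hCq : 0 ≤ C * q x := mul_nonneg hC (hq x)
  have he : 1 ≤ Real.exp (M * x / 2) := Real.one_le_exp (by positivity)
  set e := Real.exp (M * x / 2)
  rw [Pi.sub_apply, Real.norm_eq_abs, Real.norm_eq_abs, abs_of_nonneg hCq, abs_le]
  constructor
  · nlinarith [mul_le_mul_of_nonneg_right hx.le hCq, mul_le_mul_of_nonneg_right he hCq]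
  · nlinarith [mul_le_mul_of_nonneg_right hx.le hCq]

/-! ### The demeaned process -/

theorem demean_eq {Ω : Type*} (X : unitInterval → Ω → ℝ) (t : unitInterval) (ω : Ω) :
    demean X t ω = X t ω - pathCoord X (fun _ => 1) ω := by
  simp [demean, pathCoord]

namespace IsCenteredGaussianProcess

variable {Ω : Type*} [MeasurableSpace Ω] {P : Measure Ω}
  {K : unitInterval → unitInterval → ℝ} {X : unitInterval → Ω → ℝ}

theorem memLp (hX : IsCenteredGaussianProcess K X P) (t : unitInterval) : MemLp (X t) 2 P :=
  (hX.gaussian.hasGaussianLaw_eval t).memLp_two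

variable [IsProbabilityMeasure P]

theorem integral_mul (hX : IsCenteredGaussianProcess K X P) (t s : unitInterval) :
    ∫ ω, X t ω * X s ω ∂P = K t s := by
  have h := covariance_eq_sub (hX.memLp t) (hX.memLp s)
  rw [hX.mean_zero, zero_mul, sub_zero, hX.covariance] at h
  exact h.symm

theorem isProcessIn (hX : IsCenteredGaussianProcess K X P)
    (hK : Continuous fun p : unitInterval × unitInterval => K p.1 p.2) :
    IsProcessIn (gaussianSpace X P) X where
  isClosed := Submodule.isClosed_topologicalClosure _
  aemeasurable := hX.aemeasurable
  mem t := ⟨(hX.memLp t).toLp,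
    Submodule.le_topologicalClosure _ (Submodule.subset_span ⟨t, (hX.memLp t).coeFn_toLp⟩),
    (hX.memLp t).coeFn_toLp.symm⟩
  bounded := by
    obtain ⟨C, _, hC⟩ := (hK.comp (continuous_id.prodMk continuous_id)).exists_abs_le
    refine ⟨C, fun t => ?_⟩
    simp_rw [sq]
    rw [hX.integral_mul]
    exact (le_abs_self _).trans (hC t)

theorem integral_demean_mul (hX : IsCenteredGaussianProcess K X P)
    (hK : Continuous fun p : unitInterval × unitInterval => K p.1 p.2) (t s : unitInterval) :
    ∫ ω, demean X t ω * demean X s ω ∂P = centerKernel K t s := by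
  have hZ := hX.isProcessIn hK
  set Y := pathCoord X fun _ => 1 with hY
  have hY2 : MemLp Y 2 P := hZ.memLp_pathCoord continuous_const
  have h1 : ∀ t, ∫ ω, X t ω * Y ω ∂P = ∫ r, K t r := fun t => by
    rw [hZ.integral_mul_pathCoord (hX.memLp t) continuous_const]
    simp_rw [hX.integral_mul, mul_one]
  have h2 : ∫ ω, Y ω * Y ω ∂P = ∫ r, ∫ q, K r q := by
    rw [hZ.integral_mul_pathCoord hY2 continuous_const]
    simp_rw [mul_comm (Y _), h1, mul_one]
  have i1 := (hX.memLp t).integrable_mul (hX.memLp s)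
  have i2 := (hX.memLp t).integrable_mul hY2
  have i3 := (hX.memLp s).integrable_mul hY2
  have i4 := hY2.integrable_mul hY2
  have h3 : ∀ ω, demean X t ω * demean X s ω =
      X t ω * X s ω - X t ω * Y ω - X s ω * Y ω + Y ω * Y ω := fun ω => by
    rw [demean_eq, demean_eq]; ring
  simp_rw [h3]
  refine (integral_add ((i1.sub i2).sub i3) i4).trans ?_
  rw [centerKernel, ← h2]
  congr 1
  refine (integral_sub (i1.sub i2) i3).trans ?_
  rw [← h1 t, ← h1 s, ← hX.integral_mul]
  congr 1
  exact integral_sub i1 i2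

theorem isProcessIn_demean (hX : IsCenteredGaussianProcess K X P)
    (hK : Continuous fun p : unitInterval × unitInterval => K p.1 p.2) :
    IsProcessIn (gaussianSpace X P) (demean X) where
  isClosed := Submodule.isClosed_topologicalClosure _
  aemeasurable := by
    have h := ((hX.isProcessIn hK).memLp_pathCoord (f := fun _ => 1)
      continuous_const).1.aemeasurable.comp_snd (μ := (volume : Measure unitInterval))
    simp_rw [demean_eq]
    exact hX.aemeasurable.sub h
  mem t := by
    obtain ⟨x, hx, hxX⟩ := (hX.isProcessIn hK).mem t
    obtain ⟨y, hy, hyY⟩ := (hX.isProcessIn hK).pathCoord_mem (f := fun _ => 1) continuous_const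
    refine ⟨x - y, sub_mem hx hy, ?_⟩
    filter_upwards [hxX, hyY, Lp.coeFn_sub x y] with ω h1 h2 h3
    rw [demean_eq, h3, Pi.sub_apply, h1, h2]
  bounded := by
    obtain ⟨C, _, hC⟩ := ((continuous_centerKernel hK).comp
      (continuous_id.prodMk continuous_id)).exists_abs_le
    refine ⟨C, fun t => ?_⟩
    simp_rw [sq]
    rw [hX.integral_demean_mul hK]
    exact (le_abs_self _).trans (hC t)

theorem covariance_demean (hX : IsCenteredGaussianProcess K X P)
    (hK : Continuous fun p : unitInterval × unitInterval => K p.1 p.2) (t s : unitInterval) :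
    cov[demean X t, demean X s; P] = centerKernel K t s := by
  have hZ := hX.isProcessIn hK
  have hmean : ∫ ω, demean X t ω ∂P = 0 := by
    have h1 := hZ.integral_mul_pathCoord (memLp_const (1 : ℝ)) (f := fun _ => 1) continuous_const
    simp only [one_mul, mul_one, hX.mean_zero, integral_zero] at h1
    simp_rw [demean_eq]
    rw [integral_sub ((hX.memLp t).integrable (by norm_num))
      ((hZ.memLp_pathCoord continuous_const).integrable (by norm_num)), h1, hX.mean_zero, sub_zero]
  have hW := hX.isProcessIn_demean hK
  rw [covariance_eq_sub (hW.memLp t) (hW.memLp s), hmean, zero_mul, sub_zero]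
  exact hX.integral_demean_mul hK t s

end IsCenteredGaussianProcess

/-! ### Completeness of the list of eigenvalues -/

/-- Self-adjointness of the integral operator; eigenfunctions with different eigenvalues are
therefore orthogonal. -/
theorem integral_mul_eigenfunction_comm {R : unitInterval → unitInterval → ℝ}
    (hR : Continuous fun p : unitInterval × unitInterval => R p.1 p.2)
    (hsymm : ∀ t s, R t s = R s t) {u v : unitInterval → ℝ} (hu : Continuous u) (hv : Continuous v)
    {a b : ℝ} (hua : ∀ t, ∫ s, R t s * u s = a * u t) (hvb : ∀ t, ∫ s, R t s * v s = b * v t) :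
    a * ∫ t, u t * v t = b * ∫ t, u t * v t := by
  have hc : Continuous fun p : unitInterval × unitInterval => R p.1 p.2 * u p.2 * v p.1 := by
    fun_prop
  have h := integral_integral_swap (μ := (volume : Measure unitInterval)) (ν := volume)
    (f := fun t s => R t s * u s * v t) hc.integrable_unitInterval_prod
  have h1 : ∀ t, ∫ s, R t s * u s * v t = a * (u t * v t) := fun t => by
    rw [integral_mul_const, hua]; ring
  have h2 : ∀ s, ∫ t, R t s * u s * v t = b * (u s * v s) := fun s => by
    have : ∀ t, R t s * u s * v t = u s * (R s t * v t) := fun t => by rw [hsymm]; ring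
    simp_rw [this]
    rw [integral_const_mul, hvb]; ring
  simp_rw [h1, h2, integral_const_mul] at h
  exact h

theorem integral_sq_pos {u : unitInterval → ℝ} (hu : Continuous u) (h0 : u ≠ 0) :
    0 < ∫ t, u t * u t := by
  obtain ⟨t, ht⟩ := Function.ne_iff.1 h0
  have hv : Continuous (Set.IccExtend (zero_le_one' ℝ) u) := hu.Icc_extend'
  have h1 : ∀ t : unitInterval, u t = Set.IccExtend (zero_le_one' ℝ) u t := fun t =>
    (Set.IccExtend_val (zero_le_one' ℝ) u t).symm
  simp_rw [h1]
  rw [integral_unitInterval fun t => Set.IccExtend (zero_le_one' ℝ) u t *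
    Set.IccExtend (zero_le_one' ℝ) u t]
  refine intervalIntegral.integral_pos one_pos (hv.mul hv).continuousOn
    (fun _ _ => mul_self_nonneg _) ⟨t, t.2, ?_⟩
  rw [← h1]
  exact mul_self_pos.2 ht

theorem exists_orthonormal_eigenfunctions {R : unitInterval → unitInterval → ℝ}
    (hR : Continuous fun p : unitInterval × unitInterval => R p.1 p.2)
    (hsymm : ∀ t s, R t s = R s t) {m : ℕ → ℝ} (hm : Function.Injective m)
    (h : ∀ k, ∃ u : unitInterval → ℝ, Continuous u ∧ u ≠ 0 ∧ ∀ t, ∫ s, R t s * u s = m k * u t) :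
    ∃ e : ℕ → unitInterval → ℝ, (∀ k, Continuous (e k)) ∧
      (∀ i j, ∫ t, e i t * e j t = if i = j then 1 else 0) ∧
      ∀ k t, ∫ s, R t s * e k s = m k * e k t := by
  choose u hu hu0 hum using h
  have hpos := fun k => integral_sq_pos (hu k) (hu0 k)
  refine ⟨fun k t => (√(∫ t, u k t * u k t))⁻¹ * u k t, fun k => (hu k).const_mul _, fun i j => ?_,
    fun k t => ?_⟩
  · have h1 : ∀ t, (√(∫ t, u i t * u i t))⁻¹ * u i t * ((√(∫ t, u j t * u j t))⁻¹ * u j t) =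
        (√(∫ t, u i t * u i t))⁻¹ * (√(∫ t, u j t * u j t))⁻¹ * (u i t * u j t) := fun t => by ring
    simp_rw [h1]
    rw [integral_const_mul]
    split_ifs with hij
    · subst hij
      rw [← mul_inv, Real.mul_self_sqrt (hpos i).le, inv_mul_cancel₀ (hpos i).ne']
    · have h2 := integral_mul_eigenfunction_comm hR hsymm (hu i) (hu j) (hum i) (hum j)
      have h3 : (m i - m j) * ∫ t, u i t * u j t = 0 := by linear_combination h2
      rw [(mul_eq_zero.1 h3).resolve_left (sub_ne_zero.2 fun h => hij (hm h)), mul_zero]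
  · have h1 : ∀ s, R t s * ((√(∫ t, u k t * u k t))⁻¹ * u k s) =
        (√(∫ t, u k t * u k t))⁻¹ * (R t s * u k s) := fun s => by ring
    simp_rw [h1]
    rw [integral_const_mul, hum]
    ring

/-- The equation holds at every t, so u is m⁻¹ times its own integral transform, which is continuous
for a continuous kernel. -/
theorem continuous_of_mem_kernelEigenspace {R : unitInterval → unitInterval → ℝ}
    (hR : Continuous fun p : unitInterval × unitInterval => R p.1 p.2) {m : ℝ} (hm : m ≠ 0)
    {u : unitInterval → ℝ} (hu : u ∈ kernelEigenspace R m) : Continuous u := by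
  obtain ⟨hu2, hum⟩ := hu
  obtain ⟨C, hC⟩ := isCompact_univ.exists_bound_of_continuousOn hR.continuousOn
  have h1 : Continuous fun t => ∫ s, R t s * u s := by
    refine continuous_of_dominated (bound := fun s => C * |u s|) (fun t => (hum t).1.1)
      (fun t => .of_forall fun s => ?_) ((hu2.integrable (by norm_num)).abs.const_mul C)
      (.of_forall fun s => ?_)
    · rw [norm_mul, Real.norm_eq_abs (u s)]
      exact mul_le_mul_of_nonneg_right (hC (t, s) trivial) (abs_nonneg _)
    · exact (hR.comp (continuous_id.prodMk continuous_const)).mul continuous_const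
  have h2 : u = fun t => m⁻¹ * ∫ s, R t s * u s := by
    funext t; rw [(hum t).2, inv_mul_cancel_left₀ hm]
  rw [h2]
  exact h1.const_mul _

/-- Otherwise the normalized u, adjoined at the index `none`, would enlarge the orthonormal system,
and the eigenvalues would sum to more than the trace, by c. -/
theorem eigenfunction_eq_zero {Ω : Type*} [MeasurableSpace Ω] {P : Measure Ω}
    [IsProbabilityMeasure P] {W : Submodule ℝ (Lp ℝ 2 P)} {Z : unitInterval → Ω → ℝ}
    (hZ : IsProcessIn W Z) {e : ℕ → unitInterval → ℝ} {m : ℕ → ℝ}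
    (he : ∀ i, Continuous (e i)) (ho : ∀ i j, ∫ t, e i t * e j t = if i = j then 1 else 0)
    (hem : ∀ i t, ∫ r, (∫ ω, Z t ω * Z r ω ∂P) * e i r = m i * e i t)
    (hs : Summable m) (htr : ∫ t, (∫ ω, Z t ω * Z t ω ∂P) ≤ ∑' i, m i)
    {u : unitInterval → ℝ} (hu : Continuous u) {c : ℝ} (hc : 0 < c)
    (huc : ∀ t, ∫ r, (∫ ω, Z t ω * Z r ω ∂P) * u r = c * u t)
    (huo : ∀ i, ∫ t, e i t * u t = 0) : u = 0 := by
  by_contra hu0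
  have hpos := integral_sq_pos hu hu0
  set d := (√(∫ t, u t * u t))⁻¹ with hd
  set f : Option ℕ → unitInterval → ℝ := fun o => o.elim (fun t => d * u t) e with hf
  set n : Option ℕ → ℝ := fun o => o.elim c m with hn
  have hfc : ∀ o, Continuous (f o) := fun o => by
    cases o with
    | none => exact hu.const_mul d
    | some i => exact he i
  have h1 : ∀ i, ∫ t, e i t * (d * u t) = 0 := fun i => by
    simp_rw [mul_left_comm _ d]
    rw [integral_const_mul, huo, mul_zero]
  have hfo : ∀ o o', ∫ t, f o t * f o' t = if o = o' then 1 else 0 := by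
    intro o o'
    cases o with
    | none =>
      cases o' with
      | none =>
        have : ∀ t, d * u t * (d * u t) = d * d * (u t * u t) := fun t => by ring
        simp only [hf, Option.elim_none, this, if_true]
        rw [integral_const_mul, hd, ← mul_inv, Real.mul_self_sqrt hpos.le,
          inv_mul_cancel₀ hpos.ne']
      | some j =>
        simp only [hf, Option.elim_none, Option.elim_some, reduceCtorEq, if_false]
        simp_rw [mul_comm _ (e j _)]
        exact h1 j
    | some i =>
      cases o' with
      | none => simpa [hf] using h1 i
      | some j => simpa [hf] using ho i j
  have hfn : ∀ o t, ∫ r, (∫ ω, Z t ω * Z r ω ∂P) * f o r = n o * f o t := by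
    intro o t
    cases o with
    | none =>
      simp only [hf, hn, Option.elim_none]
      simp_rw [mul_left_comm _ d]
      rw [integral_const_mul, huc]
    | some i => exact hem i t
  have hle : ∀ s : Finset ℕ, ∑ i ∈ s, m i ≤ ∑' i, m i - c := by
    intro s
    have h2 := sum_eigenvalues_le hZ (Finset.insertNone s) hfc (fun i _ j _ => hfo i j)
      fun i _ => hfn i
    rw [Finset.sum_insertNone] at h2
    have h3 : c + ∑ i ∈ s, m i ≤ ∑' i, m i := h2.trans htr
    linarith
  have := hs.tsum_le_of_sum_le hle
  linarith

/-- An eigenfunction for c is orthogonal to all e i with m i ≠ c. Subtracting its projection on the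
only possible e k with m k = c leaves zero, so each eigenspace is spanned by that e k or is trivial.
-/
theorem isEigenvalueSequence_of_trace_le {Ω : Type*} [MeasurableSpace Ω] {P : Measure Ω}
    [IsProbabilityMeasure P] {W : Submodule ℝ (Lp ℝ 2 P)} {Z : unitInterval → Ω → ℝ}
    (hZ : IsProcessIn W Z) {R : unitInterval → unitInterval → ℝ}
    (hR : Continuous fun p : unitInterval × unitInterval => R p.1 p.2)
    (hZR : ∀ t s, ∫ ω, Z t ω * Z s ω ∂P = R t s) {e : ℕ → unitInterval → ℝ} {m : ℕ → ℝ}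
    (he : ∀ i, Continuous (e i)) (ho : ∀ i j, ∫ t, e i t * e j t = if i = j then 1 else 0)
    (hem : ∀ i t, ∫ r, R t r * e i r = m i * e i t)
    (hs : Summable m) (htr : ∫ t, R t t ≤ ∑' i, m i) (hm : StrictAnti m) (hm0 : ∀ k, 0 < m k) :
    IsEigenvalueSequence R m := by
  refine ⟨hm0, hm.antitone, fun c hc => ?_⟩
  have hsymm : ∀ t s, R t s = R s t := fun t s => by simp_rw [← hZR, mul_comm]
  have key : ∀ u ∈ kernelEigenspace R c, (∀ i, m i = c → ∫ t, e i t * u t = 0) → u = 0 := by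
    intro u hu huo
    have huc := continuous_of_mem_kernelEigenspace hR hc.ne' hu
    refine eigenfunction_eq_zero hZ he ho (by simpa only [hZR] using hem) hs
      (by simpa only [hZR] using htr) huc hc (by simpa only [hZR] using fun t => (hu.2 t).2)
      fun i => ?_
    by_cases hi : m i = c
    · exact huo i hi
    · have h1 := integral_mul_eigenfunction_comm hR hsymm (he i) huc (hem i) fun t => (hu.2 t).2
      have h2 : (m i - c) * ∫ t, e i t * u t = 0 := by linear_combination h1
      exact (mul_eq_zero.1 h2).resolve_left (sub_ne_zero.2 hi)
  by_cases hex : ∃ k, m k = c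
  · obtain ⟨k, hk⟩ := hex
    have hek : e k ∈ kernelEigenspace R c := by
      obtain ⟨C, _, hC⟩ := (he k).exists_abs_le
      refine ⟨MemLp.of_bound (he k).aestronglyMeasurable C (.of_forall hC), fun t =>
        ⟨Continuous.integrable_unitInterval ?_, hk ▸ hem k t⟩⟩
      exact (hR.comp (continuous_const.prodMk continuous_id)).mul (he k)
    have h1 : Cardinal.mk {k // m k = c} = 1 := by
      rw [Cardinal.eq_one_iff_unique]
      exact ⟨⟨fun a b => Subtype.ext (hm.injective (a.2.trans b.2.symm))⟩, ⟨⟨k, hk⟩⟩⟩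
    have h2 : Module.finrank ℝ (kernelEigenspace R c) = 1 := by
      refine finrank_eq_one ⟨e k, hek⟩ (fun h => ?_) fun w => ?_
      · have h3 : e k = 0 := congrArg Subtype.val h
        have h4 := ho k k
        simp [h3] at h4
      · obtain ⟨w, hw⟩ := w
        have hwc := continuous_of_mem_kernelEigenspace hR hc.ne' hw
        refine ⟨∫ t, e k t * w t, Subtype.ext ?_⟩
        have h3 := key (w - (∫ t, e k t * w t) • e k)
          (Submodule.sub_mem _ hw (Submodule.smul_mem _ _ hek)) fun i hi => by
            obtain rfl : i = k := hm.injective (hi.trans hk.symm)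
            have h4 : ∀ t, e i t * (w - (∫ t, e i t * w t) • e i) t =
                e i t * w t - (∫ t, e i t * w t) * (e i t * e i t) := fun t => by
              simp only [Pi.sub_apply, Pi.smul_apply, smul_eq_mul]; ring
            simp_rw [h4]
            have h5 : Continuous fun t => e i t * w t := (he i).mul hwc
            have h6 : Continuous fun s => (∫ t, e i t * w t) * (e i s * e i s) := by fun_prop
            rw [integral_sub h5.integrable_unitInterval h6.integrable_unitInterval,
              integral_const_mul, ho i i, if_pos rfl, mul_one, sub_self]
        exact (sub_eq_zero.1 h3).symm
    rw [h1, Module.rank_eq_one_iff_finrank_eq_one.2 h2]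
  · have : IsEmpty {k // m k = c} := ⟨fun k => hex ⟨k, k.2⟩⟩
    rw [Cardinal.mk_eq_zero, eq_comm, rank_zero_iff_forall_zero]
    exact fun u => Subtype.ext (key u u.2 fun i hi => (hex ⟨i, hi⟩).elim)

/-- Equal multiplicities give fibers of equal size, so μ is injective with the range of ν; a
strictly decreasing sequence is determined by its range. -/
theorem IsEigenvalueSequence.eq_of_strictAnti {R : unitInterval → unitInterval → ℝ} {μ ν : ℕ → ℝ}
    (hμ : IsEigenvalueSequence R μ) (hν : IsEigenvalueSequence R ν) (hanti : StrictAnti ν) :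
    μ = ν := by
  have hcard : ∀ c, 0 < c → Cardinal.mk {k // μ k = c} = Cardinal.mk {k // ν k = c} := fun c hc =>
    (hμ.multiplicity c hc).trans (hν.multiplicity c hc).symm
  have hequiv : ∀ c, 0 < c → Nonempty ({k // μ k = c} ≃ {k // ν k = c}) := fun c hc =>
    Cardinal.eq.1 (hcard c hc)
  have hinj : Function.Injective μ := by
    intro i j hij
    obtain ⟨φ⟩ := hequiv (μ j) (hμ.pos j)
    have h1 : φ ⟨i, hij⟩ = φ ⟨j, rfl⟩ :=
      Subtype.ext (hanti.injective ((φ ⟨i, hij⟩).2.trans (φ ⟨j, rfl⟩).2.symm))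
    exact congrArg Subtype.val (φ.injective h1)
  have hrange : Set.range μ = Set.range ν := by
    ext c
    constructor
    · rintro ⟨k, rfl⟩
      obtain ⟨φ⟩ := hequiv (μ k) (hμ.pos k)
      exact ⟨φ ⟨k, rfl⟩, (φ ⟨k, rfl⟩).2⟩
    · rintro ⟨k, rfl⟩
      obtain ⟨φ⟩ := hequiv (ν k) (hν.pos k)
      exact ⟨φ.symm ⟨k, rfl⟩, (φ.symm ⟨k, rfl⟩).2⟩
  have h := StrictMono.range_inj (hμ.antitone.strictAnti_of_injective hinj).dual_right
    hanti.dual_right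
  have h2 : OrderDual.toDual ∘ μ = OrderDual.toDual ∘ ν :=
    h.1 (by rw [Set.range_comp, Set.range_comp, hrange])
  exact funext fun k => congrFun h2 k

/-! ### The bridge and the main theorem -/

theorem tendsto_gaussianBall_smallBall_bridge {Ω : Type*} [MeasurableSpace Ω] {P : Measure Ω}
    [IsProbabilityMeasure P] {B : unitInterval → Ω → ℝ}
    (hB : IsCenteredGaussianProcess bridgeKernel B P) {ε : ℝ} (hε : 0 ≤ ε) :
    Tendsto (fun n => gaussianBall (fun k => (dirichletEigenvalue k)⁻¹) n (ε ^ 2)) atTop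
      (𝓝 (smallBall B P ε)) := by
  obtain ⟨e, he, ho, hem⟩ := exists_orthonormal_eigenfunctions continuous_bridgeKernel
    (fun t s => by simp only [bridgeKernel, min_comm, mul_comm])
    (m := fun k => (dirichletEigenvalue k)⁻¹)
    (fun i j hij => dirichletEigenvalue_strictMono.injective (inv_injective hij)) fun k => by
      refine ⟨fun t => Real.sin (Real.pi * (k + 1) * t), by fun_prop, fun h => ?_,
        integral_bridgeKernel_mul_sin k⟩
      have ht : (1 / (2 * (k + 1)) : ℝ) ∈ unitInterval := by
        refine ⟨by positivity, ?_⟩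
        rw [div_le_one (by positivity)]
        linarith [(Nat.cast_nonneg k : (0 : ℝ) ≤ k)]
      have h1 := congrFun h ⟨_, ht⟩
      have h2 : Real.pi * (k + 1) * (1 / (2 * (k + 1))) = Real.pi / 2 := by field_simp
      simp only [h2, Real.sin_pi_div_two, Pi.zero_apply, one_ne_zero] at h1
  refine tendsto_gaussianBall_smallBall hB.gaussian hB.mean_zero
    (hB.isProcessIn continuous_bridgeKernel) he ho ?_ summable_inv_dirichletEigenvalue ?_ hε
  · simpa only [hB.integral_mul] using hem
  · simp only [hB.integral_mul]
    rw [integral_bridgeKernel_diag, tsum_inv_dirichletEigenvalue]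

theorem tendsto_sq_nhdsGT_zero : Tendsto (fun ε : ℝ => ε ^ 2) (𝓝[>] 0) (𝓝[>] 0) := by
  refine tendsto_nhdsWithin_iff.2 ⟨?_, ?_⟩
  · have h := ((continuous_pow 2).tendsto (0 : ℝ)).mono_left (nhdsWithin_le_nhds (s := Set.Ioi 0))
    simpa using h
  · filter_upwards [self_mem_nhdsWithin] with x hx
    exact pow_pos (Set.mem_Ioi.1 hx) 2

theorem mainTheorem5 {Ω : Type*} [MeasurableSpace Ω] (P : Measure Ω) [IsProbabilityMeasure P]
    (β : ℝ) (hβ : 0 < β) (X : unitInterval → Ω → ℝ)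
    (hX : IsCenteredGaussianProcess (ouZeroKernel β) X P) :
    (∃ μ : ℕ → ℝ, IsEigenvalueSequence (fun t s => cov[demean X t, demean X s; P]) μ) ∧
    (∀ μ : ℕ → ℝ, IsEigenvalueSequence (fun t s => cov[demean X t, demean X s; P]) μ →
      Tendsto (fun n : ℕ => ∏ k ∈ Finset.range n, ((Real.pi * ((k : ℝ) + 1)) ^ 2)⁻¹ / μ k)
        atTop (𝓝 (Real.exp β))) ∧
    (∀ {Ω' : Type*} [MeasurableSpace Ω'] (P' : Measure Ω') [IsProbabilityMeasure P']
      (B : unitInterval → Ω' → ℝ), IsCenteredGaussianProcess bridgeKernel B P' →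
      smallBall (demean X) P ~[𝓝[>] 0] fun ε => Real.exp (β / 2) * smallBall B P' ε) ∧
    smallBall (demean X) P ~[𝓝[>] 0]
      fun ε => (8 * Real.exp β / Real.pi) ^ (1 / 2 : ℝ) * Real.exp (-(1 / 8) * (ε ^ 2)⁻¹) := by
  have hpi := Real.pi_pos
  obtain ⟨ω, hω1, hω2, hF, ⟨M, hM⟩, hprod⟩ := exists_ou_frequencies hβ
  set R := centerKernel (ouZeroKernel β) with hR
  have hK := continuous_ouZeroKernel β
  have hcov : (fun t s => cov[demean X t, demean X s; P]) = R :=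
    funext fun t => funext fun s => hX.covariance_demean hK t s
  rw [hcov]
  have hω0 : ∀ k, 0 < ω k := fun k => lt_trans (by positivity) (hω1 k)
  have hlt : ∀ k, dirichletEigenvalue k < ω k ^ 2 := fun k => by
    have := hω1 k
    unfold dirichletEigenvalue
    gcongr
  set m : ℕ → ℝ := fun k => (ω k ^ 2 + β ^ 2)⁻¹ with hm
  have hm0 : ∀ k, 0 < m k := fun k => by have := hω0 k; simp only [hm]; positivity
  have hanti : StrictAnti m := strictAnti_nat_of_succ_lt fun k => by
    have h1 : ω k < ω (k + 1) := (hω2 k).trans ((le_of_eq (by push_cast; ring)).trans_lt (hω1 (k + 1)))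
    have h2 := hω0 k
    simp only [hm]
    gcongr
  have hsum : Summable m := Summable.of_nonneg_of_le (fun k => (hm0 k).le) (fun k => by
    have h1 := dirichletEigenvalue_pos k
    have h2 := (hlt k).le
    simp only [hm]
    gcongr
    nlinarith) summable_inv_dirichletEigenvalue
  -- This inequality serves twice: it rules out further eigenvalues and it yields the expansion of
  -- the path norm.
  have htr : ∫ t, R t t ≤ ∑' k, m k := by
    rw [hR, integral_ouZeroKernel_center_diag hβ]
    exact ouTrace_le_tsum hβ hprod hsum
  have hRc : Continuous fun p : unitInterval × unitInterval => R p.1 p.2 := continuous_centerKernel hK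
  obtain ⟨e, he, ho, hem⟩ := exists_orthonormal_eigenfunctions hRc
    (fun t s => by simp only [hR, centerKernel, ouZeroKernel_comm β t s]; ring) hanti.injective
    fun k => exists_ou_eigenfunction hβ (hω0 k) (hF k) (sin_ne_zero_of_mem_Ioo (hω1 k) (hω2 k))
  have hZ := hX.isProcessIn_demean hK
  have hZR := hX.integral_demean_mul hK
  have hseq : IsEigenvalueSequence R m :=
    isEigenvalueSequence_of_trace_le hZ hRc hZR he ho hem hsum htr hanti hm0
  have hlim : Tendsto (fun n : ℕ => ∏ k ∈ Finset.range n, (dirichletEigenvalue k)⁻¹ / m k) atTop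
      (𝓝 (Real.exp β)) := by
    rw [← ouDet_self hβ]
    refine (hprod β hβ).congr fun n => Finset.prod_congr rfl fun k _ => ?_
    simp only [hm]
    rw [div_inv_eq_mul, mul_comm, div_eq_mul_inv]
  have hball : ∀ ε, 0 ≤ ε →
      Tendsto (fun n => gaussianBall m n (ε ^ 2)) atTop (𝓝 (smallBall (demean X) P ε)) :=
    fun ε hε => tendsto_gaussianBall_smallBall hX.gaussian hX.mean_zero hZ he ho
      (by simpa only [hZR] using hem) hsum (by simpa only [hZR] using htr) hε
  choose q hq using exists_tendsto_gaussianBall m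
  choose p hp using exists_tendsto_gaussianBall fun k => (dirichletEigenvalue k)⁻¹
  have hsqrt : √(Real.exp β) = Real.exp (β / 2) := (Real.exp_half β).symm
  -- The reciprocal eigenvalues differ by ω_k² + β² - a_k, which is nonnegative and bounded because
  -- the zeros stay at bounded distance from the poles.
  have hM' : ∀ k, |1 / (dirichletEigenvalue k)⁻¹ - 1 / m k| ≤ M + β ^ 2 := fun k => by
    simp only [hm, one_div, inv_inv]
    rw [abs_sub_comm, abs_of_nonneg (by nlinarith [hlt k])]
    linarith [hM k]
  have hqp : q ~[𝓝[>] 0] fun x => Real.exp (β / 2) * p x := by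
    refine isEquivalent_of_le_exp_mul (M := M + β ^ 2) ((abs_nonneg _).trans (hM' 0))
      (fun x => ge_of_tendsto' (hp x) fun n => gaussianBall_nonneg _ _ _) (Real.exp_pos _).le
      fun x _ => ?_
    rw [← hsqrt]
    exact limit_gaussianBall_mem hm0 (fun k => inv_pos.2 (dirichletEigenvalue_pos k)) hM' hlim
      (hq x) (hp x)
  have hXp : smallBall (demean X) P ~[𝓝[>] 0] fun ε => Real.exp (β / 2) * p (ε ^ 2) := by
    refine (hqp.comp_tendsto tendsto_sq_nhdsGT_zero).congr_left ?_
    filter_upwards [self_mem_nhdsWithin] with ε hε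
    exact tendsto_nhds_unique (hq (ε ^ 2)) (hball ε (le_of_lt hε))
  refine ⟨⟨m, hseq⟩, fun μ hμ => ?_, fun P' _ B hB => ?_, ?_⟩
  · rw [hμ.eq_of_strictAnti hseq hanti]
    exact hlim
  · refine hXp.congr_right ?_
    filter_upwards [self_mem_nhdsWithin] with ε hε
    rw [tendsto_nhds_unique (hp (ε ^ 2)) (tendsto_gaussianBall_smallBall_bridge hB (le_of_lt hε))]
  · have h := (isEquivalent_limit_gaussianBall_bridge hp).comp_tendsto tendsto_sq_nhdsGT_zero
    have h2 := (IsEquivalent.refl (u := fun _ : ℝ => Real.exp (β / 2)) (l := 𝓝[>] (0 : ℝ))).mul h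
    refine (hXp.trans h2).congr_right (.of_forall fun ε => ?_)
    simp only [Function.comp_apply, Pi.mul_apply]
    rw [← hsqrt, ← mul_assoc, ← Real.sqrt_mul (Real.exp_pos β).le, ← Real.sqrt_eq_rpow]
    rw [show Real.exp β * (8 / Real.pi) = 8 * Real.exp β / Real.pi by ring]
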